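/- Fix an odd prime $p$. All groups below are pro-$p$-groups; homomorphisms are continuous and subgroups are closed. A $\sigma$-pro-$p$-group is a pro-$p$-group $G$ with a continuous action of a group $\{1,\sigma\}$ of order two; $\sigma$-homomorphisms are the $\sigma$-equivariant homomorphisms, $\mathrm{Aut}_\sigma(G)$ is the group of $\sigma$-equivariant automorphisms, $\cong$ denotes $\sigma$-isomorphism, $G^-=\{a\in G:{}^\sigma a=a^{-1}\}$ is the set of odd elements, and $d_G$ is the minimal number of (topological) generators of $G$. Let $F_n$ be the free pro-$p$-group on $n$ generators $x_1,\dots,x_n$ with the action of $\sigma$ for which all $x_i$ are odd, and let $\mathrm{Fr}(F_n)$ be its Frattini subgroup. For $r\in(F_n^-)^n$ let $N_r$ be the closed normal subgroup generated by all conjugates of $r_1,\dots,r_n$, and put $G_r=F_n/N_r$. A weak Schur $\sigma$-group is a $\sigma$-pro-$p$-group that is $\sigma$-isomorphic to $G_r$ for some $n\ge0$ and some $r\in(F_n^-)^n$, and $\mathrm{Sch}$ is the set of $\sigma$-isomorphism classes $[G]$ of these groups. Equip $\mathrm{Sch}$ with the topology generated by the sets $\{[H]: H/D_i(H)\cong G/D_i(G)\}$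 for all $i\ge2$ and $[G]\in\mathrm{Sch}$, where $D_i$ denotes the Zassenhaus filtration. The Haar measure on $F_n^-$ is the Borel measure for which, for every $\sigma$-invariant open normal subgroup $N$ of $F_n$, every fiber of $F_n^-\to(F_n/N)^-$ has measure $1/|(F_n/N)^-|$. Let $\mu_n$ be the pushforward under $(F_n^-)^n\to\mathrm{Sch}$, $r\mapsto[G_r]$, of the product of these measures, and let $\mu_\infty$ be the limit of the $\mu_n$, i.e. the Borel measure with $\mu_\infty(A)=\lim_{n\to\infty}\mu_n(A)$ for every Borel set $A$. Let $C_k=\prod_{i=1}^k(1-p^{-i})$ for $0\le k\le\infty$. Let $n\ge0$, and let $D$ be an open $\sigma$-invariant normal subgroup of $F_n$ that is contained in $\mathrm{Fr}(F_n)$ and invariant under $\mathrm{Aut}_\sigma(F_n)$. For a weak Schur $\sigma$-group $G$ with $d_G=n$ there exists a surjective $\sigma$-homomorphism $\pi\colon F_n\to G$. For any such $\pi$ put $G_D:=G/\pi(D)$ (up to $\sigma$-isomorphism independent of $\pi$), let $N=\ker\pi$, and let $m_{D,G}$ be the minimal number of generators of $ND/D$ as a normal subgroup of $F_n/D$. Then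 the set $$U_{D,G}:=\{[H]\in\mathrm{Sch}\mid d_H=n,\ H_D\cong G_D\}$$ is a Borel set and $$\mu_\infty(U_{D,G})\ =\ \frac{C_\infty}{C_{n-m_{D,G}}}\cdot\frac{1}{|\mathrm{Aut}_\sigma(G_D)|}.$$ -/

import Mathlib

open MeasureTheory Filter Topology
open scoped ENNReal

/-! ### Groups with an action of a group `{1, σ}` of order two -/

/-- A continuous action of `{1, σ}` on a topological group `G` by automorphisms, given by the
involution `sigma` through which `σ` acts. -/
class SigmaGroup (G : Type*) [Group G] [TopologicalSpace G] where
  sigma : G →* G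
  continuous_sigma : Continuous sigma
  sigma_sigma : ∀ x, sigma (sigma x) = x

open SigmaGroup (sigma)

/-- Two groups with an action of `σ` are `σ`-isomorphic: there is an isomorphism of topological
groups commuting with `σ`. -/
def SigmaIso (G H : Type*) [Group G] [TopologicalSpace G] [SigmaGroup G]
    [Group H] [TopologicalSpace H] [SigmaGroup H] : Prop :=
  ∃ e : G ≃ₜ* H, ∀ x, e (sigma x) = sigma (e x)

/-- The `σ`-automorphisms of `G`. -/
def SigmaAut (G : Type*) [Group G] [TopologicalSpace G] [SigmaGroup G] : Type _ :=
  {e : G ≃ₜ* G // ∀ x, e (sigma x) = sigma (e x)}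

/-- The set `G⁻` of odd elements of `G`. -/
def oddPart (G : Type*) [Group G] [TopologicalSpace G] [SigmaGroup G] : Set G :=
  {x | sigma x = x⁻¹}

/-- The subgroup `N` is `σ`-invariant. -/
class IsSigmaInvariant {G : Type*} [Group G] [TopologicalSpace G] [SigmaGroup G]
    (N : Subgroup G) : Prop where
  sigma_mem : ∀ x ∈ N, sigma x ∈ N

/-- The action of `σ` on the factor group by a `σ`-invariant normal subgroup. -/
instance quotientSigmaGroup {G : Type*} [Group G] [TopologicalSpace G] [SigmaGroup G]
    (N : Subgroup G) [N.Normal] [IsSigmaInvariant N] : SigmaGroup (G ⧸ N) where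
  sigma := QuotientGroup.map N N sigma (fun x hx => IsSigmaInvariant.sigma_mem x hx)
  continuous_sigma :=
    (QuotientGroup.continuous_mk.comp SigmaGroup.continuous_sigma).quotient_lift _
  sigma_sigma := by
    intro x
    induction x using QuotientGroup.induction_on with
    | H x => exact congrArg QuotientGroup.mk (SigmaGroup.sigma_sigma x)

/-! ### Pro-`p`-groups -/

/-- `G` is a pro-`p`-group. -/
class IsProP (p : ℕ) (G : Type*) [Group G] [TopologicalSpace G] : Prop
    extends IsTopologicalGroup G, CompactSpace G, T2Space G, TotallyDisconnectedSpace G where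
  index_eq : ∀ N : Subgroup G, N.Normal → IsOpen (N : Set G) → ∃ k : ℕ, N.index = p ^ k

/-- The minimal number `d_G` of topological generators of `G`. -/
noncomputable def minGenerators (G : Type*) [Group G] [TopologicalSpace G] : ℕ :=
  sInf {d | ∃ x : Fin d → G, Dense (Subgroup.closure (Set.range x) : Set G)}

/-- The minimal number of elements whose conjugates topologically generate the subgroup `N`. -/
noncomputable def minNormalGenerators {G : Type*} [Group G] [TopologicalSpace G]
    (N : Subgroup G) : ℕ :=
  sInf {d | ∃ x : Fin d → G,
    closure (Subgroup.normalClosure (Set.range x) : Set G) = (N : Set G)}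

/-- The Frattini subgroup of a profinite group: the intersection of all maximal (proper) open
subgroups. -/
def openFrattini (G : Type*) [Group G] [TopologicalSpace G] : Subgroup G :=
  sInf {M | IsOpen (M : Set G) ∧ IsCoatom M}

/-- The Zassenhaus filtration `D_i(G)` of dimension subgroups of a pro-`p`-group `G`:
`D_1 = G` and, for `m ≥ 2`, `D_m` is the closed subgroup generated by the `p`-th powers of the
elements of `D_⌈m/p⌉` and the commutators `[a, b]` with `a ∈ D_i`, `b ∈ D_j`, `i, j ≥ 1` and `i + j = m`.
(The value at `0` is irrelevant.) -/
noncomputable def zassenhaus (p : ℕ) [hp : Fact p.Prime] (G : Type*) [Group G]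
    [TopologicalSpace G] [IsTopologicalGroup G] : ℕ → Subgroup G
  | 0 => ⊤
  | 1 => ⊤
  | m + 2 => (Subgroup.closure
      ({y | ∃ x ∈ zassenhaus p G ((m + 2) ⌈/⌉ p), y = x ^ p} ∪
        {y | ∃ i j : ℕ, ∃ (_ : 1 ≤ i) (_ : 1 ≤ j) (_ : i + j = m + 2),
          ∃ a ∈ zassenhaus p G i, ∃ b ∈ zassenhaus p G j, y = a * b * a⁻¹ * b⁻¹})).topologicalClosure
  termination_by m => m
  decreasing_by
    · have h2 := hp.out.two_le
      rw [Nat.ceilDiv_eq_add_pred_div, Nat.div_lt_iff_lt_mul (by omega)]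
      nlinarith [Nat.sub_add_cancel (show 1 ≤ m + 2 + p by omega)]
    · omega
    · omega

/-- Any continuous endomorphism maps `D_i(G)` into itself. -/
theorem zassenhaus_map_mem (p : ℕ) [Fact p.Prime] {G : Type*} [Group G]
    [TopologicalSpace G] [IsTopologicalGroup G] (f : G →* G) (hf : Continuous f) (i : ℕ) :
    ∀ x ∈ zassenhaus p G i, f x ∈ zassenhaus p G i := by
  induction i using Nat.strong_induction_on with
  | _ i ih =>
    match i, ih with
    | 0, _ => intro x _; simp [zassenhaus]
    | 1, _ => intro x _; simp [zassenhaus]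
    | m + 2, ih =>
      intro x hx
      rw [zassenhaus] at hx ⊢
      refine map_mem_closure hf hx ?_
      intro y hy
      rw [SetLike.mem_coe] at hy ⊢
      induction hy using Subgroup.closure_induction with
      | one => rw [map_one]; exact one_mem _
      | mul a b _ _ ha hb => rw [map_mul]; exact mul_mem ha hb
      | inv a _ ha => rw [map_inv]; exact inv_mem ha
      | mem y hy =>
        apply Subgroup.subset_closure
        rcases hy with ⟨a, ha, rfl⟩ | ⟨j, k, hj, hk, h, a, ha, b, hb, rfl⟩
        · refine Or.inl ⟨f a, ih _ ?_ a ha, map_pow f a p⟩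
          have h2 := (Fact.out : p.Prime).two_le
          rw [Nat.ceilDiv_eq_add_pred_div, Nat.div_lt_iff_lt_mul (by omega)]
          nlinarith [Nat.sub_add_cancel (show 1 ≤ m + 2 + p by omega)]
        · exact Or.inr ⟨j, k, hj, hk, h, f a, ih j (by omega) a ha, f b, ih k (by omega) b hb,
            by simp only [map_mul, map_inv]⟩

instance zassenhaus_normal (p : ℕ) [Fact p.Prime] (G : Type*) [Group G]
    [TopologicalSpace G] [IsTopologicalGroup G] (i : ℕ) : (zassenhaus p G i).Normal where
  conj_mem x hx g := by
    have h := zassenhaus_map_mem p (MulAut.conj g).toMonoidHom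
      (IsTopologicalGroup.continuous_conj g) i x hx
    simpa using h

instance zassenhaus_sigmaInvariant (p : ℕ) [Fact p.Prime] (G : Type*) [Group G]
    [TopologicalSpace G] [IsTopologicalGroup G] [SigmaGroup G] (i : ℕ) :
    IsSigmaInvariant (zassenhaus p G i) where
  sigma_mem x hx := zassenhaus_map_mem p sigma SigmaGroup.continuous_sigma i x hx

/-! ### The free pro-`p`-group `F_n` on odd generators -/

/-- The normal subgroups of `p`-power index of the abstract free group on `n` generators. -/
def PIndex (p n : ℕ) : Type :=
  {N : Subgroup (FreeGroup (Fin n)) // N.Normal ∧ ∃ k : ℕ, N.index = p ^ k}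

instance (p n : ℕ) (N : PIndex p n) : N.1.Normal := N.2.1

/-- The finite `p`-quotient of the abstract free group that belongs to `N`. -/
def PQuotient {p n : ℕ} (N : PIndex p n) : Type := FreeGroup (Fin n) ⧸ N.1

instance {p n : ℕ} (N : PIndex p n) : Group (PQuotient N) :=
  inferInstanceAs (Group (FreeGroup (Fin n) ⧸ N.1))

instance {p n : ℕ} (N : PIndex p n) : TopologicalSpace (PQuotient N) := ⊥

instance {p n : ℕ} (N : PIndex p n) : DiscreteTopology (PQuotient N) := ⟨rfl⟩

/-- The homomorphism between finite `p`-quotients induced by an endomorphism `s` of the abstract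
free group. -/
def PQuotient.map {p n : ℕ} (N M : PIndex p n) (s : FreeGroup (Fin n) →* FreeGroup (Fin n))
    (h : N.1 ≤ M.1.comap s) : PQuotient N →* PQuotient M :=
  QuotientGroup.map N.1 M.1 s h

/-- The free pro-`p`-group as a subgroup of a product: the inverse limit of all finite
`p`-quotients of the abstract free group on `n` generators. -/
def freeProPSubgroup (p n : ℕ) : Subgroup (∀ N : PIndex p n, PQuotient N) where
  carrier := {f | ∀ (N M : PIndex p n) (h : N.1 ≤ M.1),
    PQuotient.map N M (MonoidHom.id _) h (f N) = f M}
  mul_mem' {f g} hf hg N M h := by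
    rw [Pi.mul_apply, map_mul, hf N M h, hg N M h, Pi.mul_apply]
  one_mem' N M h := by rw [Pi.one_apply, map_one, Pi.one_apply]
  inv_mem' {f} hf N M h := by rw [Pi.inv_apply, map_inv, hf N M h, Pi.inv_apply]

/-- The free pro-`p`-group `F_n` of rank `n`. -/
def FreeProP (p n : ℕ) : Type := freeProPSubgroup p n

namespace FreeProP

variable {p n : ℕ}

instance : Group (FreeProP p n) := inferInstanceAs (Group (freeProPSubgroup p n))

instance : TopologicalSpace (FreeProP p n) :=
  inferInstanceAs (TopologicalSpace (freeProPSubgroup p n))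

instance : IsTopologicalGroup (FreeProP p n) :=
  inferInstanceAs (IsTopologicalGroup (freeProPSubgroup p n))

instance : MeasurableSpace (FreeProP p n) := borel _

instance : BorelSpace (FreeProP p n) := ⟨rfl⟩

/-- The free generators `x_1, …, x_n` of `F_n`. -/
def gen (i : Fin n) : FreeProP p n :=
  ⟨fun N => (QuotientGroup.mk (FreeGroup.of i) : FreeGroup (Fin n) ⧸ N.1), fun _ _ _ => rfl⟩

/-- The involution of the abstract free group inverting each free generator. -/
def invGen (n : ℕ) : FreeGroup (Fin n) →* FreeGroup (Fin n) :=
  FreeGroup.lift fun i => (FreeGroup.of i)⁻¹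

theorem invGen_comp_invGen (n : ℕ) : (invGen n).comp (invGen n) = MonoidHom.id _ := by
  ext i
  simp [invGen]

theorem invGen_invGen (x : FreeGroup (Fin n)) : invGen n (invGen n x) = x :=
  DFunLike.congr_fun (invGen_comp_invGen n) x

/-- The preimage of a normal subgroup of `p`-power index under the involution. -/
def pullback (N : PIndex p n) : PIndex p n :=
  ⟨N.1.comap (invGen n), inferInstance, by
    rw [Subgroup.index_comap_of_surjective _ (fun x => ⟨invGen n x, invGen_invGen x⟩)]
    exact N.2.2⟩

/-- `F_n` carries the action of `σ` for which the free generators are odd: it is the inverse limit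
of the homomorphisms induced by the involution of the abstract free group. -/
instance : SigmaGroup (FreeProP p n) where
  sigma :=
    { toFun := fun f => ⟨fun N => PQuotient.map (pullback N) N (invGen n) le_rfl
          (f.1 (pullback N)), by
        intro N M h
        have h' : (pullback N).1 ≤ (pullback M).1 := Subgroup.comap_mono h
        have hf := f.2 (pullback N) (pullback M) h'
        change PQuotient.map N M (MonoidHom.id _) h
          (PQuotient.map (pullback N) N (invGen n) le_rfl (f.1 (pullback N))) =
          PQuotient.map (pullback M) M (invGen n) le_rfl (f.1 (pullback M))
        rw [← hf]
        generalize f.1 (pullback N) = y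
        induction y using QuotientGroup.induction_on with
        | H y => rfl⟩
      map_one' := by
        apply Subtype.ext
        funext N
        exact map_one (PQuotient.map (pullback N) N (invGen n) le_rfl)
      map_mul' := by
        intro f g
        apply Subtype.ext
        funext N
        exact map_mul (PQuotient.map (pullback N) N (invGen n) le_rfl) _ _ }
  continuous_sigma := by
    refine Continuous.subtype_mk (continuous_pi fun N => ?_) _
    exact continuous_of_discreteTopology.comp
      ((continuous_apply (pullback N)).comp continuous_subtype_val)
  sigma_sigma := by
    intro f
    apply Subtype.ext
    funext N
    have h : (pullback (pullback N)).1 ≤ N.1 := by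
      intro x hx
      have hx' : invGen n (invGen n x) ∈ N.1 := hx
      rwa [invGen_invGen] at hx'
    change PQuotient.map (pullback N) N (invGen n) le_rfl
      (PQuotient.map (pullback (pullback N)) (pullback N) (invGen n) le_rfl
        (f.1 (pullback (pullback N)))) = f.1 N
    rw [← f.2 (pullback (pullback N)) N h]
    generalize f.1 (pullback (pullback N)) = y
    induction y using QuotientGroup.induction_on with
    | H y =>
      change (QuotientGroup.mk (invGen n (invGen n y)) : FreeGroup (Fin n) ⧸ N.1) =
        QuotientGroup.mk y
      rw [invGen_invGen]

theorem sigma_gen (i : Fin n) : sigma (gen i : FreeProP p n) = (gen i)⁻¹ := by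
  apply Subtype.ext
  funext N
  change (QuotientGroup.mk (invGen n (FreeGroup.of i)) : FreeGroup (Fin n) ⧸ N.1) =
    (QuotientGroup.mk (FreeGroup.of i))⁻¹
  simp [invGen]

end FreeProP

/-! ### Weak Schur `σ`-groups -/

/-- The closed normal subgroup `N_r` of `F_n` generated by all conjugates of the entries of a tuple
`r` of odd elements. -/
def relators {p n : ℕ} (r : Fin n → oddPart (FreeProP p n)) : Subgroup (FreeProP p n) :=
  (Subgroup.normalClosure (Set.range fun i => (r i : FreeProP p n))).topologicalClosure

instance relators_normal {p n : ℕ} (r : Fin n → oddPart (FreeProP p n)) : (relators r).Normal :=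
  Subgroup.is_normal_topologicalClosure _

instance relators_sigmaInvariant {p n : ℕ} (r : Fin n → oddPart (FreeProP p n)) :
    IsSigmaInvariant (relators r) where
  sigma_mem x hx := by
    refine map_mem_closure SigmaGroup.continuous_sigma hx ?_
    intro y hy
    have h : Subgroup.normalClosure (Set.range fun i => (r i : FreeProP p n)) ≤
        (Subgroup.normalClosure (Set.range fun i => (r i : FreeProP p n))).comap sigma := by
      have : ((Subgroup.normalClosure (Set.range fun i => (r i : FreeProP p n))).comap
        sigma).Normal := inferInstance
      refine Subgroup.normalClosure_le_normal ?_
      rintro _ ⟨i, rfl⟩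
      have hr : sigma (r i : FreeProP p n) = (r i : FreeProP p n)⁻¹ := (r i).2
      rw [SetLike.mem_coe, Subgroup.mem_comap]
      dsimp only
      rw [hr]
      exact inv_mem (Subgroup.subset_normalClosure ⟨i, rfl⟩)
    exact h hy

/-- The `σ`-pro-`p`-group `G_r = F_n / N_r`. -/
abbrev RelatorQuotient {p n : ℕ} (r : Fin n → oddPart (FreeProP p n)) : Type :=
  FreeProP p n ⧸ relators r

/-- `G` is a weak Schur `σ`-group: a `σ`-pro-`p`-group that is `σ`-isomorphic to `G_r` for some
`k ≥ 0` and some tuple `r` of `k` odd elements of `F_k`. -/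
structure IsWeakSchur (p : ℕ) (G : Type*) [Group G] [TopologicalSpace G] [SigmaGroup G] :
    Prop where
  isProP : IsProP p G
  exists_iso : ∃ (k : ℕ) (r : Fin k → oddPart (FreeProP p k)), SigmaIso G (RelatorQuotient r)

/-- All tuples `r` of `k` odd elements of `F_k`, for all `k ≥ 0`. -/
abbrev SchurTuple (p : ℕ) : Type := Σ k : ℕ, (Fin k → oddPart (FreeProP p k))

/-- Two tuples are equivalent if the groups that they define are `σ`-isomorphic. -/
instance schurSetoid (p : ℕ) : Setoid (SchurTuple p) where
  r a b := SigmaIso (RelatorQuotient a.2) (RelatorQuotient b.2)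
  iseqv :=
    { refl := fun _ => ⟨ContinuousMulEquiv.refl _, fun _ => rfl⟩
      symm := fun ⟨e, he⟩ => ⟨e.symm, fun x => by
        rw [ContinuousMulEquiv.symm_apply_eq, he, ContinuousMulEquiv.apply_symm_apply]⟩
      trans := fun ⟨e, he⟩ ⟨f, hf⟩ => ⟨e.trans f, fun x => by
        simp only [ContinuousMulEquiv.trans_apply, he, hf]⟩ }

/-- The set `Sch` of all `σ`-isomorphism classes of groups `G_r`. -/
def Sch (p : ℕ) : Type := Quotient (schurSetoid p)

namespace Sch

variable {p : ℕ}

/-- The class `[G_r]`; for fixed `n` this is the map `Θ_n`. -/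
def mk {n : ℕ} (r : Fin n → oddPart (FreeProP p n)) : Sch p :=
  Quotient.mk (schurSetoid p) ⟨n, r⟩

/-- The set `U_{i,G}` for `G = G_r`: all classes `[H]` such that `H / D_i(H)` is `σ`-isomorphic
to `G / D_i(G)`. -/
def basicOpen [Fact p.Prime] (i : ℕ) {n : ℕ} (r : Fin n → oddPart (FreeProP p n)) :
    Set (Sch p) :=
  {c | ∃ (k : ℕ) (s : Fin k → oddPart (FreeProP p k)), c = mk s ∧
    SigmaIso (RelatorQuotient s ⧸ zassenhaus p (RelatorQuotient s) i)
      (RelatorQuotient r ⧸ zassenhaus p (RelatorQuotient r) i)}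

/-- The topology on `Sch` generated by the sets `U_{i,G}` for `i ≥ 2`. -/
instance [Fact p.Prime] : TopologicalSpace (Sch p) :=
  TopologicalSpace.generateFrom
    {U | ∃ (i : ℕ) (_ : 2 ≤ i) (n : ℕ) (r : Fin n → oddPart (FreeProP p n)), U = basicOpen i r}

instance [Fact p.Prime] : MeasurableSpace (Sch p) := borel _

instance [Fact p.Prime] : BorelSpace (Sch p) := ⟨rfl⟩

end Sch

/-! ### The measures -/

/-- The property that characterizes the Haar measure on `G⁻`: for every `σ`-invariant open normal
subgroup `N` of `G`, all fibers of the map `G⁻ → (G/N)⁻` have the measure `1 / |(G/N)⁻|`. -/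
def IsOddHaar {G : Type*} [Group G] [TopologicalSpace G] [SigmaGroup G] [MeasurableSpace G]
    (μ : Measure (oddPart G)) : Prop :=
  ∀ (N : Subgroup G) [N.Normal] [IsSigmaInvariant N], IsOpen (N : Set G) →
    ∀ a : oddPart (G ⧸ N),
      μ {b | ((b : G) : G ⧸ N) = a} = (Nat.card (oddPart (G ⧸ N)) : ℝ≥0∞)⁻¹

open scoped Classical in
/-- The Haar measure on `F_n⁻`: the unique Borel measure with the property `IsOddHaar`. -/
noncomputable def oddHaar (p n : ℕ) : Measure (oddPart (FreeProP p n)) :=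
  if h : ∃ μ : Measure (oddPart (FreeProP p n)), IsOddHaar μ then h.choose else 0

/-- The measure `μ_n` on `Sch`: the pushforward under `r ↦ [G_r]` of the product measure on
`(F_n⁻)ⁿ` of the Haar measures on the factors. -/
noncomputable def schMeasure (p : ℕ) [Fact p.Prime] (n : ℕ) : Measure (Sch p) :=
  (Measure.pi fun _ : Fin n => oddHaar p n).map Sch.mk

open scoped Classical in
/-- The measure `μ_∞` on `Sch`: the limit of the measures `μ_n`, that is, the unique Borel measure
with `μ_∞(A) = lim μ_n(A)` for every Borel set `A`. -/
noncomputable def schMeasureLim (p : ℕ) [Fact p.Prime] : Measure (Sch p) :=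
  if h : ∃ μ : Measure (Sch p), ∀ A : Set (Sch p), MeasurableSet A →
      Tendsto (fun n => schMeasure p n A) atTop (𝓝 (μ A))
    then h.choose else 0

/-- The constant `C_k = ∏_{i=1}^k (1 - p^{-i})`. -/
noncomputable def schConst (p k : ℕ) : ℝ := ∏ i ∈ Finset.Icc 1 k, (1 - ((p : ℝ) ^ i)⁻¹)

/-- The constant `C_∞ = ∏_{i=1}^∞ (1 - p^{-i})`. -/
noncomputable def schConstInf (p : ℕ) : ℝ := ∏' i : ℕ, (1 - ((p : ℝ) ^ (i + 1))⁻¹)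

/-! ### The factor groups `G_D` and the sets `U_{D,G}` -/

/-- Surjective (continuous) `σ`-homomorphisms from `F_n` onto `G`. -/
structure SigmaEpi (p n : ℕ) (G : Type*) [Group G] [TopologicalSpace G] [SigmaGroup G] where
  toHom : FreeProP p n →* G
  continuous_toHom : Continuous toHom
  surjective : Function.Surjective toHom
  map_sigma : ∀ x, toHom (sigma x) = sigma (toHom x)

namespace SigmaEpi

variable {p n : ℕ} {G : Type*} [Group G] [TopologicalSpace G] [SigmaGroup G]

/-- The image `π(D)` in `G`. -/
def image (π : SigmaEpi p n G) (D : Subgroup (FreeProP p n)) : Subgroup G := D.map π.toHom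

instance (π : SigmaEpi p n G) (D : Subgroup (FreeProP p n)) [hD : D.Normal] :
    (π.image D).Normal :=
  hD.map π.toHom π.surjective

instance (π : SigmaEpi p n G) (D : Subgroup (FreeProP p n)) [IsSigmaInvariant D] :
    IsSigmaInvariant (π.image D) where
  sigma_mem := by
    rintro _ ⟨x, hx, rfl⟩
    exact ⟨sigma x, IsSigmaInvariant.sigma_mem x hx, π.map_sigma x⟩

/-- The factor group `G_D = G / π(D)`. -/
abbrev Quot (π : SigmaEpi p n G) (D : Subgroup (FreeProP p n)) : Type _ := G ⧸ π.image D

/-- The number `m_{D,G}`: the minimal number of generators of `ND/D` as a normal subgroup of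
`F_n/D`, where `N` is the kernel of `π : F_n → G`. -/
noncomputable def relationNumber (π : SigmaEpi p n G) (D : Subgroup (FreeProP p n)) [D.Normal] :
    ℕ :=
  minNormalGenerators (π.toHom.ker.map (QuotientGroup.mk' D))

/-- The set `U_{D,G}` of all classes `[H]` with `d_H = n` such that `H_D` is `σ`-isomorphic
to `G_D`. -/
def measureSet (π : SigmaEpi p n G) (D : Subgroup (FreeProP p n)) [D.Normal]
    [IsSigmaInvariant D] : Set (Sch p) :=
  {c | ∃ (k : ℕ) (s : Fin k → oddPart (FreeProP p k)), c = Sch.mk s ∧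
    minGenerators (RelatorQuotient s) = n ∧
    ∃ π' : SigmaEpi p n (RelatorQuotient s), SigmaIso (π'.Quot D) (π.Quot D)}

end SigmaEpi

/-!
The random group `G_r` is studied through its finite factor groups. For a normal subgroup `M` of a
finite `p`-group `E`, let `X(M)` be the space `invHoms p M` of homomorphisms `M → ZMod p` that are
invariant under conjugation by `E`. Elements of `M` generate `M` as a normal subgroup if and only if
no nonzero element of `X(M)` kills all of them (`normalClosure_eq_iff_invHoms`), so that `dim X(M)`
is the minimal number of normal generators of `M`. If `σ` acts by `-1` on `X(M)`, which is the case
whenever `M` is generated by odd elements, then a random tuple of `k` odd elements of `M` has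
uniformly distributed values in the dual of `X(M)`, and it generates `M` with the probability
`C_k / C_{k-m}`, where `m = dim X(M)` (`card_odd_normalGenerators`).

Let `B` be a finite `σ`-group with `n` generators, and let `K` be a small `σ`-invariant open normal
subgroup of `F_k`. Counting in two ways the pairs that consist of a tuple `r` of odd relators and an
epimorphism `F_k / K → B` whose kernel is generated by `r` shows that the finite factor group of
`G_r` belonging to `K` is isomorphic to `B` with the probability
`C_k² / (C_{k-n} C_{k-m} |Aut_σ(B)|)` (`card_relators_mul_card_aut`, `pi_oddHaar_exists_epi`). Here
`m` is the dimension of `X` of the kernel of any epimorphism `F_k / K → B`. For `k = n` and `K = D`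
this is the measure of `U_{D,G}` under `μ_n`: any two epimorphisms differ by a `σ`-automorphism of
`F_n` (`SigmaEpi.exists_aut`), so that `m = m_{D,G}`, and the result is
`C_n² / (C_{n-m} |Aut_σ(G_D)|)` (`SigmaEpi.pi_oddHaar_measureSet`).

For `K = D_i(F_k)` the difference `m - k` does not depend on `k`, by a comparison of presentations
in the manner of Schanuel's lemma (`finrank_invHoms_ker_add`). Therefore the ratio of the measures
of a set `U_{i,G}` with `d_G = n` under `μ_k` and `μ_n` is `C_k² / (C_{k-n} C_n²)` for all `k ≥ n`.
These sets form a countable `π`-system that generates the Borel `σ`-algebra, so the restrictions of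
`μ_k` and `μ_n` to the set of all classes with `d_G = n` are proportional with this factor
(`schMeasure_restrict_rankSet`). The limit for `k → ∞` is taken separately on each of these sets by
dominated convergence (`exists_tendsto_schMeasure`); hence `μ_∞` equals `(C_∞ / C_n²) μ_n` on the
subsets of `{d_G = n}`, and in particular on `U_{D,G}`.
-/

/-! ### Involutions of finite groups of odd order -/

/-- The map `x ↦ σ(x)⁻¹ x`, which takes odd values. -/
def oddDiff {G : Type*} [Group G] (σ : G →* G) (x : G) : G := (σ x)⁻¹ * x

theorem sigma_oddDiff {G : Type*} [Group G] {σ : G →* G} (hσ : ∀ x, σ (σ x) = x) (x : G) :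
    σ (oddDiff σ x) = (oddDiff σ x)⁻¹ := by
  simp [oddDiff, hσ]

theorem oddDiff_eq_sq {G : Type*} [Group G] {σ : G →* G} {b : G} (hb : σ b = b⁻¹) :
    oddDiff σ b = b ^ 2 := by
  simp [oddDiff, hb, sq]

theorem map_oddDiff {G A : Type*} [Group G] [Group A] {σ : G →* G} {τ : A →* A} (f : G →* A)
    (hf : ∀ x, f (σ x) = τ (f x)) (x : G) : f (oddDiff σ x) = oddDiff τ (f x) := by
  simp [oddDiff, hf]

theorem exists_odd_sq_of_odd_card {G : Type*} [Group G] (hG : Odd (Nat.card G)) {σ : G →* G}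
    {a : G} (ha : σ a = a⁻¹) : ∃ b, σ b = b⁻¹ ∧ b ^ 2 = a := by
  obtain ⟨k, hk⟩ := hG
  refine ⟨a ^ (k + 1), by simp [ha], ?_⟩
  rw [← pow_mul, show (k + 1) * 2 = Nat.card G + 1 by omega, pow_succ, pow_card_eq_one', one_mul]

/-- For a surjective equivariant homomorphism every odd element lifts to an odd element: write
`a = b²` with `b` odd and apply `x ↦ σ(x)⁻¹ x` to a lift of `b`. -/
theorem exists_odd_lift {G A : Type*} [Group G] [Group A] {σ : G →* G}
    (hσ : ∀ x, σ (σ x) = x) {τ : A →* A} {f : G →* A} (hf : ∀ x, f (σ x) = τ (f x))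
    (hs : Function.Surjective f) (hA : Odd (Nat.card A)) {a : A} (ha : τ a = a⁻¹) :
    ∃ b, σ b = b⁻¹ ∧ f b = a := by
  obtain ⟨c, hc, rfl⟩ := exists_odd_sq_of_odd_card hA ha
  obtain ⟨x, rfl⟩ := hs c
  exact ⟨oddDiff σ x, sigma_oddDiff hσ x, by rw [map_oddDiff f hf, oddDiff_eq_sq hc]⟩

/-- All fibres of `x ↦ σ(x)⁻¹ x : G → G⁻` are cosets of the fixed group of `σ`. -/
theorem card_oddDiff_fiber {G : Type*} [Group G] [Finite G] (hG : Odd (Nat.card G)) {σ : G →* G}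
    {a : G} (ha : σ a = a⁻¹) :
    Nat.card {x : G // oddDiff σ x = a} = Nat.card {x : G // σ x = x} := by
  obtain ⟨b, hb, hba⟩ := exists_odd_sq_of_odd_card hG ha
  refine (Nat.card_congr (Equiv.subtypeEquiv (Equiv.mulRight b) fun g => ⟨fun hg => ?_,
    fun hx => ?_⟩)).symm
  · have h1 : oddDiff σ b = a := by rw [oddDiff_eq_sq hb, hba]
    rw [← h1]
    simp [oddDiff, hg, mul_assoc]
  · have h : (σ (g * b))⁻¹ * (g * b) = (σ b)⁻¹ * b := by
      have h1 : oddDiff σ b = a := by rw [oddDiff_eq_sq hb, hba]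
      exact hx.trans h1.symm
    rw [map_mul, mul_inv_rev, mul_assoc, mul_right_inj, ← mul_assoc, mul_eq_right,
      inv_mul_eq_one] at h
    exact h

theorem card_oddDiff_preimage {G : Type*} [Group G] [Finite G] (hG : Odd (Nat.card G))
    {σ : G →* G} (hσ : ∀ x, σ (σ x) = x) (P : G → Prop) :
    Nat.card {x : G // P (oddDiff σ x)} =
      Nat.card {a : G // σ a = a⁻¹ ∧ P a} * Nat.card {x : G // σ x = x} := by
  have e : {x : G // P (oddDiff σ x)} ≃
      Σ a : {a : G // σ a = a⁻¹ ∧ P a}, {x : G // oddDiff σ x = a.1} :=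
    ⟨fun x => ⟨⟨oddDiff σ x.1, sigma_oddDiff hσ _, x.2⟩, ⟨x.1, rfl⟩⟩,
     fun y => ⟨y.2.1, by rw [y.2.2]; exact y.1.2.2⟩, fun x => rfl, by
      rintro ⟨⟨a, ha⟩, ⟨x, hx⟩⟩
      obtain rfl : oddDiff σ x = a := hx
      rfl⟩
  classical
  have := Fintype.ofFinite {a : G // σ a = a⁻¹ ∧ P a}
  rw [Nat.card_congr e, Nat.card_sigma, Finset.sum_congr rfl fun a _ =>
    card_oddDiff_fiber hG a.2.1]
  simp [Nat.card_eq_fintype_card]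

theorem card_eq_card_odd_mul_card_even {G : Type*} [Group G] [Finite G] (hG : Odd (Nat.card G))
    {σ : G →* G} (hσ : ∀ x, σ (σ x) = x) :
    Nat.card G = Nat.card {a : G // σ a = a⁻¹} * Nat.card {x : G // σ x = x} := by
  have h := card_oddDiff_preimage hG hσ (fun _ => True)
  simp only [and_true] at h
  rw [← h]
  exact (Nat.card_congr (Equiv.subtypeUnivEquiv fun _ => trivial)).symm

theorem card_fiber_hom {G A : Type*} [Group G] [Finite G] [Group A] (f : G →* A)
    (hs : Function.Surjective f) (P : A → Prop) :
    Nat.card {x : G // P (f x)} = Nat.card f.ker * Nat.card {y : A // P y} := by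
  have : Finite A := Finite.of_surjective f hs
  have e : {x : G // P (f x)} ≃ Σ y : {y : A // P y}, {x : G // f x = y.1} :=
    ⟨fun x => ⟨⟨f x.1, x.2⟩, ⟨x.1, rfl⟩⟩, fun y => ⟨y.2.1, by rw [y.2.2]; exact y.1.2⟩,
      fun x => rfl, by
        rintro ⟨⟨a, ha⟩, ⟨x, hx⟩⟩
        obtain rfl : f x = a := hx
        rfl⟩
  have h : ∀ y : A, Nat.card {x : G // f x = y} = Nat.card f.ker := by
    intro y
    obtain ⟨x, rfl⟩ := hs y
    refine Nat.card_congr ⟨fun z => ⟨x⁻¹ * z.1, ?_⟩, fun z => ⟨x * z.1, ?_⟩, ?_, ?_⟩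
    · simp [MonoidHom.mem_ker, z.2]
    · have hz : f z.1 = 1 := z.2
      simp [hz]
    · intro z; simp
    · intro z; simp
  classical
  have := Fintype.ofFinite {y : A // P y}
  rw [Nat.card_congr e, Nat.card_sigma, Finset.sum_congr rfl fun a _ => h a.1]
  simp [Nat.card_eq_fintype_card, mul_comm]

/-- A surjective equivariant homomorphism of finite groups of odd order is equidistributed on odd
elements. -/
theorem card_odd_fiber {G A : Type*} [Group G] [Finite G] [Group A] (hG : Odd (Nat.card G))
    {σ : G →* G} (hσ : ∀ x, σ (σ x) = x) {τ : A →* A} (hτ : ∀ x, τ (τ x) = x) (f : G →* A)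
    (hf : ∀ x, f (σ x) = τ (f x)) (hs : Function.Surjective f) {b : A} (hb : τ b = b⁻¹) :
    Nat.card {a : G // σ a = a⁻¹ ∧ f a = b} * Nat.card {y : A // τ y = y⁻¹} =
      Nat.card {a : G // σ a = a⁻¹} := by
  have : Finite A := Finite.of_surjective f hs
  have hker := card_fiber_hom f hs (fun _ => True)
  rw [Nat.card_congr (Equiv.subtypeUnivEquiv fun _ => trivial),
    Nat.card_congr (Equiv.subtypeUnivEquiv fun _ => trivial)] at hker
  have hA : Odd (Nat.card A) := by
    rw [hker, Nat.odd_mul] at hG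
    exact hG.2
  have h1 := card_oddDiff_preimage hG hσ (fun a => f a = b)
  simp only [map_oddDiff f hf] at h1
  rw [card_fiber_hom f hs (fun y => oddDiff τ y = b), card_oddDiff_fiber hA hb] at h1
  have h2 := card_eq_card_odd_mul_card_even hA hτ
  have h3 := card_eq_card_odd_mul_card_even hG hσ
  have : Nonempty {x : G // σ x = x} := ⟨⟨1, map_one _⟩⟩
  have hpos : 0 < Nat.card {x : G // σ x = x} := Nat.card_pos
  refine Nat.eq_of_mul_eq_mul_right hpos ?_
  calc _ = (Nat.card {a : G // σ a = a⁻¹ ∧ f a = b} * Nat.card {x : G // σ x = x}) *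
        Nat.card {y : A // τ y = y⁻¹} := by ring
    _ = Nat.card f.ker * Nat.card A := by rw [← h1, h2]; ring
    _ = _ := by rw [← hker, h3]

theorem odd_card_of_isPGroup {p : ℕ} [Fact p.Prime] (hp : p ≠ 2) {G : Type*} [Group G] [Finite G]
    (hG : IsPGroup p G) : Odd (Nat.card G) := by
  obtain ⟨n, hn⟩ := IsPGroup.iff_card.1 hG
  rw [hn]
  exact ((Fact.out : p.Prime).odd_of_ne_two hp).pow

/-! ### Invariant homomorphisms to the field with `p` elements -/

/-- The space of all homomorphisms from a normal subgroup `M` of `E` to `ZMod p` that are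
invariant under conjugation by `E`. It is dual to `M / Mᵖ[M, E]`. -/
def invHoms (p : ℕ) {E : Type*} [Group E] (M : Subgroup E) : Submodule (ZMod p) (M → ZMod p) where
  carrier := {f | (∀ a b, f (a * b) = f a + f b) ∧
    ∀ (g : E) (a b : M), (b : E) = g * a * g⁻¹ → f b = f a}
  add_mem' {f g} hf hg := ⟨fun a b => by
      simp only [Pi.add_apply, hf.1, hg.1]; abel,
    fun x a b h => by simp only [Pi.add_apply, hf.2 x a b h, hg.2 x a b h]⟩
  zero_mem' := ⟨fun _ _ => by simp, fun _ _ _ _ => rfl⟩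
  smul_mem' c f hf := ⟨fun a b => by simp only [Pi.smul_apply, hf.1, smul_add],
    fun x a b h => by simp only [Pi.smul_apply, hf.2 x a b h]⟩

section invHoms

variable {p : ℕ} {E : Type*} [Group E] {M : Subgroup E}

/-- An invariant homomorphism as a homomorphism of groups. -/
def invHoms.toHom (f : invHoms p M) : M →* Multiplicative (ZMod p) where
  toFun a := Multiplicative.ofAdd (f.1 a)
  map_one' := by
    have h := f.2.1 1 1
    rw [mul_one] at h
    simpa using h
  map_mul' a b := by rw [f.2.1 a b, ofAdd_add]

theorem invHoms.apply_one (f : invHoms p M) : f.1 1 = 0 := (invHoms.toHom f).map_one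

theorem invHoms.apply_inv (f : invHoms p M) (a : M) : f.1 a⁻¹ = - f.1 a :=
  (invHoms.toHom f).map_inv a

/-- All invariant homomorphisms on `M` change sign under `σ`. -/
def OddInvHoms (p : ℕ) {E : Type*} [Group E] (σ : E →* E) (M : Subgroup E) : Prop :=
  ∀ f ∈ invHoms p M, ∀ a b : M, (b : E) = σ a → f b = - f a

/-- The kernel in `E` of an invariant homomorphism. -/
def invHoms.ker [M.Normal] (f : invHoms p M) : Subgroup E := (invHoms.toHom f).ker.map M.subtype

theorem invHoms.mem_ker [M.Normal] (f : invHoms p M) (x : E) :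
    x ∈ invHoms.ker f ↔ ∃ h : x ∈ M, f.1 ⟨x, h⟩ = 0 := by
  constructor
  · rintro ⟨y, hy, rfl⟩
    exact ⟨y.2, hy⟩
  · rintro ⟨h, hx⟩
    exact ⟨⟨x, h⟩, hx, rfl⟩

instance [M.Normal] (f : invHoms p M) : (invHoms.ker f).Normal where
  conj_mem x hx g := by
    rw [invHoms.mem_ker] at hx ⊢
    obtain ⟨h, h'⟩ := hx
    exact ⟨Subgroup.Normal.conj_mem inferInstance x h g, by
      rw [f.2.2 g ⟨x, h⟩ ⟨_, _⟩ rfl, h']⟩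

open scoped commutatorElement in
/-- In a finite `p`-group an invariant homomorphism separates any two normal subgroups
`N < M`. -/
theorem exists_invHom_ne_zero [hp : Fact p.Prime] [Finite E] (hE : IsPGroup p E) (N : Subgroup E)
    [M.Normal] [N.Normal] (hNM : N < M) :
    ∃ f ∈ invHoms p M, f ≠ 0 ∧ ∀ a : M, (a : E) ∈ N → f a = 0 := by
  obtain ⟨L, ⟨hLn, hNL, hLM⟩, hmax⟩ : ∃ L : Subgroup E, (L.Normal ∧ N ≤ L ∧ L < M) ∧
      ∀ L' : Subgroup E, L'.Normal → L < L' → L' ≤ M → L' = M := by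
    obtain ⟨L, hL⟩ := (Set.toFinite {L : Subgroup E | L.Normal ∧ N ≤ L ∧ L < M}).exists_maximal
      ⟨N, inferInstance, le_rfl, hNM⟩
    refine ⟨L, hL.1, fun L' h1 h2 h3 => ?_⟩
    by_contra hne
    exact absurd (hL.2 ⟨h1, hL.1.2.1.trans h2.le, lt_of_le_of_ne h3 hne⟩ h2.le) h2.not_ge
  have hnil : Group.IsNilpotent E := hE.isNilpotent
  -- nilpotency of `E` excludes `M = L [M, E]`
  have hcomm : ⁅M, (⊤ : Subgroup E)⁆ ≤ L := by
    by_contra hne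
    have hM : L ⊔ ⁅M, (⊤ : Subgroup E)⁆ = M := by
      refine hmax _ inferInstance (lt_of_le_of_ne le_sup_left fun h => hne ?_)
        (sup_le hLM.le (Subgroup.commutator_le_left M ⊤))
      rw [h]; exact le_sup_right
    have hk : ∀ k, M ≤ (⊤ : Subgroup E).lowerCentralSeries k ⊔ L := by
      intro k
      induction k with
      | zero => simp
      | succ k ih =>
        rw [← hM]
        refine sup_le le_sup_right (Subgroup.commutator_le.2 fun a ha b _ => ?_)
        obtain ⟨c, hc, d, hd, rfl⟩ := Subgroup.mem_sup_of_normal_right.1 (ih ha)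
        have h1 : ⁅c, b⁆ ∈ (⊤ : Subgroup E).lowerCentralSeries (k + 1) :=
          Subgroup.commutator_mem_commutator hc (Subgroup.mem_top b)
        have h2 : ⁅d, b⁆ ∈ L := by
          rw [commutatorElement_def, mul_assoc, mul_assoc]
          exact mul_mem hd (by
            have := hLn.conj_mem _ (inv_mem hd) b
            rwa [mul_assoc] at this)
        have h3 : ⁅c * d, b⁆ = (c * ⁅d, b⁆ * c⁻¹) * ⁅c, b⁆ := by
          simp only [commutatorElement_def]; group
        rw [h3]
        exact mul_mem ((le_sup_right : L ≤ _) (hLn.conj_mem _ h2 c))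
          ((le_sup_left : _ ≤ _ ⊔ L) h1)
    obtain ⟨k, hk'⟩ := Subgroup.nilpotent_iff_lowerCentralSeries.1 hnil
    have := hk k
    rw [hk', bot_sup_eq] at this
    exact absurd this hLM.not_ge
  let L' := L.subgroupOf M
  let Q := M ⧸ L'
  have hQ : IsPGroup p Q := (hE.to_subgroup M).to_quotient L'
  have hnt : Nontrivial Q := by
    rw [QuotientGroup.nontrivial_iff]
    intro h
    rw [Subgroup.subgroupOf_eq_top] at h
    exact hLM.not_ge h
  obtain ⟨n, hn0, hn⟩ := (IsPGroup.nontrivial_iff_card hQ).1 hnt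
  obtain ⟨x, hx⟩ := exists_prime_orderOf_dvd_card' (G := Q) p (hn ▸ dvd_pow_self p hn0.ne')
  -- all subgroups between `L` and `M` are normal, so that `M / L` is cyclic of order `p`
  have hgen : ∀ y : Q, y ∈ Subgroup.zpowers x := by
    let R := ((Subgroup.zpowers x).comap (QuotientGroup.mk' L')).map M.subtype
    have hLR : L ≤ R := fun y hy => ⟨⟨y, hLM.le hy⟩, by
      have : (QuotientGroup.mk' L') ⟨y, hLM.le hy⟩ = 1 := by
        rw [QuotientGroup.mk'_apply, QuotientGroup.eq_one_iff]; exact hy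
      rw [SetLike.mem_coe, Subgroup.mem_comap, this]; exact one_mem _, rfl⟩
    have hRM : R ≤ M := by rintro _ ⟨y, _, rfl⟩; exact y.2
    have hRn : R.Normal := ⟨fun y hy g => by
      have : g * y * g⁻¹ = ⁅y, g⁆⁻¹ * y := by simp only [commutatorElement_def]; group
      rw [this]
      exact mul_mem (hLR (inv_mem (hcomm (Subgroup.commutator_mem_commutator (hRM hy)
        (Subgroup.mem_top g))))) hy⟩
    have hLR' : L < R := by
      refine lt_of_le_of_ne hLR fun h => ?_
      obtain ⟨z, hz⟩ := QuotientGroup.mk_surjective x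
      have hzR : (z : E) ∈ R := ⟨z, by
        rw [SetLike.mem_coe, Subgroup.mem_comap, QuotientGroup.mk'_apply, hz]
        exact Subgroup.mem_zpowers x, rfl⟩
      rw [← h] at hzR
      have : x = 1 := by rw [← hz, QuotientGroup.eq_one_iff]; exact hzR
      rw [this, orderOf_one] at hx
      exact hp.out.one_lt.ne hx
    have hR := hmax R hRn hLR' hRM
    intro y
    obtain ⟨z, rfl⟩ := QuotientGroup.mk_surjective y
    have hz : (z : E) ∈ R := by rw [hR]; exact z.2
    obtain ⟨w, hw, hwz⟩ := hz
    rw [← show w = z from Subtype.ext hwz]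
    exact hw
  have hcard : Nat.card Q = Nat.card (Multiplicative (ZMod p)) := by
    rw [← orderOf_eq_card_of_forall_mem_zpowers hgen, hx]
    simp
  have hcQ : IsCyclic Q := ⟨x, hgen⟩
  let e : Q ≃* Multiplicative (ZMod p) := mulEquivOfCyclicCardEq hcard
  refine ⟨fun a => (e (QuotientGroup.mk a)).toAdd, ⟨fun a b => ?_, fun g a b h => ?_⟩, ?_, ?_⟩
  · simp only [QuotientGroup.mk_mul, map_mul, toAdd_mul]
  · have h1 : (QuotientGroup.mk b : Q) = QuotientGroup.mk a := by
      rw [QuotientGroup.eq, Subgroup.mem_subgroupOf]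
      have : ((b⁻¹ * a : M) : E) = ⁅g, (a : E)⁻¹⁆ := by
        push_cast; rw [h, commutatorElement_def]; group
      rw [this, ← inv_inv ⁅g, (a : E)⁻¹⁆, commutatorElement_inv]
      exact inv_mem (hcomm (Subgroup.commutator_mem_commutator (inv_mem a.2)
        (Subgroup.mem_top g)))
    exact congrArg (fun y => (e y).toAdd) h1
  · intro h
    obtain ⟨z, hz⟩ := QuotientGroup.mk_surjective x
    have h1 := congrFun h z
    have h2 : e x = 1 := by
      rw [← hz]; exact Multiplicative.toAdd.injective h1
    rw [(MulEquiv.map_eq_one_iff e).1 h2, orderOf_one] at hx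
    exact hp.out.one_lt.ne hx
  · intro a ha
    have : (QuotientGroup.mk a : Q) = 1 := by rw [QuotientGroup.eq_one_iff]; exact hNL ha
    change (e (QuotientGroup.mk a)).toAdd = 0
    rw [this, map_one, toAdd_one]

end invHoms

section invHoms

variable {p : ℕ} {E : Type*} [Group E] {M : Subgroup E}

/-- Elements of `M` generate `M` as a normal subgroup of the finite `p`-group `E` if and only if
no nonzero invariant homomorphism kills all of them. -/
theorem normalClosure_eq_iff_invHoms [Fact p.Prime] [Finite E] (hE : IsPGroup p E) [M.Normal]
    {ι : Type*} (r : ι → M) :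
    Subgroup.normalClosure (Set.range fun i => (r i : E)) = M ↔
      ∀ f ∈ invHoms p M, (∀ i, f (r i) = 0) → f = 0 := by
  have hle : Subgroup.normalClosure (Set.range fun i => (r i : E)) ≤ M :=
    Subgroup.normalClosure_le_normal (by rintro _ ⟨i, rfl⟩; exact (r i).2)
  constructor
  · intro h f hf hr
    have h1 : Subgroup.normalClosure (Set.range fun i => (r i : E)) ≤
        invHoms.ker (⟨f, hf⟩ : invHoms p M) := Subgroup.normalClosure_le_normal (by
      rintro _ ⟨i, rfl⟩
      exact (invHoms.mem_ker _ _).2 ⟨(r i).2, hr i⟩)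
    rw [h] at h1
    funext x
    exact ((invHoms.mem_ker _ _).1 (h1 x.2)).2
  · intro h
    by_contra hne
    obtain ⟨f, hf, hf0, hk⟩ := exists_invHom_ne_zero hE _ (lt_of_le_of_ne hle hne)
    exact hf0 (h f hf fun i => hk _ (Subgroup.subset_normalClosure ⟨i, rfl⟩))

/-- The evaluation map of `M` in coordinates belonging to a basis of the space of invariant
homomorphisms. -/
noncomputable def evalBasis {m : ℕ} (b : Module.Basis (Fin m) (ZMod p) (invHoms p M)) :
    M →* Multiplicative (Fin m → ZMod p) where
  toFun x := Multiplicative.ofAdd fun j => (b j).1 x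
  map_one' := by
    rw [← ofAdd_zero]
    exact congrArg _ (funext fun j => invHoms.apply_one (b j))
  map_mul' x y := by
    rw [← ofAdd_add]
    exact congrArg _ (funext fun j => (b j).2.1 x y)

theorem evalBasis_surjective [Fact p.Prime] {m : ℕ}
    (b : Module.Basis (Fin m) (ZMod p) (invHoms p M)) : Function.Surjective (evalBasis b) := by
  let S : AddSubgroup (Fin m → ZMod p) := Subgroup.toAddSubgroup' (evalBasis b).range
  let S' : Submodule (ZMod p) (Fin m → ZMod p) := AddSubgroup.toZModSubmodule p S
  have hS : S' = ⊤ := by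
    by_contra hne
    obtain ⟨g, hg0, hg⟩ := Submodule.exists_le_ker_of_lt_top S' (lt_top_iff_ne_top.2 hne)
    have h1 : ∑ j, g (Pi.single j 1) • b j = 0 := by
      apply Subtype.ext
      funext x
      have hx : (fun j => (b j).1 x) ∈ S' := ⟨x, rfl⟩
      have h2 : g (fun j => (b j).1 x) = 0 := hg hx
      rw [LinearMap.pi_apply_eq_sum_univ] at h2
      have h3 : ∀ i : Fin m, (fun j => if i = j then (1 : ZMod p) else 0) = Pi.single i 1 :=
        fun i => funext fun j => by simp [Pi.single_apply, eq_comm]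
      simp only [h3] at h2
      simpa [mul_comm] using h2
    have h2 := Fintype.linearIndependent_iff.1 b.linearIndependent _ h1
    exact hg0 (LinearMap.pi_ext' fun j => LinearMap.ext_ring (by simpa using h2 j))
  intro v
  have hv : v.toAdd ∈ S' := by rw [hS]; trivial
  exact hv

theorem card_tuples_of_card_fiber {S V : Type*} [Finite S] [Finite V] (f : S → V) (c : ℕ)
    (hc : ∀ v, Nat.card {s : S // f s = v} = c) (k : ℕ) (P : (Fin k → V) → Prop) :
    Nat.card {r : Fin k → S // P fun i => f (r i)} = c ^ k * Nat.card {A : Fin k → V // P A} := by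
  have e : ∀ v, {s : S // f s = v} ≃ Fin c := fun v => Finite.equivFinOfCardEq (hc v)
  let e1 : S ≃ V × Fin c := (Equiv.sigmaFiberEquiv f).symm.trans
    ((Equiv.sigmaCongrRight e).trans (Equiv.sigmaEquivProd V (Fin c)))
  have he1 : ∀ s, (e1 s).1 = f s := fun s => rfl
  let e2 : {r : Fin k → S // P fun i => f (r i)} ≃ {A : Fin k → V // P A} × (Fin k → Fin c) :=
    { toFun := fun r => (⟨fun i => f (r.1 i), r.2⟩, fun i => (e1 (r.1 i)).2)
      invFun := fun A => ⟨fun i => e1.symm (A.1.1 i, A.2 i), by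
        simp only [← he1, Equiv.apply_symm_apply]; exact A.1.2⟩
      left_inv := fun r => by
        apply Subtype.ext
        funext i
        exact (Equiv.symm_apply_eq e1).2 rfl
      right_inv := fun A => by
        refine Prod.ext (Subtype.ext ?_) ?_
        · funext i; simp [← he1]
        · funext i; simp }
  rw [Nat.card_congr e2, Nat.card_prod]
  simp [mul_comm]

theorem schConst_succ (p k : ℕ) :
    schConst p (k + 1) = schConst p k * (1 - ((p : ℝ) ^ (k + 1))⁻¹) := by
  rw [schConst, schConst, Finset.prod_Icc_succ_top (by omega)]

/-- The number of linearly independent `m`-tuples in a space of dimension `k` over the field with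
`p` elements, in terms of the constants `C_k`. -/
theorem prod_pow_sub_pow_mul_schConst {p : ℕ} (hp : 0 < p) {k m : ℕ} (hm : m ≤ k) :
    ((∏ i : Fin m, (p ^ k - p ^ i.val) : ℕ) : ℝ) * schConst p (k - m) =
      ((p : ℝ) ^ m) ^ k * schConst p k := by
  rw [Fin.prod_univ_eq_prod_range (fun i => p ^ k - p ^ i) m]
  induction m with
  | zero => simp
  | succ m ih =>
    have h1 := ih (by omega)
    obtain ⟨j, hj⟩ : ∃ j, k = m + (j + 1) := ⟨k - m - 1, by omega⟩
    have h2 : k - m = j + 1 := by omega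
    have h3 : k - (m + 1) = j := by omega
    have hp' : (p : ℝ) ≠ 0 := by positivity
    rw [h2, schConst_succ] at h1
    rw [Finset.prod_range_succ, h3, Nat.cast_mul,
      Nat.cast_sub (Nat.pow_le_pow_right hp (by omega : m ≤ k))]
    have h4 : ((p ^ k : ℕ) : ℝ) - ((p ^ m : ℕ) : ℝ) =
        (p : ℝ) ^ k * (1 - ((p : ℝ) ^ (j + 1))⁻¹) := by
      push_cast
      rw [hj, pow_add (p : ℝ) m (j + 1)]
      field_simp
    rw [h4, pow_succ (p : ℝ) m, mul_pow]
    linear_combination (p : ℝ) ^ k * h1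

/-- The number of odd tuples that generate a normal subgroup `M` whose invariant homomorphisms are
all odd: the evaluation map `M⁻ → Xᵛ` to the dual of the space `X` of invariant homomorphisms is
equidistributed, and a tuple generates `M` if and only if its image spans `Xᵛ`. -/
theorem card_odd_normalGenerators [Fact p.Prime] (hp : p ≠ 2) [Finite E] (hE : IsPGroup p E)
    {σ : E →* E} (hσ : ∀ x, σ (σ x) = x) [M.Normal] (hM : ∀ x ∈ M, σ x ∈ M)
    (hodd : OddInvHoms p σ M) {m k : ℕ} (hm : Module.finrank (ZMod p) (invHoms p M) = m)
    (hmk : m ≤ k) :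
    (Nat.card {r : Fin k → E // (∀ i, σ (r i) = (r i)⁻¹) ∧
      Subgroup.normalClosure (Set.range r) = M} : ℝ) * schConst p (k - m) =
      (Nat.card {a : E // σ a = a⁻¹ ∧ a ∈ M} : ℝ) ^ k * schConst p k := by
  have hp0 : 0 < p := (Fact.out : p.Prime).pos
  have : Finite (M → ZMod p) := Pi.finite
  let b : Module.Basis (Fin m) (ZMod p) (invHoms p M) := Module.finBasisOfFinrankEq _ _ hm
  let σM : M →* M := (σ.comp M.subtype).codRestrict M fun x => hM x x.2
  let η := evalBasis b
  let S := {a : E // σ a = a⁻¹ ∧ a ∈ M}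
  let f : S → (Fin m → ZMod p) := fun a => (η ⟨a.1, a.2.2⟩).toAdd
  have hEodd : Odd (Nat.card M) := odd_card_of_isPGroup hp (hE.to_subgroup M)
  let τ : Multiplicative (Fin m → ZMod p) →* Multiplicative (Fin m → ZMod p) :=
    invMonoidHom
  -- equidistribution of the evaluation map on odd elements
  have hfib : ∀ v, Nat.card {s : S // f s = v} * p ^ m = Nat.card S := by
    intro v
    have h := card_odd_fiber (σ := σM) (τ := τ) hEodd (fun x => Subtype.ext (hσ x))
      (fun x => inv_inv x) η (fun x => by
        apply Multiplicative.toAdd.injective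
        funext j
        exact hodd _ (b j).2 x (σM x) rfl) (evalBasis_surjective b)
      (b := Multiplicative.ofAdd v) rfl
    have h1 : Nat.card {y : Multiplicative (Fin m → ZMod p) // τ y = y⁻¹} = p ^ m := by
      rw [Nat.card_congr (Equiv.subtypeUnivEquiv (p := fun y => τ y = y⁻¹) fun _ => rfl)]
      change Nat.card (Fin m → ZMod p) = _
      simp
    have h2 : Nat.card {a : M // σM a = a⁻¹} = Nat.card S :=
      Nat.card_congr ⟨fun a => ⟨a.1.1, congrArg Subtype.val a.2, a.1.2⟩,
        fun a => ⟨⟨a.1, a.2.2⟩, Subtype.ext a.2.1⟩, fun _ => rfl, fun _ => rfl⟩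
    have h3 : Nat.card {a : M // σM a = a⁻¹ ∧ η a = Multiplicative.ofAdd v} =
        Nat.card {s : S // f s = v} :=
      Nat.card_congr ⟨fun a => ⟨⟨a.1.1, congrArg Subtype.val a.2.1, a.1.2⟩, a.2.2⟩,
        fun a => ⟨⟨a.1.1, a.1.2.2⟩, Subtype.ext a.1.2.1, a.2⟩, fun _ => rfl, fun _ => rfl⟩
    rw [h1, h2, h3] at h
    exact h
  let c := Nat.card {s : S // f s = 0}
  have hc : ∀ v, Nat.card {s : S // f s = v} = c := fun v =>
    Nat.eq_of_mul_eq_mul_right (pow_pos hp0 m) ((hfib v).trans (hfib 0).symm)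
  -- a tuple generates `M` if and only if the coordinates of its values are linearly independent
  have hlin : ∀ r : Fin k → S, Subgroup.normalClosure (Set.range fun i => (r i).1) = M ↔
      LinearIndependent (ZMod p) (fun (j : Fin m) (i : Fin k) => f (r i) j) := by
    intro r
    rw [normalClosure_eq_iff_invHoms (p := p) hE (fun i => (⟨(r i).1, (r i).2.2⟩ : M)),
      Fintype.linearIndependent_iff]
    constructor
    · intro h g hg
      refine Fintype.linearIndependent_iff.1 b.linearIndependent g (Subtype.ext ?_)
      refine h _ (∑ j, g j • b j).2 fun i => ?_
      have := congrFun hg i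
      simpa [f, η, evalBasis] using this
    · intro h x hx hr
      obtain ⟨g, h1⟩ : ∃ g : Fin m → ZMod p, ∑ j, g j • b j = ⟨x, hx⟩ :=
        ⟨_, b.sum_repr ⟨x, hx⟩⟩
      have h2 := h g (by
        funext i
        have h3 := congrFun (congrArg Subtype.val h1) ⟨(r i).1, (r i).2.2⟩
        rw [show (⟨x, hx⟩ : invHoms p M).1 ⟨(r i).1, (r i).2.2⟩ = 0 from hr i] at h3
        simpa [f, η, evalBasis] using h3)
      have h4 : (⟨x, hx⟩ : invHoms p M) = 0 := by
        rw [← h1]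
        exact Finset.sum_eq_zero fun j _ => by rw [h2 j, zero_smul]
      exact congrArg Subtype.val h4
  let e : {r : Fin k → E // (∀ i, σ (r i) = (r i)⁻¹) ∧
      Subgroup.normalClosure (Set.range r) = M} ≃
      {r : Fin k → S // LinearIndependent (ZMod p) (fun (j : Fin m) (i : Fin k) => f (r i) j)} :=
    { toFun := fun r => ⟨fun i => ⟨r.1 i, r.2.1 i, by
          have h : r.1 i ∈ Subgroup.normalClosure (Set.range r.1) :=
            Subgroup.subset_normalClosure ⟨i, rfl⟩
          rwa [r.2.2] at h⟩, (hlin _).1 r.2.2⟩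
      invFun := fun r => ⟨fun i => (r.1 i).1, fun i => (r.1 i).2.1, (hlin r.1).2 r.2⟩
      left_inv := fun _ => rfl
      right_inv := fun _ => rfl }
  have hcard := card_tuples_of_card_fiber f c hc k
    (fun A => LinearIndependent (ZMod p) (fun (j : Fin m) (i : Fin k) => A i j))
  have hA : Nat.card {A : Fin k → Fin m → ZMod p //
      LinearIndependent (ZMod p) (fun (j : Fin m) (i : Fin k) => A i j)} =
      ∏ i : Fin m, (p ^ k - p ^ i.val) := by
    have h := card_linearIndependent (K := ZMod p) (V := Fin k → ZMod p) (k := m) (by simpa)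
    simp only [ZMod.card, Module.finrank_fin_fun] at h
    rw [← h]
    exact Nat.card_congr (Equiv.subtypeEquiv (Equiv.piComm _) fun _ => Iff.rfl)
  rw [Nat.card_congr e, hcard, hA, ← hfib 0]
  have := prod_pow_sub_pow_mul_schConst hp0 hmk
  push_cast [c] at this ⊢
  rw [mul_assoc, this]
  ring

end invHoms

/-! ### Counting relators of a finite quotient -/

theorem exists_mulEquiv_of_ker_eq {E A B : Type*} [Group E] [Group A] [Group B] {f : E →* A}
    {g : E →* B} (hf : Function.Surjective f) (hg : Function.Surjective g) (h : f.ker = g.ker) :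
    ∃ e : A ≃* B, ∀ x, e (f x) = g x := by
  refine ⟨((QuotientGroup.quotientKerEquivOfSurjective f hf).symm.trans
    (QuotientGroup.quotientMulEquivOfEq h)).trans
    (QuotientGroup.quotientKerEquivOfSurjective g hg), fun x => ?_⟩
  have h1 : (QuotientGroup.quotientKerEquivOfSurjective f hf).symm (f x) = QuotientGroup.mk x := by
    rw [MulEquiv.symm_apply_eq]; rfl
  rw [MulEquiv.trans_apply, MulEquiv.trans_apply, h1]
  rfl

/-- A homomorphism that maps odd generators to odd elements is equivariant. -/
theorem equivariant_of_closure {E A : Type*} [Group E] [Group A] {σ : E →* E} {τ : A →* A}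
    {ι : Type*} {e : ι → E} (hgen : Subgroup.closure (Set.range e) = ⊤)
    (he : ∀ i, σ (e i) = (e i)⁻¹) {φ : E →* A} (h : ∀ i, τ (φ (e i)) = (φ (e i))⁻¹) (x : E) :
    φ (σ x) = τ (φ x) := by
  have : φ.comp σ = τ.comp φ := by
    refine MonoidHom.eq_of_eqOn_dense hgen ?_
    rintro _ ⟨i, rfl⟩
    simp [he, h]
  exact DFunLike.congr_fun this x

/-- In a finite `p`-group every maximal subgroup is normal, so that elements which generate the
group as a normal subgroup generate it. -/
theorem closure_eq_top_iff_normalClosure {p : ℕ} [Fact p.Prime] {Γ : Type*} [Group Γ] [Finite Γ]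
    (hΓ : IsPGroup p Γ) (s : Set Γ) :
    Subgroup.closure s = ⊤ ↔ Subgroup.normalClosure s = ⊤ := by
  refine ⟨fun h => top_le_iff.1 (h ▸ Subgroup.closure_le_normalClosure), fun h => ?_⟩
  by_contra hne
  obtain ⟨M, hM, hle⟩ := (eq_top_or_exists_le_coatom (Subgroup.closure s)).resolve_left hne
  have : Group.IsNilpotent Γ := hΓ.isNilpotent
  have : M.Normal := Subgroup.NormalizerCondition.normal_of_coatom M
    Group.normalizerCondition_of_isNilpotent hM
  refine hM.1 (top_le_iff.1 (h ▸ Subgroup.normalClosure_le_normal ?_))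
  exact (Subgroup.subset_closure).trans hle

section count

variable {p : ℕ} [Fact p.Prime] {E Γ : Type*} [Group E] [Finite E] [Group Γ] [Finite Γ]

theorem closure_range_eq_top_iff_invHoms (hΓ : IsPGroup p Γ) {ι : Type*} (y : ι → Γ) :
    Subgroup.closure (Set.range y) = ⊤ ↔
      ∀ f ∈ invHoms p (⊤ : Subgroup Γ), (∀ i, f ⟨y i, trivial⟩ = 0) → f = 0 := by
  rw [closure_eq_top_iff_normalClosure hΓ]
  exact normalClosure_eq_iff_invHoms hΓ fun i => (⟨y i, trivial⟩ : (⊤ : Subgroup Γ))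

/-- The number of odd relator tuples in `E` whose quotient is isomorphic to `Γ`. Pairs consisting
of such a tuple `r` and an epimorphism `E → Γ` with kernel generated by `r` are counted in two
ways. -/
theorem card_relators_mul_card_aut (hp : p ≠ 2) (hE : IsPGroup p E) (hΓ : IsPGroup p Γ)
    {σ : E →* E} (hσ : ∀ x, σ (σ x) = x) {τ : Γ →* Γ} (hτ : ∀ x, τ (τ x) = x) {k n m : ℕ}
    (e : Fin k → E) (he : ∀ i, σ (e i) = (e i)⁻¹) (hgen : Subgroup.closure (Set.range e) = ⊤)
    (hfree : ∀ y : Fin k → Γ, (∀ i, τ (y i) = (y i)⁻¹) → Subgroup.closure (Set.range y) = ⊤ →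
      ∃ φ : E →* Γ, ∀ i, φ (e i) = y i)
    (hX : OddInvHoms p τ (⊤ : Subgroup Γ))
    (hn : Module.finrank (ZMod p) (invHoms p (⊤ : Subgroup Γ)) = n) (hnk : n ≤ k)
    (hker : ∀ φ : E →* Γ, (∀ x, φ (σ x) = τ (φ x)) → Function.Surjective φ →
      OddInvHoms p σ φ.ker ∧ Module.finrank (ZMod p) (invHoms p φ.ker) = m) (hmk : m ≤ k) :
    (Nat.card {r : Fin k → E // (∀ i, σ (r i) = (r i)⁻¹) ∧ ∃ φ : E →* Γ,
        (∀ x, φ (σ x) = τ (φ x)) ∧ Function.Surjective φ ∧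
          φ.ker = Subgroup.normalClosure (Set.range r)} : ℝ) *
      (Nat.card {α : Γ ≃* Γ // ∀ x, α (τ x) = τ (α x)} : ℝ) *
      (schConst p (k - n) * schConst p (k - m)) =
      (Nat.card {a : E // σ a = a⁻¹} : ℝ) ^ k * schConst p k ^ 2 := by
  classical
  have : Finite (E →* Γ) := Finite.of_injective _ DFunLike.coe_injective
  let Epi := {φ : E →* Γ // (∀ x, φ (σ x) = τ (φ x)) ∧ Function.Surjective φ}
  let R := {r : Fin k → E // (∀ i, σ (r i) = (r i)⁻¹) ∧ ∃ φ : E →* Γ,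
        (∀ x, φ (σ x) = τ (φ x)) ∧ Function.Surjective φ ∧
          φ.ker = Subgroup.normalClosure (Set.range r)}
  let A := {α : Γ ≃* Γ // ∀ x, α (τ x) = τ (α x)}
  have := Fintype.ofFinite Epi
  have := Fintype.ofFinite R
  -- epimorphisms correspond to generating odd tuples
  have hEpi : (Nat.card Epi : ℝ) * schConst p (k - n) =
      (Nat.card {a : Γ // τ a = a⁻¹} : ℝ) ^ k * schConst p k := by
    have h := card_odd_normalGenerators hp hΓ hτ (M := ⊤) (fun _ _ => trivial) hX hn hnk
    have h1 : Nat.card {a : Γ // τ a = a⁻¹ ∧ a ∈ (⊤ : Subgroup Γ)} =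
        Nat.card {a : Γ // τ a = a⁻¹} :=
      Nat.card_congr (Equiv.subtypeEquivRight fun a => and_iff_left trivial)
    have h2 : Nat.card Epi = Nat.card {r : Fin k → Γ // (∀ i, τ (r i) = (r i)⁻¹) ∧
        Subgroup.normalClosure (Set.range r) = ⊤} := by
      have htop : ∀ φ : E →* Γ, Subgroup.closure (Set.range fun i => φ (e i)) = φ.range := by
        intro φ
        rw [MonoidHom.range_eq_map, ← hgen, MonoidHom.map_closure, ← Set.range_comp]
        rfl
      refine Nat.card_congr (Equiv.ofBijective (fun φ => ⟨fun i => φ.1 (e i), fun i => by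
        rw [← φ.2.1, he, map_inv], by
        rw [← closure_eq_top_iff_normalClosure hΓ, htop, MonoidHom.range_eq_top]
        exact φ.2.2⟩) ⟨fun φ ψ h => ?_, fun y => ?_⟩)
      · refine Subtype.ext (MonoidHom.eq_of_eqOn_dense hgen ?_)
        rintro _ ⟨i, rfl⟩
        exact congrFun (congrArg Subtype.val h) i
      · have hy := (closure_eq_top_iff_normalClosure hΓ _).2 y.2.2
        obtain ⟨φ, hφ⟩ := hfree y.1 y.2.1 hy
        refine ⟨⟨φ, equivariant_of_closure hgen he (fun i => by rw [hφ]; exact y.2.1 i), ?_⟩,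
          Subtype.ext (funext hφ)⟩
        rw [← MonoidHom.range_eq_top, ← htop, ← hy]
        simp only [hφ]
    rw [h2, h, h1]
  -- relator tuples that generate the kernel of a given epimorphism
  have hfib : ∀ φ : Epi, (Nat.card {r : Fin k → E // (∀ i, σ (r i) = (r i)⁻¹) ∧
      Subgroup.normalClosure (Set.range r) = φ.1.ker} : ℝ) * schConst p (k - m) *
      (Nat.card {a : Γ // τ a = a⁻¹} : ℝ) ^ k =
      (Nat.card {a : E // σ a = a⁻¹} : ℝ) ^ k * schConst p k := by
    intro φ
    obtain ⟨h1, h2⟩ := hker φ.1 φ.2.1 φ.2.2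
    have h3 := card_odd_normalGenerators hp hE hσ (M := φ.1.ker) (fun x hx => by
      rw [MonoidHom.mem_ker] at hx ⊢
      rw [φ.2.1, hx, map_one]) h1 h2 hmk
    have h4 := card_odd_fiber (odd_card_of_isPGroup hp hE) hσ hτ φ.1 φ.2.1 φ.2.2 (b := 1) (by simp)
    simp only [← MonoidHom.mem_ker] at h4
    rw [h3, ← h4]
    push_cast
    ring
  -- epimorphisms with a given kernel form a torsor under the automorphisms of `Γ`
  have haut : ∀ r : R, Nat.card {φ : Epi // φ.1.ker = Subgroup.normalClosure (Set.range r.1)} =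
      Nat.card A := by
    intro r
    obtain ⟨φ, h1, h2, h3⟩ := r.2.2
    have hk : ∀ α : A, (α.1.toMonoidHom.comp φ).ker = Subgroup.normalClosure (Set.range r.1) := by
      intro α
      rw [← h3]
      ext x
      simp [MonoidHom.mem_ker]
    refine (Nat.card_congr (Equiv.ofBijective (fun α : A =>
      (⟨⟨α.1.toMonoidHom.comp φ, fun x => by simp [h1, α.2], α.1.surjective.comp h2⟩, hk α⟩ :
        {φ : Epi // φ.1.ker = Subgroup.normalClosure (Set.range r.1)})) ⟨?_, ?_⟩)).symm
    · intro α β h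
      apply Subtype.ext
      ext y
      obtain ⟨x, rfl⟩ := h2 y
      exact DFunLike.congr_fun (congrArg (fun z => z.1.1) h) x
    · intro ψ
      obtain ⟨α, hα⟩ := exists_mulEquiv_of_ker_eq h2 ψ.1.2.2 (h3.trans ψ.2.symm)
      refine ⟨⟨α, fun y => ?_⟩, Subtype.ext (Subtype.ext (MonoidHom.ext hα))⟩
      obtain ⟨x, rfl⟩ := h2 y
      rw [← h1, hα, hα, ψ.1.2.1]
  have hswap : Nat.card R * Nat.card A = ∑ φ : Epi, Nat.card {r : Fin k → E //
      (∀ i, σ (r i) = (r i)⁻¹) ∧ Subgroup.normalClosure (Set.range r) = φ.1.ker} := by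
    rw [← Nat.card_sigma, Nat.card_eq_fintype_card, ← smul_eq_mul, ← Finset.card_univ,
      ← Finset.sum_const, ← Finset.sum_congr rfl fun r _ => haut r, ← Nat.card_sigma]
    exact Nat.card_congr
      { toFun := fun x => ⟨x.2.1, ⟨x.1.1, x.1.2.1, x.2.2.symm⟩⟩
        invFun := fun x => ⟨⟨x.2.1, x.2.2.1, x.1.1, x.1.2.1, x.1.2.2, x.2.2.2.symm⟩,
          ⟨x.1, x.2.2.2.symm⟩⟩
        left_inv := fun _ => rfl
        right_inv := fun _ => rfl }
  have hsum : (Nat.card R * Nat.card A : ℝ) * schConst p (k - m) *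
      (Nat.card {a : Γ // τ a = a⁻¹} : ℝ) ^ k =
      Nat.card Epi * ((Nat.card {a : E // σ a = a⁻¹} : ℝ) ^ k * schConst p k) := by
    rw [← Nat.cast_mul, hswap, Nat.cast_sum, Finset.sum_mul, Finset.sum_mul,
      Finset.sum_congr rfl fun φ _ => hfib φ]
    simp [Nat.card_eq_fintype_card]
  have : Nonempty {a : Γ // τ a = a⁻¹} := ⟨⟨1, by simp⟩⟩
  have hpos : ((Nat.card {a : Γ // τ a = a⁻¹} : ℝ)) ^ k ≠ 0 :=
    pow_ne_zero _ (Nat.cast_ne_zero.2 Nat.card_pos.ne')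
  refine mul_right_cancel₀ hpos ?_
  linear_combination schConst p (k - n) * hsum +
    (Nat.card {a : E // σ a = a⁻¹} : ℝ) ^ k * schConst p k * hEpi

end count

/-! ### Comparison of presentations -/

section schanuel

variable {p : ℕ} {E E' : Type*} [Group E] [Group E'] {l : ℕ} (M : Subgroup E)
  [M.Normal] {ι : E →* E'} {ρ : E' →* E} {z : Fin l → E'}
  {h : E' →* Multiplicative (Fin l → ZMod p)}

/-- The pullback of invariant homomorphisms. -/
def invHoms.pullback (ρ : E' →* E) {M' : Subgroup E'} (hM : M' ≤ M.comap ρ) :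
    invHoms p M →ₗ[ZMod p] invHoms p M' where
  toFun f := ⟨fun a => f.1 ⟨ρ a, hM a.2⟩,
    fun a b => (congrArg f.1 (Subtype.ext (map_mul ρ a.1 b.1))).trans
      (f.2.1 ⟨ρ a, hM a.2⟩ ⟨ρ b, hM b.2⟩),
    fun g a b hab => f.2.2 (ρ g) _ _ (by simp [hab])⟩
  map_add' _ _ := rfl
  map_smul' _ _ := rfl

omit [M.Normal] in
theorem le_comap_section (hρι : ∀ x, ρ (ι x) = x) : M ≤ (M.comap ρ).comap ι := fun x hx => by
  simpa [hρι] using hx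

/-- Let `ρ : E' → E` be a retraction with the section `ι`, and let `E'` be generated by the image of
`ι` and elements `z j` in the kernel of `ρ`. An invariant homomorphism on the preimage of `M` is
determined by its values on `ι(M)` and on the `z j`. -/
theorem invHoms.eq_of_eqOn_section (hρι : ∀ x, ρ (ι x) = x) (hρz : ∀ j, ρ (z j) = 1)
    (hgen : Subgroup.closure (Set.range ι ∪ Set.range z) = ⊤) (f : invHoms p (M.comap ρ))
    (hι : ∀ a : M, f.1 ⟨ι a, le_comap_section M hρι a.2⟩ = 0)
    (hz : ∀ j, f.1 ⟨z j, by simp [hρz, one_mem]⟩ = 0) : f = 0 := by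
  let Z := invHoms.ker f
  have h1 : (QuotientGroup.mk' Z) = (QuotientGroup.mk' Z).comp (ι.comp ρ) := by
    refine MonoidHom.eq_of_eqOn_dense hgen ?_
    rintro _ (⟨x, rfl⟩ | ⟨j, rfl⟩)
    · simp [hρι]
    · rw [MonoidHom.comp_apply, MonoidHom.comp_apply, hρz, map_one, map_one,
        QuotientGroup.mk'_apply, QuotientGroup.eq_one_iff]
      exact (invHoms.mem_ker _ _).2 ⟨_, hz j⟩
  apply Subtype.ext
  funext a
  have h2 : (QuotientGroup.mk (a : E') : E' ⧸ Z) = QuotientGroup.mk (ι (ρ a)) :=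
    DFunLike.congr_fun h1 a.1
  rw [QuotientGroup.eq] at h2
  obtain ⟨h3, h4⟩ := (invHoms.mem_ker _ _).1 h2
  have h5 : (⟨_, h3⟩ : M.comap ρ) = a⁻¹ * ⟨ι (ρ a), by
      have := a.2; simp only [Subgroup.mem_comap] at this ⊢; rwa [hρι]⟩ := rfl
  rw [h5, f.2.1, invHoms.apply_inv, hι ⟨ρ a, a.2⟩, add_zero, neg_eq_zero] at h4
  exact h4

/-- Adding `l` generators together with `l` relations that eliminate them raises the dimension of
the space of invariant homomorphisms on the relation subgroup by `l`. -/
theorem finrank_invHoms_comap [Fact p.Prime] [Finite E] (hρι : ∀ x, ρ (ι x) = x)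
    (hρz : ∀ j, ρ (z j) = 1)
    (hgen : Subgroup.closure (Set.range ι ∪ Set.range z) = ⊤) (hι : ∀ x, h (ι x) = 1)
    (hz : ∀ j, h (z j) = Multiplicative.ofAdd (Pi.single j 1)) :
    Module.finrank (ZMod p) (invHoms p (M.comap ρ)) =
      Module.finrank (ZMod p) (invHoms p M) + l := by
  let T : invHoms p (M.comap ρ) →ₗ[ZMod p] invHoms p M × (Fin l → ZMod p) :=
    { toFun := fun f => (invHoms.pullback (M.comap ρ) ι (le_comap_section M hρι) f,
        fun j => f.1 ⟨z j, by simp [hρz, one_mem]⟩)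
      map_add' := fun f g => rfl
      map_smul' := fun c f => rfl }
  have hT : Function.Bijective T := by
    constructor
    · rw [injective_iff_map_eq_zero]
      intro f hf
      exact invHoms.eq_of_eqOn_section M hρι hρz hgen f
        (fun a => congrFun (congrArg (fun x => x.1.1) hf) a)
        (fun j => congrFun (congrArg Prod.snd hf) j)
    · rintro ⟨f, c⟩
      let H : invHoms p (M.comap ρ) := ⟨fun a => ∑ j, (h a).toAdd j * c j, fun a b => by
          simp [add_mul, Finset.sum_add_distrib], fun g a b hab => by
          simp [hab]⟩
      refine ⟨invHoms.pullback M ρ le_rfl f + H,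
        Prod.ext (Subtype.ext (funext fun a => ?_)) (funext fun j => ?_)⟩
      · change f.1 ⟨ρ (ι a), _⟩ + ∑ j, (h (ι a)).toAdd j * c j = f.1 a
        simp [hι, hρι]
      · change f.1 ⟨ρ (z j), _⟩ + ∑ i, (h (z j)).toAdd i * c i = c j
        have : f.1 ⟨ρ (z j), by rw [hρz]; exact one_mem _⟩ = f.1 1 :=
          congrArg f.1 (Subtype.ext (hρz j))
        rw [this, invHoms.apply_one, hz]
        simp [Pi.single_apply]
  have : Finite (M → ZMod p) := Pi.finite
  rw [(LinearEquiv.ofBijective T hT).finrank_eq, Module.finrank_prod, Module.finrank_fin_fun]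

/-- The eliminated generators contribute only odd invariant homomorphisms. -/
theorem oddInvHoms_comap_iff {σ : E →* E} {σ' : E' →* E'} (hρι : ∀ x, ρ (ι x) = x)
    (hρz : ∀ j, ρ (z j) = 1)
    (hgen : Subgroup.closure (Set.range ι ∪ Set.range z) = ⊤) (hι : ∀ x, h (ι x) = 1)
    (hz : ∀ j, h (z j) = Multiplicative.ofAdd (Pi.single j 1))
    (hισ : ∀ x, ι (σ x) = σ' (ι x)) (hρσ : ∀ x, ρ (σ' x) = σ (ρ x))
    (hσ : ∀ x, h (σ' x) = (h x)⁻¹) :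
    OddInvHoms p σ' (M.comap ρ) ↔ OddInvHoms p σ M := by
  constructor
  · intro H f hf a b hab
    have h1 := H _ (invHoms.pullback M ρ le_rfl ⟨f, hf⟩).2 ⟨ι a, by simp [hρι]⟩
      ⟨ι b, by simp [hρι]⟩ (by simp [hab, hισ])
    simpa [invHoms.pullback, hρι] using h1
  · intro H f hf a b hab
    let f0 : invHoms p M := invHoms.pullback (M.comap ρ) ι (le_comap_section M hρι) ⟨f, hf⟩
    let c : Fin l → ZMod p := fun j => f ⟨z j, by simp [hρz, one_mem]⟩
    let H' : invHoms p (M.comap ρ) := ⟨fun a => ∑ j, (h a).toAdd j * c j, fun a b => by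
          simp [add_mul, Finset.sum_add_distrib], fun g a b hab => by
          simp [hab]⟩
    have h1 : (⟨f, hf⟩ : invHoms p (M.comap ρ)) - (invHoms.pullback M ρ le_rfl f0 + H') = 0 := by
      refine invHoms.eq_of_eqOn_section M hρι hρz hgen _ (fun a => ?_) (fun j => ?_)
      · change f ⟨ι a, _⟩ - (f0.1 ⟨ρ (ι a), _⟩ + ∑ j, (h (ι a)).toAdd j * c j) = 0
        simp only [hι, hρι, toAdd_one, Pi.zero_apply, zero_mul, Finset.sum_const_zero, add_zero]
        exact sub_self _
      · change f ⟨z j, _⟩ - (f0.1 ⟨ρ (z j), _⟩ + ∑ i, (h (z j)).toAdd i * c i) = 0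
        have : f0.1 ⟨ρ (z j), by rw [hρz]; exact one_mem _⟩ = f0.1 1 :=
          congrArg f0.1 (Subtype.ext (hρz j))
        rw [this, invHoms.apply_one, hz]
        simp [Pi.single_apply, c]
    have h2 : ∀ a, f a = f0.1 ⟨ρ a, a.2⟩ + ∑ j, (h a).toAdd j * c j := fun a =>
      sub_eq_zero.1 (congrFun (congrArg Subtype.val h1) a)
    rw [h2, h2, H f0.1 f0.2 ⟨ρ a, a.2⟩ ⟨ρ b, b.2⟩ (by simp [hab, hρσ]), hab, hσ]
    simp
    ring

end schanuel

/-! ### Numbers of generators of finite groups -/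

section generators

variable {p : ℕ} [Fact p.Prime] {E : Type*} [Group E] [Finite E] {M : Subgroup E}

omit [Finite E] in
/-- Elements at which no nonzero invariant homomorphism vanishes simultaneously span the dual of
the space of invariant homomorphisms. -/
theorem finrank_invHoms_le {d : ℕ} (r : Fin d → M)
    (h : ∀ f ∈ invHoms p M, (∀ i, f (r i) = 0) → f = 0) :
    Module.finrank (ZMod p) (invHoms p M) ≤ d := by
  let T : invHoms p M →ₗ[ZMod p] (Fin d → ZMod p) :=
    { toFun := fun f i => f.1 (r i), map_add' := fun _ _ => rfl, map_smul' := fun _ _ => rfl }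
  have hT : Function.Injective T := by
    rw [injective_iff_map_eq_zero]
    exact fun f hf => Subtype.ext (h f.1 f.2 fun i => congrFun hf i)
  simpa using LinearMap.finrank_le_finrank_of_injective hT

omit [Finite E] in
/-- Elements whose values are a multiple of the dual basis separate the invariant homomorphisms. The
factor `u` is `2` for the odd elements obtained from `x ↦ σ(x)⁻¹ x`. -/
theorem separating_of_evalBasis {m : ℕ} (b : Module.Basis (Fin m) (ZMod p) (invHoms p M))
    (r : Fin m → M) (u : (ZMod p)ˣ)
    (hr : ∀ i, evalBasis b (r i) = Multiplicative.ofAdd (Pi.single i (u : ZMod p))) :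
    ∀ f ∈ invHoms p M, (∀ i, f (r i) = 0) → f = 0 := by
  intro f hf h
  obtain ⟨g, hg⟩ : ∃ g : Fin m → ZMod p, ∑ j, g j • b j = ⟨f, hf⟩ := ⟨_, b.sum_repr ⟨f, hf⟩⟩
  have h1 : ∀ i, g i = 0 := by
    intro i
    have h2 := congrFun (congrArg Subtype.val hg) (r i)
    rw [show (⟨f, hf⟩ : invHoms p M).1 (r i) = 0 from h i] at h2
    have h3 : ∀ j, (b j).1 (r i) = (Pi.single i (u : ZMod p) : Fin m → ZMod p) j :=
      fun j => congrFun (congrArg Multiplicative.toAdd (hr i)) j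
    simpa [h3, Pi.single_apply] using h2
  have h2 : (⟨f, hf⟩ : invHoms p M) = 0 := by
    rw [← hg]
    exact Finset.sum_eq_zero fun j _ => by rw [h1 j, zero_smul]
  exact congrArg Subtype.val h2

theorem exists_separating :
    ∃ r : Fin (Module.finrank (ZMod p) (invHoms p M)) → M,
      ∀ f ∈ invHoms p M, (∀ i, f (r i) = 0) → f = 0 := by
  have : Finite (M → ZMod p) := Pi.finite
  let b := Module.finBasis (ZMod p) (invHoms p M)
  choose r hr using fun i => evalBasis_surjective b (Multiplicative.ofAdd (Pi.single i 1))
  exact ⟨r, separating_of_evalBasis b r 1 hr⟩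

/-- If the invariant homomorphisms are odd, then the elements that separate them can be chosen odd:
the value of an invariant homomorphism at `σ(x)⁻¹ x` is twice its value at `x`. -/
theorem exists_odd_separating (hp : p ≠ 2) {σ : E →* E} (hσ : ∀ x, σ (σ x) = x)
    (hM : ∀ x ∈ M, σ x ∈ M) (hodd : OddInvHoms p σ M) :
    ∃ r : Fin (Module.finrank (ZMod p) (invHoms p M)) → M, (∀ i, σ (r i) = (r i : E)⁻¹) ∧
      ∀ f ∈ invHoms p M, (∀ i, f (r i) = 0) → f = 0 := by
  have : Finite (M → ZMod p) := Pi.finite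
  let b := Module.finBasis (ZMod p) (invHoms p M)
  choose r hr using fun i => evalBasis_surjective b (Multiplicative.ofAdd (Pi.single i 1))
  have h2 : (2 : ZMod p) ≠ 0 := by
    intro h
    have h' : ((2 : ℕ) : ZMod p) = 0 := by exact_mod_cast h
    rw [ZMod.natCast_eq_zero_iff] at h'
    exact hp ((Nat.prime_dvd_prime_iff_eq Fact.out Nat.prime_two).1 h')
  refine ⟨fun i => ⟨oddDiff σ (r i : E), mul_mem (inv_mem (hM _ (r i).2)) (r i).2⟩,
    fun i => sigma_oddDiff hσ _, separating_of_evalBasis b _ (Units.mk0 2 h2) fun i => ?_⟩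
  apply Multiplicative.toAdd.injective
  funext j
  have h3 : (b j).1 (r i) = (Pi.single i 1 : Fin _ → ZMod p) j :=
    congrFun (congrArg Multiplicative.toAdd (hr i)) j
  have h4 : (b j).1 ⟨σ (r i : E), hM _ (r i).2⟩ = - (b j).1 (r i) := hodd _ (b j).2 _ _ rfl
  have h5 := (b j).2.1 (⟨σ (r i : E), hM _ (r i).2⟩ : M)⁻¹ (r i)
  rw [invHoms.apply_inv, h4, h3] at h5
  refine h5.trans ?_
  rcases eq_or_ne i j with rfl | hij
  · simp; norm_num
  · simp [hij.symm]

theorem minNormalGenerators_eq_finrank [TopologicalSpace E] [DiscreteTopology E] [M.Normal]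
    (hE : IsPGroup p E) : minNormalGenerators M = Module.finrank (ZMod p) (invHoms p M) := by
  have hset : {d | ∃ x : Fin d → E,
      closure (Subgroup.normalClosure (Set.range x) : Set E) = (M : Set E)} =
      {d | ∃ x : Fin d → E, Subgroup.normalClosure (Set.range x) = M} := by
    simp only [closure_discrete, SetLike.coe_set_eq]
  rw [minNormalGenerators, hset]
  refine le_antisymm (Nat.sInf_le ?_) (le_csInf ?_ ?_)
  · obtain ⟨r, hr⟩ := exists_separating (p := p) (M := M)
    exact ⟨fun i => r i, (normalClosure_eq_iff_invHoms hE r).2 hr⟩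
  · obtain ⟨r, hr⟩ := exists_separating (p := p) (M := M)
    exact ⟨_, fun i => r i, (normalClosure_eq_iff_invHoms hE r).2 hr⟩
  · rintro d ⟨x, hx⟩
    have hxM : ∀ i, x i ∈ M := fun i => by
      rw [← hx]; exact Subgroup.subset_normalClosure ⟨i, rfl⟩
    exact finrank_invHoms_le (fun i => ⟨x i, hxM i⟩)
      ((normalClosure_eq_iff_invHoms hE fun i => (⟨x i, hxM i⟩ : M)).1 hx)

theorem exists_closure_eq_top_iff_finrank_le (hE : IsPGroup p E) (d : ℕ) :
    (∃ x : Fin d → E, Subgroup.closure (Set.range x) = ⊤) ↔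
      Module.finrank (ZMod p) (invHoms p (⊤ : Subgroup E)) ≤ d := by
  constructor
  · rintro ⟨x, hx⟩
    exact finrank_invHoms_le (fun i => ⟨x i, trivial⟩)
      ((closure_range_eq_top_iff_invHoms hE x).1 hx)
  · intro h
    obtain ⟨r, hr⟩ := exists_separating (p := p) (M := (⊤ : Subgroup E))
    refine ⟨fun i => if h : i.1 < Module.finrank (ZMod p) (invHoms p (⊤ : Subgroup E)) then
      r ⟨i, h⟩ else 1, (closure_range_eq_top_iff_invHoms hE _).2 fun f hf h' => hr f hf fun i => ?_⟩
    have := h' ⟨i, i.2.trans_le h⟩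
    simpa using this

end generators

/-! ### The free pro-`p`-group as a topological group -/

namespace FreeProP

variable {p n : ℕ}

/-- The projection of the free pro-`p`-group to one of its defining finite quotients. -/
def proj (N : PIndex p n) : FreeProP p n →* PQuotient N where
  toFun f := f.1 N
  map_one' := rfl
  map_mul' _ _ := rfl

theorem continuous_proj (N : PIndex p n) : Continuous (proj N) :=
  (continuous_apply N).comp continuous_subtype_val

theorem ext_proj {f g : FreeProP p n} (h : ∀ N, proj N f = proj N g) : f = g :=
  Subtype.ext (funext h)

theorem finite_pQuotient [hp : Fact p.Prime] (N : PIndex p n) : Finite (PQuotient N) := by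
  obtain ⟨k, hk⟩ := N.2.2
  have : N.1.FiniteIndex := ⟨by rw [hk]; exact pow_ne_zero _ hp.out.ne_zero⟩
  exact inferInstanceAs (Finite (FreeGroup (Fin n) ⧸ N.1))

theorem isPGroup_pQuotient (N : PIndex p n) : IsPGroup p (PQuotient N) := by
  obtain ⟨k, hk⟩ := N.2.2
  exact IsPGroup.of_card (n := k) hk

theorem isClosed_freeProPSubgroup :
    IsClosed (freeProPSubgroup p n : Set (∀ N : PIndex p n, PQuotient N)) := by
  have : (freeProPSubgroup p n : Set (∀ N : PIndex p n, PQuotient N)) =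
      ⋂ (N : PIndex p n) (M : PIndex p n) (h : N.1 ≤ M.1),
        {f | PQuotient.map N M (MonoidHom.id _) h (f N) = f M} := by
    ext f
    simp [freeProPSubgroup]
  rw [this]
  refine isClosed_iInter fun N => isClosed_iInter fun M => isClosed_iInter fun h => ?_
  exact isClosed_eq (continuous_of_discreteTopology.comp (continuous_apply N)) (continuous_apply M)

instance [Fact p.Prime] : CompactSpace (FreeProP p n) := by
  have : ∀ N : PIndex p n, Finite (PQuotient N) := finite_pQuotient
  exact isCompact_iff_compactSpace.1 isClosed_freeProPSubgroup.isCompact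

instance : T2Space (FreeProP p n) := inferInstanceAs (T2Space (freeProPSubgroup p n))

theorem exists_pIndex_le [hp : Fact p.Prime] (I : Finset (PIndex p n)) :
    ∃ N : PIndex p n, ∀ M ∈ I, N.1 ≤ M.1 := by
  classical
  induction I using Finset.induction_on with
  | empty => exact ⟨⟨⊤, inferInstance, 0, by simp⟩, by simp⟩
  | insert M I _ ih =>
    obtain ⟨N, hN⟩ := ih
    have hpow : ∃ k, (M.1 ⊓ N.1).index = p ^ k := by
      obtain ⟨a, ha⟩ := M.2.2
      obtain ⟨b, hb⟩ := N.2.2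
      have h := Subgroup.relIndex_mul_index (inf_le_right : M.1 ⊓ N.1 ≤ N.1)
      rw [Subgroup.inf_relIndex_right] at h
      obtain ⟨c, -, hc⟩ := (Nat.dvd_prime_pow hp.out).1
        (ha ▸ Subgroup.relIndex_dvd_index_of_normal M.1 N.1)
      exact ⟨c + b, by rw [← h, hc, hb, pow_add]⟩
    refine ⟨⟨M.1 ⊓ N.1, inferInstance, hpow⟩, fun M' hM' => ?_⟩
    rcases Finset.mem_insert.1 hM' with rfl | h
    · exact inf_le_left
    · exact inf_le_right.trans (hN M' h)

/-- The fibres of the projections form a neighbourhood basis. -/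
theorem exists_proj_fiber_subset [Fact p.Prime] (f : FreeProP p n) {U : Set (FreeProP p n)}
    (hU : U ∈ 𝓝 f) : ∃ N : PIndex p n, ∀ g, proj N g = proj N f → g ∈ U := by
  obtain ⟨V, hV, hVU⟩ := mem_nhds_induced Subtype.val f U |>.1 hU
  obtain ⟨W, hWV, hW, hfW⟩ := mem_nhds_iff.1 hV
  obtain ⟨I, u, hu, hIu⟩ := isOpen_pi_iff.1 hW f.1 hfW
  obtain ⟨N, hN⟩ := exists_pIndex_le I
  refine ⟨N, fun g hg => hVU (hWV (hIu fun M hM => ?_))⟩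
  have h1 := g.2 N M (hN M hM)
  have h2 := f.2 N M (hN M hM)
  have h3 : g.1 N = f.1 N := hg
  rw [← h1, h3, h2]
  exact (hu M hM).2

theorem exists_ker_proj_le [Fact p.Prime] {U : Set (FreeProP p n)} (hU : U ∈ 𝓝 1) :
    ∃ N : PIndex p n, ((proj N).ker : Set (FreeProP p n)) ⊆ U := by
  obtain ⟨N, hN⟩ := exists_proj_fiber_subset 1 hU
  exact ⟨N, fun g hg => hN g (by rw [map_one]; exact hg)⟩

theorem isOpen_ker_proj (N : PIndex p n) : IsOpen ((proj N).ker : Set (FreeProP p n)) :=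
  (isOpen_discrete ({1} : Set (PQuotient N))).preimage (continuous_proj N)

theorem pow_mem_of_nhds [Fact p.Prime] {U : Set (FreeProP p n)} (hU : U ∈ 𝓝 1)
    (a : FreeProP p n) : ∃ j, a ^ p ^ j ∈ U := by
  obtain ⟨N, hN⟩ := exists_ker_proj_le hU
  obtain ⟨j, hj⟩ := isPGroup_pQuotient N (proj N a)
  exact ⟨j, hN (by rw [SetLike.mem_coe, MonoidHom.mem_ker, map_pow, hj])⟩

theorem isPGroup_quotient [Fact p.Prime] {K : Subgroup (FreeProP p n)} [K.Normal]
    (hK : IsOpen (K : Set (FreeProP p n))) : IsPGroup p (FreeProP p n ⧸ K) := by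
  intro x
  induction x using QuotientGroup.induction_on with
  | H x =>
    obtain ⟨j, hj⟩ := pow_mem_of_nhds (hK.mem_nhds (one_mem K)) x
    exact ⟨j, by rw [← QuotientGroup.mk_pow, QuotientGroup.eq_one_iff]; exact hj⟩

/-- The canonical map of the abstract free group. -/
def ofFree (p n : ℕ) : FreeGroup (Fin n) →* FreeProP p n where
  toFun x := ⟨fun N => (QuotientGroup.mk x : FreeGroup (Fin n) ⧸ N.1), fun _ _ _ => rfl⟩
  map_one' := rfl
  map_mul' _ _ := rfl

theorem denseRange_ofFree [Fact p.Prime] : DenseRange (ofFree p n) := by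
  intro f
  rw [mem_closure_iff_nhds]
  intro U hU
  obtain ⟨N, hN⟩ := exists_proj_fiber_subset f hU
  obtain ⟨x, hx⟩ := QuotientGroup.mk_surjective (proj N f : FreeGroup (Fin n) ⧸ N.1)
  exact ⟨ofFree p n x, hN _ hx, x, rfl⟩

theorem range_ofFree : (ofFree p n).range = Subgroup.closure (Set.range gen) := by
  rw [MonoidHom.range_eq_map, ← FreeGroup.closure_range_of, MonoidHom.map_closure,
    ← Set.range_comp]
  rfl

theorem dense_closure_gen [Fact p.Prime] :
    Dense (Subgroup.closure (Set.range (gen : Fin n → FreeProP p n)) : Set (FreeProP p n)) := by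
  rw [← range_ofFree]
  exact denseRange_ofFree

/-- Continuous homomorphisms are determined by the images of the generators. -/
theorem hom_ext [Fact p.Prime] {A : Type*} [Group A] [TopologicalSpace A] [T2Space A]
    {φ ψ : FreeProP p n →* A} (hφ : Continuous φ) (hψ : Continuous ψ)
    (h : ∀ i, φ (gen i) = ψ (gen i)) : φ = ψ := by
  have h1 : Set.EqOn φ ψ (Subgroup.closure (Set.range (gen : Fin n → FreeProP p n)) : Set _) :=
    MonoidHom.eqOn_closure (by rintro _ ⟨i, rfl⟩; exact h i)
  exact MonoidHom.ext fun x => congrFun (Continuous.ext_on dense_closure_gen hφ hψ h1) x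

/-- The universal property with respect to finite `p`-groups. -/
theorem exists_lift_finite [hp : Fact p.Prime] {Q : Type*} [Group Q] [TopologicalSpace Q]
    [DiscreteTopology Q] [Finite Q] (hQ : IsPGroup p Q) (g : Fin n → Q) :
    ∃ φ : FreeProP p n →* Q, Continuous φ ∧ ∀ i, φ (gen i) = g i := by
  let N : PIndex p n := ⟨(FreeGroup.lift g).ker, inferInstance, by
    rw [Subgroup.index_ker]
    exact IsPGroup.iff_card.1 (hQ.to_subgroup _)⟩
  let ψ : PQuotient N →* Q := QuotientGroup.kerLift (FreeGroup.lift g)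
  refine ⟨ψ.comp (proj N), (continuous_of_discreteTopology (f := ψ)).comp (continuous_proj N),
    fun i => ?_⟩
  change FreeGroup.lift g (FreeGroup.of i) = g i
  simp

/-- The universal property with respect to free pro-`p`-groups. -/
theorem exists_lift [hp : Fact p.Prime] {k : ℕ} (g : Fin n → FreeProP p k) :
    ∃ φ : FreeProP p n →* FreeProP p k, Continuous φ ∧ ∀ i, φ (gen i) = g i := by
  have : ∀ N : PIndex p k, Finite (PQuotient N) := finite_pQuotient
  choose φ hφ hφg using fun N : PIndex p k =>
    exists_lift_finite (isPGroup_pQuotient N) fun i => proj N (g i)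
  refine ⟨{ toFun := fun f => ⟨fun N => φ N f, fun N M h => ?_⟩
            map_one' := ext_proj fun N => map_one (φ N)
            map_mul' := fun a b => ext_proj fun N => map_mul (φ N) a b },
    Continuous.subtype_mk (continuous_pi hφ) _, fun i => ext_proj fun N => hφg N i⟩
  refine DFunLike.congr_fun (hom_ext (φ := (PQuotient.map N M (MonoidHom.id _) h).comp (φ N))
    (ψ := φ M)
    ((continuous_of_discreteTopology (f := PQuotient.map N M (MonoidHom.id _) h)).comp (hφ N))
    (hφ M) fun i => ?_) f
  rw [MonoidHom.comp_apply, hφg, hφg]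
  exact (g i).2 N M h

instance [Fact p.Prime] : Countable (PIndex p n) := by
  let F : (Σ m : ℕ, (Fin n → Equiv.Perm (Fin m))) → Set (FreeGroup (Fin n)) :=
    fun x => ((FreeGroup.lift x.2).ker : Set _)
  have h : Set.range (fun N : PIndex p n => (N.1 : Set (FreeGroup (Fin n)))) ⊆ Set.range F := by
    rintro _ ⟨N, rfl⟩
    have : Finite (FreeGroup (Fin n) ⧸ N.1) := finite_pQuotient N
    let e := Finite.equivFin (FreeGroup (Fin n) ⧸ N.1)
    let ψ : FreeGroup (Fin n) →* Equiv.Perm (FreeGroup (Fin n) ⧸ N.1) := MulAction.toPermHom _ _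
    refine ⟨⟨_, fun i => e.permCongrHom (ψ (FreeGroup.of i))⟩, ?_⟩
    have h1 : FreeGroup.lift (fun i => e.permCongrHom (ψ (FreeGroup.of i))) =
        (e.permCongrHom : _ →* _).comp ψ := by
      ext1 i; simp
    ext x
    simp only [F, h1, SetLike.mem_coe, MonoidHom.mem_ker, MonoidHom.comp_apply]
    rw [MonoidHom.coe_coe, MulEquiv.map_eq_one_iff, ← MonoidHom.mem_ker,
      ← Subgroup.normalCore_eq_ker, Subgroup.normalCore_eq_self]
  have h2 := (Set.countable_range F).mono h
  have hinj : Function.Injective (fun N : PIndex p n => (N.1 : Set (FreeGroup (Fin n)))) :=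
    fun N M h => Subtype.ext (SetLike.coe_injective h)
  rw [← Set.image_univ] at h2
  exact Set.countable_univ_iff.1
    (Set.countable_of_injective_of_countable_image hinj.injOn h2)

instance [Fact p.Prime] : SecondCountableTopology (FreeProP p n) := by
  have : ∀ N : PIndex p n, Finite (PQuotient N) := finite_pQuotient
  have : ∀ N : PIndex p n, SecondCountableTopology (PQuotient N) := fun N => inferInstance
  exact TopologicalSpace.Subtype.secondCountableTopology
    (freeProPSubgroup p n : Set (∀ N : PIndex p n, PQuotient N))

end FreeProP

/-! ### The Zassenhaus filtration -/

section zassenhaus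

variable (p : ℕ) [hp : Fact p.Prime] {G : Type*} [Group G] [TopologicalSpace G]
  [IsTopologicalGroup G]

theorem ceilDiv_prime_lt {m : ℕ} (hm : 2 ≤ m) : m ⌈/⌉ p < m := by
  have h2 := hp.out.two_le
  rw [Nat.ceilDiv_eq_add_pred_div, Nat.div_lt_iff_lt_mul (by omega)]
  nlinarith [Nat.sub_add_cancel (show 1 ≤ m + p by omega)]

theorem isClosed_zassenhaus (m : ℕ) : IsClosed (zassenhaus p G m : Set G) := by
  match m with
  | 0 => simp [zassenhaus]
  | 1 => simp [zassenhaus]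
  | m + 2 => rw [zassenhaus]; exact Subgroup.isClosed_topologicalClosure _

theorem pow_mem_zassenhaus {m : ℕ} (hm : 2 ≤ m) {x : G} (hx : x ∈ zassenhaus p G (m ⌈/⌉ p)) :
    x ^ p ∈ zassenhaus p G m := by
  obtain ⟨m, rfl⟩ := Nat.exists_eq_add_of_le' hm
  rw [zassenhaus]
  exact Subgroup.le_topologicalClosure _ (Subgroup.subset_closure (Or.inl ⟨x, hx, rfl⟩))

theorem comm_mem_zassenhaus {i j : ℕ} (hi : 1 ≤ i) (hj : 1 ≤ j) {a b : G}
    (ha : a ∈ zassenhaus p G i) (hb : b ∈ zassenhaus p G j) :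
    a * b * a⁻¹ * b⁻¹ ∈ zassenhaus p G (i + j) := by
  obtain ⟨m, hm⟩ : ∃ m, i + j = m + 2 := ⟨i + j - 2, by omega⟩
  rw [hm, zassenhaus]
  exact Subgroup.le_topologicalClosure _ (Subgroup.subset_closure
    (Or.inr ⟨i, j, hi, hj, hm, a, ha, b, hb, rfl⟩))

theorem zassenhaus_le {m : ℕ} (hm : 2 ≤ m) {S : Subgroup G} (hS : IsClosed (S : Set G))
    (hpow : ∀ x ∈ zassenhaus p G (m ⌈/⌉ p), x ^ p ∈ S)
    (hcomm : ∀ i j, 1 ≤ i → 1 ≤ j → i + j = m → ∀ a ∈ zassenhaus p G i,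
      ∀ b ∈ zassenhaus p G j, a * b * a⁻¹ * b⁻¹ ∈ S) : zassenhaus p G m ≤ S := by
  obtain ⟨m, rfl⟩ := Nat.exists_eq_add_of_le' hm
  rw [zassenhaus]
  refine Subgroup.topologicalClosure_minimal _ ((Subgroup.closure_le S).2 ?_) hS
  rintro y (⟨x, hx, rfl⟩ | ⟨i, j, hi, hj, h, a, ha, b, hb, rfl⟩)
  · exact hpow x hx
  · exact hcomm i j hi hj h a ha b hb

theorem map_mem_zassenhaus {H : Type*} [Group H] [TopologicalSpace H] [IsTopologicalGroup H]
    (f : G →* H) (hf : Continuous f) (m : ℕ) :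
    ∀ x ∈ zassenhaus p G m, f x ∈ zassenhaus p H m := by
  induction m using Nat.strong_induction_on with
  | _ m ih =>
    rcases Nat.lt_or_ge m 2 with hm | hm
    · intro x _
      interval_cases m <;> simp [zassenhaus]
    · refine zassenhaus_le p (S := (zassenhaus p H m).comap f) hm
        ((isClosed_zassenhaus p m).preimage hf) (fun x hx => ?_) (fun i j hi hj h a ha b hb => ?_)
      · rw [Subgroup.mem_comap, map_pow]
        exact pow_mem_zassenhaus p hm (ih _ (ceilDiv_prime_lt p hm) x hx)
      · simp only [Subgroup.mem_comap, map_mul, map_inv]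
        rw [← h]
        exact comm_mem_zassenhaus p hi hj (ih i (by omega) a ha) (ih j (by omega) b hb)

theorem map_zassenhaus_of_surjective [CompactSpace G] {H : Type*} [Group H] [TopologicalSpace H]
    [IsTopologicalGroup H] [T2Space H] (f : G →* H) (hf : Continuous f)
    (hs : Function.Surjective f) (m : ℕ) :
    (zassenhaus p G m).map f = zassenhaus p H m := by
  refine le_antisymm (Subgroup.map_le_iff_le_comap.2 (map_mem_zassenhaus p f hf m)) ?_
  induction m using Nat.strong_induction_on with
  | _ m ih =>
    rcases Nat.lt_or_ge m 2 with hm | hm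
    · intro x _
      obtain ⟨y, rfl⟩ := hs x
      interval_cases m <;> exact ⟨y, by simp [zassenhaus], rfl⟩
    · refine zassenhaus_le p hm
        ((isClosed_zassenhaus p m).isCompact.image hf).isClosed (fun x hx => ?_)
        (fun i j hi hj h a ha b hb => ?_)
      · obtain ⟨y, hy, rfl⟩ := ih _ (ceilDiv_prime_lt p hm) hx
        exact ⟨y ^ p, pow_mem_zassenhaus p hm hy, map_pow f y p⟩
      · obtain ⟨a', ha', rfl⟩ := ih i (by omega) ha
        obtain ⟨b', hb', rfl⟩ := ih j (by omega) hb
        refine ⟨a' * b' * a'⁻¹ * b'⁻¹, ?_, by simp only [map_mul, map_inv]⟩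
        rw [← h]
        exact comm_mem_zassenhaus p hi hj ha' hb'

theorem zassenhaus_succ_le (m : ℕ) : zassenhaus p G (m + 1) ≤ zassenhaus p G m := by
  induction m using Nat.strong_induction_on with
  | _ m ih =>
    rcases Nat.lt_or_ge m 2 with hm | hm
    · intro x _
      interval_cases m <;> simp [zassenhaus]
    have hanti : ∀ i j, i ≤ j → j ≤ m → zassenhaus p G j ≤ zassenhaus p G i := by
      intro i j hij
      induction j, hij using Nat.le_induction with
      | base => exact fun _ => le_rfl
      | succ j _ ihj => exact fun hj => (ih j (by omega)).trans (ihj (by omega))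
    refine zassenhaus_le p (by omega) (isClosed_zassenhaus p m) (fun x hx => ?_)
      (fun i j hi hj h a ha b hb => ?_)
    · refine pow_mem_zassenhaus p hm (hanti _ _ ?_ ?_ hx)
      · rw [Nat.ceilDiv_eq_add_pred_div, Nat.ceilDiv_eq_add_pred_div]
        exact Nat.div_le_div_right (by omega)
      · have := ceilDiv_prime_lt p (m := m + 1) (by omega)
        omega
    · rcases Nat.lt_or_ge i 2 with hi' | hi'
      · obtain rfl : i = 1 := by omega
        obtain ⟨j, rfl⟩ : ∃ j', j = j' + 1 := ⟨j - 1, by omega⟩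
        have := comm_mem_zassenhaus p hi (by omega) ha (hanti j (j + 1) (by omega) (by omega) hb)
        rwa [show 1 + j = m by omega] at this
      · obtain ⟨i, rfl⟩ : ∃ i', i = i' + 1 := ⟨i - 1, by omega⟩
        have := comm_mem_zassenhaus p (by omega) hj (hanti i (i + 1) (by omega) (by omega) ha) hb
        rwa [show i + j = m by omega] at this

theorem zassenhaus_antitone : Antitone (zassenhaus p G) :=
  antitone_nat_of_succ_le (zassenhaus_succ_le p)

theorem pow_mem_zassenhaus_succ {m : ℕ} (hm : 1 ≤ m) {x : G} (hx : x ∈ zassenhaus p G m) :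
    x ^ p ∈ zassenhaus p G (m + 1) :=
  pow_mem_zassenhaus p (by omega) (zassenhaus_antitone p (by
    have := ceilDiv_prime_lt p (m := m + 1) (by omega)
    omega) hx)

/-- In a finitely generated compact group, a closed subgroup `L` containing the `p`-th powers and
commutators of an open subgroup `H` is open: the group `H` is again finitely generated, so that
`H / (H ∩ L)` is a finitely generated elementary abelian group. -/
theorem isOpen_of_pow_comm_mem [CompactSpace G] [T2Space G] {ι : Type*} [Finite ι] {g : ι → G}
    (hg : Dense (Subgroup.closure (Set.range g) : Set G)) {H L : Subgroup G}
    (hH : IsOpen (H : Set G)) (hL : IsClosed (L : Set G)) (hpow : ∀ x ∈ H, x ^ p ∈ L)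
    (hcomm : ∀ a ∈ H, ∀ b ∈ H, a * b * a⁻¹ * b⁻¹ ∈ L) : IsOpen (L : Set G) := by
  let A := Subgroup.closure (Set.range g)
  have hHc : IsClosed (H : Set G) := Subgroup.isClosed_of_isOpen H hH
  have hcH : CompactSpace H := isCompact_iff_compactSpace.1 hHc.isCompact
  have hHfin : H.FiniteIndex := by
    have := H.quotient_finite_of_isOpen hH
    exact Subgroup.finiteIndex_of_finite_quotient
  have hAfg : Group.FG A := (Group.fg_iff_subgroup_fg A).2
    ((Subgroup.fg_iff A).2 ⟨_, rfl, Set.finite_range g⟩)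
  let N := L.subgroupOf H
  have hN : N.Normal := ⟨fun x hx y => by
    rw [Subgroup.mem_subgroupOf] at hx ⊢
    have h1 := mul_mem (hcomm y y.2 x x.2) hx
    simpa using h1⟩
  let Q := H ⧸ N
  have hQT2 : IsClosed (N : Set H) := hL.preimage continuous_subtype_val
  let _ : CommGroup Q := { (inferInstance : Group Q) with
    mul_comm := by
      intro x y
      induction x using QuotientGroup.induction_on with
      | H x =>
      induction y using QuotientGroup.induction_on with
      | H y =>
        change (QuotientGroup.mk (x * y) : Q) = QuotientGroup.mk (y * x)
        rw [QuotientGroup.eq, Subgroup.mem_subgroupOf]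
        have h1 := hcomm (y : G)⁻¹ (inv_mem y.2) (x : G)⁻¹ (inv_mem x.2)
        simpa [mul_assoc] using h1 }
  have hQtop : IsTopologicalGroup Q := inferInstanceAs (IsTopologicalGroup (H ⧸ N))
  have hQ2 : T2Space Q := inferInstanceAs (T2Space (H ⧸ N))
  let B : Subgroup A := H.subgroupOf A
  have hB : Group.FG B := Subgroup.fg_of_index_ne_zero B
  let ψ : B →* Q := (QuotientGroup.mk' N).comp
    ((A.subtype.comp B.subtype).codRestrict H fun x => x.2)
  have hR : Group.FG ψ.range := Group.fg_range ψ
  have hfin : Finite ψ.range := by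
    refine CommGroup.finite_of_fg_isMulTorsion _ fun x => isOfFinOrder_iff_pow_eq_one.2
      ⟨p, hp.out.pos, ?_⟩
    obtain ⟨_, ⟨y, rfl⟩⟩ := x
    apply Subtype.ext
    change ψ y ^ p = 1
    rw [← map_pow]
    exact (QuotientGroup.eq_one_iff _).2 (hpow _ y.2)
  have hdense : Dense (ψ.range : Set Q) := by
    intro x
    induction x using QuotientGroup.induction_on with
    | H x =>
      have h1 : (x : G) ∈ closure ((H : Set G) ∩ A) :=
        hg.open_subset_closure_inter hH x.2
      have h2 : x ∈ closure ((Subtype.val : H → G) ⁻¹' A) := by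
        rw [closure_subtype]
        have h3 : Subtype.val '' (Subtype.val ⁻¹' (A : Set G) : Set H) = (H : Set G) ∩ A :=
          Subtype.image_preimage_coe _ _
        exact h3 ▸ h1
      refine map_mem_closure QuotientGroup.continuous_mk h2 fun y hy => ?_
      exact ⟨⟨⟨y, hy⟩, y.2⟩, rfl⟩
  have htop : (ψ.range : Set Q) = Set.univ := by
    rw [← hdense.closure_eq]
    exact ((Set.toFinite (ψ.range : Set Q)).isClosed.closure_eq).symm
  have hQfin : Finite Q := Set.finite_univ_iff.1 (htop ▸ Set.toFinite (ψ.range : Set Q))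
  have hNfin : N.FiniteIndex := Subgroup.finiteIndex_of_finite_quotient
  have hNo : IsOpen (N : Set H) := Subgroup.isOpen_of_isClosed_of_finiteIndex N hQT2
  have h1 : IsOpen ((Subtype.val : H → G) '' N) := hH.isOpenMap_subtype_val _ hNo
  refine Subgroup.isOpen_mono (H₁ := N.map H.subtype) ?_ h1
  rintro _ ⟨x, hx, rfl⟩
  exact hx

theorem isOpen_zassenhaus [CompactSpace G] [T2Space G] {ι : Type*} [Finite ι] {g : ι → G}
    (hg : Dense (Subgroup.closure (Set.range g) : Set G)) (m : ℕ) :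
    IsOpen (zassenhaus p G m : Set G) := by
  induction m with
  | zero => simp [zassenhaus]
  | succ m ih =>
    rcases Nat.eq_zero_or_pos m with rfl | hm
    · simp [zassenhaus]
    · exact isOpen_of_pow_comm_mem p hg ih (isClosed_zassenhaus p _)
        (fun x hx => pow_mem_zassenhaus_succ p hm hx)
        (fun a ha b _ => comm_mem_zassenhaus p hm le_rfl ha (by simp [zassenhaus]))

/-- The Zassenhaus filtration of a finite `p`-group reaches the trivial subgroup. -/
theorem exists_zassenhaus_eq_bot {Γ : Type*} [Group Γ] [TopologicalSpace Γ] [DiscreteTopology Γ]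
    [Finite Γ] (hΓ : IsPGroup p Γ) : ∃ m, 2 ≤ m ∧ zassenhaus p Γ m = ⊥ := by
  obtain ⟨N, hN⟩ : ∃ N, Nat.card Γ = N := ⟨_, rfl⟩
  induction N using Nat.strong_induction_on generalizing Γ with
  | _ N ih =>
    rcases subsingleton_or_nontrivial Γ with h | h
    · exact ⟨2, le_rfl, Subsingleton.elim _ _⟩
    have hZ := hΓ.center_nontrivial
    have hZp : IsPGroup p (Subgroup.center Γ) := hΓ.to_subgroup _
    obtain ⟨n, hn0, hn⟩ := (IsPGroup.nontrivial_iff_card hZp).1 hZ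
    obtain ⟨c, hc⟩ := exists_prime_orderOf_dvd_card' (G := Subgroup.center Γ) p
      (hn ▸ dvd_pow_self p hn0.ne')
    let C := Subgroup.zpowers (c : Γ)
    have hcen : ∀ x ∈ C, ∀ g, g * x = x * g := by
      intro x hx g
      have : C ≤ Subgroup.center Γ := (Subgroup.zpowers_le).2 c.2
      exact Subgroup.mem_center_iff.1 (this hx) g
    have hpC : ∀ x ∈ C, x ^ p = 1 := by
      rintro _ ⟨k, rfl⟩
      have h1 : (c : Γ) ^ p = 1 := by
        have := pow_orderOf_eq_one c
        rw [hc] at this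
        exact_mod_cast congrArg Subtype.val this
      change ((c : Γ) ^ k) ^ p = 1
      rw [← zpow_natCast, zpow_comm, zpow_natCast, h1, one_zpow]
    have hCn : C.Normal := ⟨fun x hx g => by rwa [hcen x hx g, mul_inv_cancel_right]⟩
    have hd : DiscreteTopology (Γ ⧸ C) := QuotientGroup.discreteTopology (isOpen_discrete _)
    have hcard : Nat.card (Γ ⧸ C) < N := by
      have h1 := Subgroup.card_eq_card_quotient_mul_card_subgroup C
      have h2 : 1 < Nat.card C := by
        rw [Nat.card_zpowers, Subgroup.orderOf_coe, hc]
        exact hp.out.one_lt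
      rw [← hN, h1]
      exact lt_mul_of_one_lt_right Nat.card_pos h2
    obtain ⟨m, hm2, hm⟩ := ih _ hcard (hΓ.to_quotient C) rfl
    have hle : ∀ i, m ≤ i → zassenhaus p Γ i ≤ C := by
      intro i hi x hx
      have h1 := map_mem_zassenhaus p (QuotientGroup.mk' C) continuous_of_discreteTopology i x hx
      have h2 := zassenhaus_antitone p hi h1
      rw [hm, Subgroup.mem_bot] at h2
      exact (QuotientGroup.eq_one_iff x).1 h2
    -- in degree `i + j = p * m + m`, both `⌈(p * m + m) / p⌉` and one of `i`, `j` are at least `m`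
    refine ⟨p * m + m, by nlinarith, ?_⟩
    rw [eq_bot_iff]
    have hp1 := hp.out.two_le
    refine zassenhaus_le p (by nlinarith) (isClosed_discrete _) (fun x hx => ?_)
      (fun i j hi hj h a ha b hb => ?_)
    · refine hpC x (hle _ ?_ hx)
      rw [Nat.ceilDiv_eq_add_pred_div, Nat.le_div_iff_mul_le hp.out.pos]
      rw [mul_comm m p]
      omega
    · rw [Subgroup.mem_bot]
      have : m ≤ i ∨ m ≤ j := by
        by_contra hcon
        push Not at hcon
        nlinarith
      rcases this with h' | h'
      · rw [← hcen a (hle i h' ha) b]; group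
      · rw [hcen b (hle j h' hb) a]; group

end zassenhaus

/-! ### Topologically finitely generated `σ`-pro-`p`-groups -/

theorem sigma_mk {G : Type*} [Group G] [TopologicalSpace G] [SigmaGroup G] (N : Subgroup G)
    [N.Normal] [IsSigmaInvariant N] (x : G) :
    sigma (QuotientGroup.mk x : G ⧸ N) = QuotientGroup.mk (sigma x) := rfl

/-- A continuous homomorphism that maps the free generators to odd elements is equivariant. -/
theorem FreeProP.hom_sigma {p n : ℕ} [Fact p.Prime] {G : Type*} [Group G] [TopologicalSpace G]
    [SigmaGroup G] [T2Space G] {φ : FreeProP p n →* G} (hφ : Continuous φ)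
    (h : ∀ i, sigma (φ (FreeProP.gen i)) = (φ (FreeProP.gen i))⁻¹) (x : FreeProP p n) :
    φ (sigma x) = sigma (φ x) := by
  have := FreeProP.hom_ext (φ := φ.comp sigma) (ψ := sigma.comp φ)
    (hφ.comp SigmaGroup.continuous_sigma) (SigmaGroup.continuous_sigma.comp hφ) (fun i => by
      simp [FreeProP.sigma_gen, h])
  exact DFunLike.congr_fun this x

/-- If a normal subgroup is generated by odd elements, then its invariant homomorphisms are odd. -/
theorem oddInvHoms_of_normalClosure {p : ℕ} [Fact p.Prime] {E : Type*} [Group E] [Finite E]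
    (hE : IsPGroup p E) {σ : E →* E} (M : Subgroup E) [M.Normal] (hσ : ∀ x ∈ M, σ x ∈ M)
    {ι : Type*} (r : ι → M) (hr : ∀ i, σ (r i) = (r i : E)⁻¹)
    (hM : Subgroup.normalClosure (Set.range fun i => (r i : E)) = M) : OddInvHoms p σ M := by
  intro f hf a b hab
  let f' : invHoms p M := ⟨fun a => f ⟨σ a, hσ a a.2⟩,
    fun a b => (congrArg f (Subtype.ext (map_mul σ a.1 b.1))).trans
      (hf.1 ⟨σ a, hσ a a.2⟩ ⟨σ b, hσ b b.2⟩),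
    fun g a b hab => hf.2 (σ g) _ _ (by simp [hab])⟩
  have h := (normalClosure_eq_iff_invHoms hE r).1 hM (f' + ⟨f, hf⟩ : invHoms p M).1
    (f' + ⟨f, hf⟩ : invHoms p M).2 (fun i => by
      have h1 : (⟨σ (r i : E), hσ _ (r i).2⟩ : M) = (r i)⁻¹ := Subtype.ext (hr i)
      have h2 := invHoms.apply_inv (⟨f, hf⟩ : invHoms p M) (r i)
      change f ⟨σ (r i : E), _⟩ + f (r i) = 0
      rw [h1, show f (r i)⁻¹ = - f (r i) from h2, neg_add_cancel])
  have h1 : f ⟨σ a, hσ a a.2⟩ + f a = 0 := congrFun h a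
  rw [show b = ⟨σ a, hσ a a.2⟩ from Subtype.ext hab]
  exact eq_neg_of_add_eq_zero_left h1

namespace SigmaEpi

variable {p n : ℕ} {G : Type*} [Group G] [TopologicalSpace G] [SigmaGroup G]

/-- The composite of a surjection from `F_n` with the projection to a factor group. -/
def quotient (π : SigmaEpi p n G) (L : Subgroup G) [L.Normal] [IsSigmaInvariant L] :
    SigmaEpi p n (G ⧸ L) where
  toHom := (QuotientGroup.mk' L).comp π.toHom
  continuous_toHom := QuotientGroup.continuous_mk.comp π.continuous_toHom
  surjective := (QuotientGroup.mk'_surjective L).comp π.surjective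
  map_sigma x := by
    change (QuotientGroup.mk (π.toHom (sigma x)) : G ⧸ L) = _
    rw [π.map_sigma]; rfl

/-- The identity of `F_n`. -/
def refl (p n : ℕ) : SigmaEpi p n (FreeProP p n) where
  toHom := MonoidHom.id _
  continuous_toHom := continuous_id
  surjective := Function.surjective_id
  map_sigma _ := rfl

/-- The composite of a surjection from `F_n` with an isomorphism. -/
def trans {H : Type*} [Group H] [TopologicalSpace H] [SigmaGroup H] (π : SigmaEpi p n G)
    (e : G ≃ₜ* H) (he : ∀ x, e (sigma x) = sigma (e x)) : SigmaEpi p n H where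
  toHom := (e : G →* H).comp π.toHom
  continuous_toHom := e.continuous.comp π.continuous_toHom
  surjective := e.surjective.comp π.surjective
  map_sigma x := by
    change e (π.toHom (sigma x)) = _
    rw [π.map_sigma, he]; rfl

theorem sigma_toHom_gen (π : SigmaEpi p n G) (i : Fin n) :
    sigma (π.toHom (FreeProP.gen i)) = (π.toHom (FreeProP.gen i))⁻¹ := by
  rw [← π.map_sigma, FreeProP.sigma_gen, map_inv]

variable [Fact p.Prime]

theorem compactSpace (π : SigmaEpi p n G) : CompactSpace G :=
  π.surjective.compactSpace π.continuous_toHom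

theorem dense_closure (π : SigmaEpi p n G) :
    Dense (Subgroup.closure (Set.range fun i => π.toHom (FreeProP.gen i)) : Set G) := by
  have h := π.surjective.denseRange.dense_image π.continuous_toHom
    (FreeProP.dense_closure_gen (p := p) (n := n))
  rw [← Subgroup.coe_map, MonoidHom.map_closure, ← Set.range_comp] at h
  exact h

theorem closure_eq_top [DiscreteTopology G] (π : SigmaEpi p n G) :
    Subgroup.closure (Set.range fun i => π.toHom (FreeProP.gen i)) = ⊤ := by
  have h := π.dense_closure.closure_eq
  rw [closure_discrete] at h
  exact SetLike.coe_injective h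

theorem pow_mem_of_nhds (π : SigmaEpi p n G) {U : Set G} (hU : U ∈ 𝓝 1) (a : G) :
    ∃ j, a ^ p ^ j ∈ U := by
  obtain ⟨x, rfl⟩ := π.surjective a
  obtain ⟨j, hj⟩ := FreeProP.pow_mem_of_nhds
    (π.continuous_toHom.continuousAt.preimage_mem_nhds (by rwa [map_one])) x
  exact ⟨j, by simpa using hj⟩

theorem isPGroup_quotient (π : SigmaEpi p n G) {L : Subgroup G} [L.Normal]
    (hL : IsOpen (L : Set G)) : IsPGroup p (G ⧸ L) := by
  intro x
  induction x using QuotientGroup.induction_on with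
  | H x =>
    obtain ⟨j, hj⟩ := π.pow_mem_of_nhds (hL.mem_nhds (one_mem L)) x
    exact ⟨j, by rw [← QuotientGroup.mk_pow, QuotientGroup.eq_one_iff]; exact hj⟩

theorem isPGroup [DiscreteTopology G] (π : SigmaEpi p n G) : IsPGroup p G := by
  intro x
  obtain ⟨j, hj⟩ := π.pow_mem_of_nhds ((isOpen_discrete {1}).mem_nhds rfl) x
  exact ⟨j, hj⟩

theorem finite [DiscreteTopology G] (π : SigmaEpi p n G) : Finite G :=
  have := π.compactSpace
  finite_of_compact_of_discrete

variable [IsTopologicalGroup G] [T2Space G]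

omit [IsTopologicalGroup G] in
theorem isOpenMap (π : SigmaEpi p n G) : IsOpenMap π.toHom := by
  have h : IsQuotientMap π.toHom :=
    π.continuous_toHom.isClosedMap.isQuotientMap π.continuous_toHom π.surjective
  exact (MonoidHom.isOpenQuotientMap_of_isQuotientMap h).isOpenMap

omit [IsTopologicalGroup G] in
theorem exists_open_normal (π : SigmaEpi p n G) {U : Set G} (hU : U ∈ 𝓝 1) :
    ∃ N : Subgroup G, N.Normal ∧ IsOpen (N : Set G) ∧ (N : Set G) ⊆ U := by
  obtain ⟨N, hN⟩ := FreeProP.exists_ker_proj_le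
    (π.continuous_toHom.continuousAt.preimage_mem_nhds (by rwa [map_one]))
  refine ⟨(FreeProP.proj N).ker.map π.toHom, Subgroup.Normal.map inferInstance _ π.surjective,
    π.isOpenMap _ (FreeProP.isOpen_ker_proj N), ?_⟩
  rintro _ ⟨x, hx, rfl⟩
  exact hN hx

/-- Every odd element of a compact `σ`-pro-`p`-group, `p ≠ 2`, is the square of an odd element:
the set of these squares is closed, and it contains all `a ^ (p ^ j + 1)`. -/
theorem exists_odd_sq (hp : p ≠ 2) (π : SigmaEpi p n G) {a : G} (ha : sigma a = a⁻¹) :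
    ∃ b : G, sigma b = b⁻¹ ∧ b ^ 2 = a := by
  have := π.compactSpace
  let S : Set G := {b | sigma b = b⁻¹}
  have hS : IsClosed S := isClosed_eq SigmaGroup.continuous_sigma continuous_inv
  have hS2 : IsClosed ((fun b : G => b ^ 2) '' S) :=
    (hS.isCompact.image (continuous_pow 2)).isClosed
  have hmem : a ∈ closure ((fun b : G => b ^ 2) '' S) := by
    rw [mem_closure_iff_nhds]
    intro U hU
    obtain ⟨j, hj⟩ := π.pow_mem_of_nhds (U := (fun x => x * a) ⁻¹' U)
      ((continuous_mul_const a).continuousAt.preimage_mem_nhds (by rwa [one_mul])) a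
    obtain ⟨t, ht⟩ := ((Fact.out : p.Prime).odd_of_ne_two hp).pow (n := j)
    refine ⟨a ^ p ^ j * a, hj, a ^ (t + 1), ?_, ?_⟩
    · change sigma (a ^ (t + 1)) = _
      rw [map_pow, ha, inv_pow]
    · change (a ^ (t + 1)) ^ 2 = _
      rw [← pow_mul, ← pow_succ, ht]
      congr 1; ring
  rw [hS2.closure_eq] at hmem
  obtain ⟨b, hb, h⟩ := hmem
  exact ⟨b, hb, h⟩

/-- Odd elements lift to odd elements: write `a = b²` with `b` odd and apply `x ↦ σ(x)⁻¹ x` to a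
lift of `b`. -/
theorem exists_odd_lift (hp : p ≠ 2) (π : SigmaEpi p n G) {a : G} (ha : sigma a = a⁻¹) :
    ∃ b : FreeProP p n, sigma b = b⁻¹ ∧ π.toHom b = a := by
  obtain ⟨c, hc, rfl⟩ := π.exists_odd_sq hp ha
  obtain ⟨x, rfl⟩ := π.surjective c
  exact ⟨oddDiff sigma x, sigma_oddDiff SigmaGroup.sigma_sigma x, by
    rw [map_oddDiff π.toHom π.map_sigma, oddDiff_eq_sq hc]⟩

/-- Elements that generate `G` modulo a subgroup of the Frattini subgroup generate `G`
topologically. -/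
theorem dense_closure_of_quotient (π : SigmaEpi p n G) {L : Subgroup G} [L.Normal]
    (hL : L ≤ openFrattini G) {ι : Type*} (y : ι → G)
    (hy : Subgroup.closure (Set.range fun i => (QuotientGroup.mk (y i) : G ⧸ L)) = ⊤) :
    Dense (Subgroup.closure (Set.range y) : Set G) := by
  have := π.compactSpace
  intro x
  by_contra hx
  obtain ⟨N, hN, hNo, hNU⟩ := π.exists_open_normal
    (U := (fun z => x * z) ⁻¹' (closure (Subgroup.closure (Set.range y) : Set G))ᶜ)
    ((continuous_const_mul x).continuousAt.preimage_mem_nhds (by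
      rw [mul_one]; exact isClosed_closure.isOpen_compl.mem_nhds hx))
  have hfin : Finite (G ⧸ N) := N.quotient_finite_of_isOpen hNo
  let B := (Subgroup.closure (Set.range y)).map (QuotientGroup.mk' N)
  have hB : B ≠ ⊤ := by
    intro h
    have hx1 : (QuotientGroup.mk x : G ⧸ N) ∈ B := by rw [h]; trivial
    obtain ⟨z, hz, hzx⟩ := hx1
    have h1 : x⁻¹ * z ∈ N := by
      rw [← QuotientGroup.eq]; exact hzx.symm
    have h2 := hNU h1
    simp only [Set.mem_preimage, mul_inv_cancel_left] at h2
    exact h2 (subset_closure hz)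
  obtain ⟨M, hM, hBM⟩ := (eq_top_or_exists_le_coatom B).resolve_left hB
  have hMc : IsCoatom (M.comap (QuotientGroup.mk' N)) :=
    Subgroup.isCoatom_comap_of_surjective (QuotientGroup.mk'_surjective N) hM
  have hMo : IsOpen (M.comap (QuotientGroup.mk' N) : Set G) :=
    Subgroup.isOpen_mono (H₁ := N) (fun z hz => by
      rw [Subgroup.mem_comap, QuotientGroup.mk'_apply, (QuotientGroup.eq_one_iff z).2 hz]
      exact one_mem M) hNo
  have hLM : L ≤ M.comap (QuotientGroup.mk' N) := hL.trans (sInf_le ⟨hMo, hMc⟩)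
  refine hMc.1 (top_le_iff.1 fun z _ => ?_)
  have hyM : Subgroup.closure (Set.range fun i => (QuotientGroup.mk (y i) : G ⧸ L)) ≤
      (M.comap (QuotientGroup.mk' N)).map (QuotientGroup.mk' L) := by
    rw [Subgroup.closure_le]
    rintro _ ⟨i, rfl⟩
    exact ⟨y i, hBM ⟨y i, Subgroup.subset_closure ⟨i, rfl⟩, rfl⟩, rfl⟩
  rw [hy] at hyM
  obtain ⟨w, hw, hwz⟩ := hyM (Subgroup.mem_top (QuotientGroup.mk z : G ⧸ L))
  have h1 : w⁻¹ * z ∈ L := by rw [← QuotientGroup.eq]; exact hwz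
  have h2 := mul_mem hw (hLM h1)
  rwa [mul_inv_cancel_left] at h2

/-- The minimal number of generators in terms of a finite quotient by a subgroup of the Frattini
subgroup. -/
theorem exists_dense_iff (π : SigmaEpi p n G) {L : Subgroup G} [L.Normal]
    (hLo : IsOpen (L : Set G)) (hL : L ≤ openFrattini G) (d : ℕ) :
    (∃ x : Fin d → G, Dense (Subgroup.closure (Set.range x) : Set G)) ↔
      Module.finrank (ZMod p) (invHoms p (⊤ : Subgroup (G ⧸ L))) ≤ d := by
  have := π.compactSpace
  have hfin : Finite (G ⧸ L) := L.quotient_finite_of_isOpen hLo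
  have hd : DiscreteTopology (G ⧸ L) := QuotientGroup.discreteTopology hLo
  rw [← exists_closure_eq_top_iff_finrank_le (π.isPGroup_quotient hLo)]
  constructor
  · rintro ⟨x, hx⟩
    refine ⟨fun i => QuotientGroup.mk (x i), ?_⟩
    have h := (QuotientGroup.mk'_surjective L).denseRange.dense_image
      QuotientGroup.continuous_mk hx
    rw [← Subgroup.coe_map, MonoidHom.map_closure, ← Set.range_comp] at h
    have h1 := h.closure_eq
    rw [closure_discrete] at h1
    exact SetLike.coe_injective h1
  · rintro ⟨x, hx⟩
    choose y hy using fun i => QuotientGroup.mk_surjective (x i)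
    exact ⟨y, π.dense_closure_of_quotient hL y (by simpa only [hy] using hx)⟩

theorem minGenerators_eq_finrank (π : SigmaEpi p n G) {L : Subgroup G} [L.Normal]
    (hLo : IsOpen (L : Set G)) (hL : L ≤ openFrattini G) :
    minGenerators G = Module.finrank (ZMod p) (invHoms p (⊤ : Subgroup (G ⧸ L))) := by
  simp only [minGenerators, π.exists_dense_iff hLo hL]
  exact csInf_Ici

/-- A maximal open subgroup is the kernel of a homomorphism to `ZMod p`, and such a homomorphism
vanishes on `p`-th powers and commutators. -/
theorem zassenhaus_le_openFrattini (π : SigmaEpi p n G) {i : ℕ} (hi : 2 ≤ i) :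
    zassenhaus p G i ≤ openFrattini G := by
  have := π.compactSpace
  refine (zassenhaus_antitone p hi).trans (le_sInf ?_)
  rintro M ⟨hMo, hM⟩
  obtain ⟨N, hN, hNo, hNM⟩ := π.exists_open_normal (hMo.mem_nhds (one_mem M))
  have hfin : Finite (G ⧸ N) := N.quotient_finite_of_isOpen hNo
  have hpG := π.isPGroup_quotient hNo
  have hnil : Group.IsNilpotent (G ⧸ N) := hpG.isNilpotent
  let M' := M.map (QuotientGroup.mk' N)
  have hcomap : M'.comap (QuotientGroup.mk' N) = M := by
    rw [Subgroup.comap_map_eq_self]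
    rw [QuotientGroup.ker_mk']; exact hNM
  have hM' : IsCoatom M' := by
    refine ⟨fun h => hM.1 ?_, fun B hB => ?_⟩
    · rw [← hcomap, h, Subgroup.comap_top]
    · have h1 : M < B.comap (QuotientGroup.mk' N) := by
        rw [← hcomap]
        exact (Subgroup.comap_lt_comap_of_surjective (QuotientGroup.mk'_surjective N)).2 hB
      exact Subgroup.comap_injective (QuotientGroup.mk'_surjective N) (by
        rw [hM.2 _ h1, Subgroup.comap_top])
  have hMn : M'.Normal := Subgroup.NormalizerCondition.normal_of_coatom M'
    Group.normalizerCondition_of_isNilpotent hM'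
  obtain ⟨f, hf, hf0, hfM⟩ := exists_invHom_ne_zero (M := ⊤) hpG M' hM'.lt_top
  -- the kernel of `f` is `M'`, because `M'` is maximal
  have hker : ∀ x : G, f ⟨QuotientGroup.mk x, trivial⟩ = 0 → x ∈ M := by
    intro x hx
    have h1 : M' ≤ invHoms.ker (⟨f, hf⟩ : invHoms p (⊤ : Subgroup (G ⧸ N))) := fun y hy =>
      (invHoms.mem_ker _ _).2 ⟨trivial, hfM ⟨y, trivial⟩ hy⟩
    have h2 : M' = invHoms.ker (⟨f, hf⟩ : invHoms p (⊤ : Subgroup (G ⧸ N))) := by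
      by_contra hne
      have h3 := hM'.2 _ (lt_of_le_of_ne h1 hne)
      refine hf0 (funext fun y => ?_)
      obtain ⟨_, h4⟩ := (invHoms.mem_ker (⟨f, hf⟩ : invHoms p (⊤ : Subgroup (G ⧸ N))) y).1
        (by rw [h3]; trivial)
      exact h4
    have h3 : (QuotientGroup.mk x : G ⧸ N) ∈ M' := by
      rw [h2]; exact (invHoms.mem_ker _ _).2 ⟨trivial, hx⟩
    rw [← hcomap]
    exact h3
  let F : G →* Multiplicative (ZMod p) :=
    (invHoms.toHom (⟨f, hf⟩ : invHoms p (⊤ : Subgroup (G ⧸ N)))).comp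
      ((QuotientGroup.mk' N).codRestrict ⊤ fun _ => trivial)
  have hF : ∀ x, F x = 1 → x ∈ M := fun x hx => hker x hx
  refine zassenhaus_le p le_rfl (Subgroup.isClosed_of_isOpen M hMo) (fun x _ => hF _ ?_)
    (fun i j _ _ _ a _ b _ => hF _ ?_)
  · rw [map_pow]
    apply Multiplicative.toAdd.injective
    rw [toAdd_pow, nsmul_eq_mul, CharP.cast_eq_zero, zero_mul, toAdd_one]
  · simp only [map_mul, map_inv]
    rw [mul_comm (F a), mul_inv_cancel_right, mul_inv_cancel]

theorem isOpen_zassenhaus (π : SigmaEpi p n G) (i : ℕ) : IsOpen (zassenhaus p G i : Set G) :=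
  have := π.compactSpace
  _root_.isOpen_zassenhaus p π.dense_closure i

omit [IsTopologicalGroup G] [T2Space G] in
theorem minGenerators_le (π : SigmaEpi p n G) : minGenerators G ≤ n :=
  Nat.sInf_le ⟨_, π.dense_closure⟩

end SigmaEpi

namespace SigmaEpi

variable {p n : ℕ} [Fact p.Prime] {G : Type*} [Group G] [TopologicalSpace G] [SigmaGroup G]
  [IsTopologicalGroup G] [T2Space G]

omit [Fact p.Prime] in
theorem pullback_top_injective {E A : Type*} [Group E] [Finite E] [Group A] {f : E →* A}
    (hf : Function.Surjective f) :
    Function.Injective (invHoms.pullback (p := p) (⊤ : Subgroup A) f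
      (le_top : (⊤ : Subgroup E) ≤ (⊤ : Subgroup A).comap f)) := by
  intro a b h
  apply Subtype.ext
  funext ⟨x, _⟩
  obtain ⟨y, rfl⟩ := hf x
  exact congrFun (congrArg Subtype.val h) ⟨y, trivial⟩

/-- If `d_G = n`, then the minimal number of generators of `F_n` is `n`. -/
theorem minGenerators_freeProP (π : SigmaEpi p n G) (hG : minGenerators G = n) :
    minGenerators (FreeProP p n) = n := by
  have := π.compactSpace
  refine le_antisymm (refl p n).minGenerators_le ?_
  have hGo := π.isOpen_zassenhaus 2
  have hFo := (refl p n).isOpen_zassenhaus 2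
  have := (zassenhaus p (FreeProP p n) 2).quotient_finite_of_isOpen hFo
  rw [(refl p n).minGenerators_eq_finrank hFo ((refl p n).zassenhaus_le_openFrattini le_rfl)]
  conv_lhs => rw [← hG, π.minGenerators_eq_finrank hGo (π.zassenhaus_le_openFrattini le_rfl)]
  let f : FreeProP p n ⧸ zassenhaus p (FreeProP p n) 2 →* G ⧸ zassenhaus p G 2 :=
    QuotientGroup.map _ _ π.toHom (map_mem_zassenhaus p π.toHom π.continuous_toHom 2)
  have hf : Function.Surjective f := by
    intro x
    obtain ⟨y, rfl⟩ := QuotientGroup.mk_surjective x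
    obtain ⟨z, rfl⟩ := π.surjective y
    exact ⟨QuotientGroup.mk z, rfl⟩
  exact LinearMap.finrank_le_finrank_of_injective (pullback_top_injective hf)

/-- Two surjections `F_n → G` with `d_G = n` differ by a surjective endomorphism of `F_n`: lift the
images of the generators to odd elements. The lifts generate `F_n` because all homomorphisms
`F_n → ZMod p` factor through `G`. -/
theorem exists_comp_eq (hp : p ≠ 2) (π₁ π₂ : SigmaEpi p n G) (hG : minGenerators G = n) :
    ∃ ψ : SigmaEpi p n (FreeProP p n), ∀ x, π₁.toHom (ψ.toHom x) = π₂.toHom x := by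
  have := π₁.compactSpace
  choose y hy hyπ using fun i => π₁.exists_odd_lift hp (π₂.sigma_toHom_gen i)
  obtain ⟨φ, hφ, hφg⟩ := FreeProP.exists_lift y
  have hcomp : ∀ x, π₁.toHom (φ x) = π₂.toHom x := fun x =>
    DFunLike.congr_fun (FreeProP.hom_ext (φ := π₁.toHom.comp φ) (ψ := π₂.toHom)
      (π₁.continuous_toHom.comp hφ) π₂.continuous_toHom fun i => by simp [hφg, hyπ]) x
  have hsurj : Function.Surjective φ := by
    have hGo := π₁.isOpen_zassenhaus 2
    have hFo := (refl p n).isOpen_zassenhaus 2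
    have hFr := (refl p n).zassenhaus_le_openFrattini (i := 2) le_rfl
    let E := FreeProP p n ⧸ zassenhaus p (FreeProP p n) 2
    let Γ := G ⧸ zassenhaus p G 2
    have hE : Finite E := (zassenhaus p (FreeProP p n) 2).quotient_finite_of_isOpen hFo
    have hΓ : Finite Γ := (zassenhaus p G 2).quotient_finite_of_isOpen hGo
    have hΓd : DiscreteTopology Γ := QuotientGroup.discreteTopology hGo
    let f : E →* Γ :=
      QuotientGroup.map _ _ π₁.toHom (map_mem_zassenhaus p π₁.toHom π₁.continuous_toHom 2)
    have hf : Function.Surjective f := by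
      intro x
      obtain ⟨y, rfl⟩ := QuotientGroup.mk_surjective x
      obtain ⟨z, rfl⟩ := π₁.surjective y
      exact ⟨QuotientGroup.mk z, rfl⟩
    have hrank : Module.finrank (ZMod p) (invHoms p (⊤ : Subgroup Γ)) =
        Module.finrank (ZMod p) (invHoms p (⊤ : Subgroup E)) := by
      rw [← π₁.minGenerators_eq_finrank hGo (π₁.zassenhaus_le_openFrattini le_rfl),
        ← (refl p n).minGenerators_eq_finrank hFo hFr, hG, π₁.minGenerators_freeProP hG]
    have hinj := pullback_top_injective (p := p) hf
    have hsur := (LinearMap.injective_iff_surjective_of_finrank_eq_finrank hrank).1 hinj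
    have hgen : Subgroup.closure (Set.range fun i => (QuotientGroup.mk (y i) : E)) = ⊤ := by
      rw [closure_range_eq_top_iff_invHoms ((refl p n).isPGroup_quotient hFo)]
      intro g hg hgy
      obtain ⟨g', hg'⟩ := hsur ⟨g, hg⟩
      have h2 := (π₂.quotient (zassenhaus p G 2)).closure_eq_top
      rw [closure_range_eq_top_iff_invHoms (p := p) (π₁.isPGroup_quotient hGo)] at h2
      have h3 : g'.1 = 0 := h2 g'.1 g'.2 fun i => by
        have h4 := congrFun (congrArg Subtype.val hg') ⟨QuotientGroup.mk (y i), trivial⟩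
        have h5 := h4.trans (hgy i)
        rw [← h5]
        refine congrArg g'.1 (Subtype.ext ?_)
        exact congrArg QuotientGroup.mk (hyπ i).symm
      rw [show g' = 0 from Subtype.ext h3, map_zero] at hg'
      exact (congrArg Subtype.val hg').symm
    have hd := (refl p n).dense_closure_of_quotient hFr y hgen
    have hr : Subgroup.closure (Set.range y) ≤ φ.range := by
      rw [Subgroup.closure_le]
      rintro _ ⟨i, rfl⟩
      exact ⟨FreeProP.gen i, hφg i⟩
    have hcl : IsClosed (φ.range : Set (FreeProP p n)) := by
      rw [MonoidHom.coe_range]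
      exact (isCompact_range hφ).isClosed
    intro x
    have hx := closure_minimal hr hcl (hd x)
    exact hx
  exact ⟨⟨φ, hφ, hsurj, FreeProP.hom_sigma hφ fun i => by rw [hφg, hy]⟩, hcomp⟩

/-- Two surjections `F_n → G` with `d_G = n` differ by a `σ`-automorphism of `F_n`. -/
theorem exists_aut (hp : p ≠ 2) (π₁ π₂ : SigmaEpi p n G) (hG : minGenerators G = n) :
    ∃ α : SigmaAut (FreeProP p n), ∀ x, π₁.toHom (α.1 x) = π₂.toHom x := by
  obtain ⟨ψ, hψ⟩ := exists_comp_eq hp π₁ π₂ hG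
  obtain ⟨β, hβ⟩ := exists_comp_eq hp ψ (refl p n) (π₁.minGenerators_freeProP hG)
  have hinj : Function.Injective ψ.toHom := by
    rw [injective_iff_map_eq_one]
    intro x hx
    obtain ⟨w, rfl⟩ := β.surjective x
    have h1 : w = 1 := by
      rw [← hx, hβ]; rfl
    rw [h1, map_one]
  let e : FreeProP p n ≃* FreeProP p n := MulEquiv.ofBijective ψ.toHom ⟨hinj, ψ.surjective⟩
  have he : Continuous e.toEquiv := ψ.continuous_toHom
  refine ⟨⟨⟨e, he, (he.homeoOfEquivCompactToT2).symm.continuous⟩, ψ.map_sigma⟩, hψ⟩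

/-- A subgroup of `F_n` that is invariant under all `σ`-automorphisms has the same image under all
surjections `F_n → G` with `d_G = n`. -/
theorem image_eq (hp : p ≠ 2) (π₁ π₂ : SigmaEpi p n G) (hG : minGenerators G = n)
    {D : Subgroup (FreeProP p n)}
    (hD : ∀ α : SigmaAut (FreeProP p n), ∀ x ∈ D, α.1 x ∈ D) : π₁.image D = π₂.image D := by
  have h : ∀ π₁ π₂ : SigmaEpi p n G, π₂.image D ≤ π₁.image D := by
    intro π₁ π₂
    obtain ⟨α, hα⟩ := exists_aut hp π₁ π₂ hG
    rintro _ ⟨x, hx, rfl⟩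
    exact ⟨α.1 x, hD α x hx, hα x⟩
  exact le_antisymm (h π₂ π₁) (h π₁ π₂)

end SigmaEpi

/-! ### The Haar measure on the odd elements of the free pro-`p`-group -/

section haar

variable {p n : ℕ} [Fact p.Prime]

/-- The normalized Haar measure of the preimage of a set under the projection to a finite factor
group is the density of the set. -/
theorem haarMeasure_mk_preimage {N : Subgroup (FreeProP p n)} [N.Normal]
    (hN : IsOpen (N : Set (FreeProP p n))) (P : FreeProP p n ⧸ N → Prop) :
    (Measure.haarMeasure (⊤ : TopologicalSpace.PositiveCompacts (FreeProP p n)))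
      {x | P (QuotientGroup.mk x)} =
      (Nat.card {y // P y} : ℝ≥0∞) * (Nat.card (FreeProP p n ⧸ N) : ℝ≥0∞)⁻¹ := by
  set μ := Measure.haarMeasure (⊤ : TopologicalSpace.PositiveCompacts (FreeProP p n))
  have hfin : Finite (FreeProP p n ⧸ N) := N.quotient_finite_of_isOpen hN
  have hd : DiscreteTopology (FreeProP p n ⧸ N) := QuotientGroup.discreteTopology hN
  have hmeas : ∀ y : FreeProP p n ⧸ N, MeasurableSet {x : FreeProP p n | QuotientGroup.mk x = y} :=
    fun y => ((isOpen_discrete {y}).preimage QuotientGroup.continuous_mk).measurableSet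
  have hconst : ∀ y : FreeProP p n ⧸ N,
      μ {x | (QuotientGroup.mk x : FreeProP p n ⧸ N) = y} = μ N := by
    intro y
    obtain ⟨z, rfl⟩ := QuotientGroup.mk_surjective y
    rw [← measure_preimage_mul μ z]
    congr 1
    ext x
    simp
  have hsum : ∀ P : FreeProP p n ⧸ N → Prop,
      μ {x | P (QuotientGroup.mk x)} = (Nat.card {y // P y} : ℝ≥0∞) * μ N := by
    intro P
    have := Fintype.ofFinite {y // P y}
    have h1 : {x : FreeProP p n | P (QuotientGroup.mk x)} =
        ⋃ y : {y // P y}, {x : FreeProP p n | QuotientGroup.mk x = y.1} := by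
      ext x; simp
    rw [h1, measure_iUnion (fun y z hyz => Set.disjoint_left.2 fun x hx hx' =>
      hyz (Subtype.ext (hx.symm.trans hx'))) (fun y => hmeas y.1), tsum_fintype]
    simp [hconst, Nat.card_eq_fintype_card]
  have htop := hsum fun _ => True
  have huniv : μ Set.univ = 1 := by
    have := Measure.haarMeasure_self (K₀ := (⊤ : TopologicalSpace.PositiveCompacts (FreeProP p n)))
    simpa using this
  rw [Set.ext fun x => (iff_of_true trivial trivial :
      x ∈ {x : FreeProP p n | True} ↔ x ∈ Set.univ), huniv,
    Nat.card_congr (Equiv.subtypeUnivEquiv fun _ => trivial)] at htop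
  rw [hsum P, ← ENNReal.eq_inv_of_mul_eq_one_left (a := μ N)
    (b := (Nat.card (FreeProP p n ⧸ N) : ℝ≥0∞)) (by rw [mul_comm]; exact htop.symm)]

/-- The Haar measure on `F_n⁻` exists: it is the image of the Haar measure of `F_n` under
`x ↦ σ(x)⁻¹ x`. -/
theorem isOddHaar_oddHaar (hp : p ≠ 2) : IsOddHaar (oddHaar p n) := by
  have hex : ∃ μ : Measure (oddPart (FreeProP p n)), IsOddHaar μ := by
    let f : FreeProP p n → oddPart (FreeProP p n) := fun x =>
      ⟨oddDiff sigma x, sigma_oddDiff SigmaGroup.sigma_sigma x⟩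
    have hf : Continuous f := Continuous.subtype_mk
      ((SigmaGroup.continuous_sigma.inv).mul continuous_id) _
    refine ⟨(Measure.haarMeasure (⊤ : TopologicalSpace.PositiveCompacts (FreeProP p n))).map f,
      fun N _ _ hN a => ?_⟩
    have hfin : Finite (FreeProP p n ⧸ N) := N.quotient_finite_of_isOpen hN
    have hd : DiscreteTopology (FreeProP p n ⧸ N) := QuotientGroup.discreteTopology hN
    have hmeas : MeasurableSet {b : oddPart (FreeProP p n) |
        ((b : FreeProP p n) : FreeProP p n ⧸ N) = a} :=
      ((isOpen_discrete {a.1}).preimage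
        (QuotientGroup.continuous_mk.comp continuous_subtype_val)).measurableSet
    rw [Measure.map_apply hf.measurable hmeas]
    have h1 : f ⁻¹' {b : oddPart (FreeProP p n) | ((b : FreeProP p n) : FreeProP p n ⧸ N) = a} =
        {x | oddDiff sigma (QuotientGroup.mk x : FreeProP p n ⧸ N) = a} := rfl
    have hodd := odd_card_of_isPGroup hp (FreeProP.isPGroup_quotient hN)
    rw [h1, haarMeasure_mk_preimage hN (fun y => oddDiff sigma y = a.1),
      card_oddDiff_fiber hodd a.2, card_eq_card_odd_mul_card_even hodd SigmaGroup.sigma_sigma]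
    have hpos : (Nat.card {x : FreeProP p n ⧸ N // sigma x = x} : ℝ≥0∞) ≠ 0 := by
      have : Nonempty {x : FreeProP p n ⧸ N // sigma x = x} := ⟨⟨1, map_one _⟩⟩
      exact Nat.cast_ne_zero.2 Nat.card_pos.ne'
    rw [Nat.cast_mul, ENNReal.mul_inv (Or.inr (ENNReal.natCast_ne_top _)) (Or.inr hpos), mul_comm,
      mul_assoc, ENNReal.inv_mul_cancel hpos (ENNReal.natCast_ne_top _), mul_one]
    rfl
  rw [oddHaar, dif_pos hex]
  exact hex.choose_spec

theorem isProbabilityMeasure_oddHaar (hp : p ≠ 2) : IsProbabilityMeasure (oddHaar p n) := by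
  have hI : IsSigmaInvariant (⊤ : Subgroup (FreeProP p n)) := ⟨fun _ _ => trivial⟩
  have h := isOddHaar_oddHaar (n := n) hp ⊤ isOpen_univ ⟨1, by simp [oddPart]⟩
  have hs : Subsingleton (FreeProP p n ⧸ (⊤ : Subgroup (FreeProP p n))) :=
    QuotientGroup.subsingleton_quotient_top
  have hc : Nat.card (oddPart (FreeProP p n ⧸ (⊤ : Subgroup (FreeProP p n)))) = 1 := by
    have : Nonempty (oddPart (FreeProP p n ⧸ (⊤ : Subgroup (FreeProP p n)))) :=
      ⟨⟨1, by simp [oddPart]⟩⟩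
    exact Nat.card_unique
  rw [hc] at h
  refine ⟨?_⟩
  have h1 : {b : oddPart (FreeProP p n) |
      ((b : FreeProP p n) : FreeProP p n ⧸ (⊤ : Subgroup (FreeProP p n))) = 1} = Set.univ :=
    Set.eq_univ_of_forall fun b => Subsingleton.elim _ _
  rw [← h1, h]
  simp

/-- The probability of a condition on a random tuple of odd elements that depends only on the
residue classes modulo an open subgroup. -/
theorem pi_oddHaar_apply (hp : p ≠ 2) {N : Subgroup (FreeProP p n)} [N.Normal]
    [IsSigmaInvariant N] (hN : IsOpen (N : Set (FreeProP p n))) (k : ℕ)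
    (P : (Fin k → FreeProP p n ⧸ N) → Prop) :
    (Measure.pi fun _ : Fin k => oddHaar p n)
      {r | P fun i => ((r i : FreeProP p n) : FreeProP p n ⧸ N)} =
      ENNReal.ofReal ((Nat.card {A : Fin k → FreeProP p n ⧸ N //
        (∀ i, sigma (A i) = (A i)⁻¹) ∧ P A} : ℝ) /
        (Nat.card {a : FreeProP p n ⧸ N // sigma a = a⁻¹} : ℝ) ^ k) := by
  have := isProbabilityMeasure_oddHaar (n := n) hp
  have hfin : Finite (FreeProP p n ⧸ N) := N.quotient_finite_of_isOpen hN
  have hd : DiscreteTopology (FreeProP p n ⧸ N) := QuotientGroup.discreteTopology hN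
  let T := {A : Fin k → FreeProP p n ⧸ N // (∀ i, sigma (A i) = (A i)⁻¹) ∧ P A}
  have := Fintype.ofFinite T
  have hset : {r : Fin k → oddPart (FreeProP p n) |
      P fun i => ((r i : FreeProP p n) : FreeProP p n ⧸ N)} =
      ⋃ A : T, Set.pi Set.univ fun i => {b : oddPart (FreeProP p n) |
        ((b : FreeProP p n) : FreeProP p n ⧸ N) = A.1 i} := by
    ext r
    simp only [Set.mem_ofPred_eq, Set.mem_iUnion, Set.mem_pi, Set.mem_univ, true_implies]
    constructor
    · intro h
      refine ⟨⟨_, fun i => ?_, h⟩, fun i => rfl⟩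
      rw [sigma_mk, show sigma (r i : FreeProP p n) = (r i : FreeProP p n)⁻¹ from (r i).2]
      rfl
    · rintro ⟨A, hA⟩
      simp only [hA]
      exact A.2.2
  have hmeas : ∀ a : FreeProP p n ⧸ N, MeasurableSet {b : oddPart (FreeProP p n) |
        ((b : FreeProP p n) : FreeProP p n ⧸ N) = a} := fun a =>
      ((isOpen_discrete {a}).preimage
        (QuotientGroup.continuous_mk.comp continuous_subtype_val)).measurableSet
  have hpos : 0 < (Nat.card {a : FreeProP p n ⧸ N // sigma a = a⁻¹} : ℝ) := by
    have : Nonempty {a : FreeProP p n ⧸ N // sigma a = a⁻¹} := ⟨⟨1, by simp⟩⟩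
    exact Nat.cast_pos.2 Nat.card_pos
  rw [hset, measure_iUnion (fun A B hAB => Set.disjoint_left.2 fun r hr hr' => hAB
      (Subtype.ext (funext fun i => (hr i trivial).symm.trans (hr' i trivial))))
    (fun A => MeasurableSet.univ_pi fun i => hmeas _), tsum_fintype]
  have hA : ∀ A : T, (Measure.pi fun _ : Fin k => oddHaar p n)
      (Set.pi Set.univ fun i => {b : oddPart (FreeProP p n) |
        ((b : FreeProP p n) : FreeProP p n ⧸ N) = A.1 i}) =
      ENNReal.ofReal (((Nat.card {a : FreeProP p n ⧸ N // sigma a = a⁻¹} : ℝ) ^ k)⁻¹) := by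
    intro A
    rw [Measure.pi_pi]
    rw [Finset.prod_congr rfl fun i _ => isOddHaar_oddHaar hp N hN ⟨A.1 i, A.2.1 i⟩]
    rw [Finset.prod_const, Finset.card_univ, Fintype.card_fin, ENNReal.ofReal_inv_of_pos
      (pow_pos hpos k), ENNReal.ofReal_pow hpos.le, ENNReal.ofReal_natCast, ENNReal.inv_pow]
    rfl
  rw [Finset.sum_congr rfl fun A _ => hA A, Finset.sum_const, Finset.card_univ,
    ← Nat.card_eq_fintype_card, nsmul_eq_mul, ← ENNReal.ofReal_natCast,
    ← ENNReal.ofReal_mul (Nat.cast_nonneg _)]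
  rfl

end haar

/-! ### Relation numbers of different presentations -/

section presentations

variable {p : ℕ} [Fact p.Prime] {i : ℕ}

/-- The finite factor group of `F_n` by a step of the Zassenhaus filtration. -/
abbrev ZQuotient (p : ℕ) [Fact p.Prime] (n i : ℕ) : Type :=
  FreeProP p n ⧸ zassenhaus p (FreeProP p n) i

/-- The images of the free generators. -/
noncomputable def ZQuotient.gen (p : ℕ) [Fact p.Prime] (i : ℕ) {n : ℕ} (j : Fin n) :
    ZQuotient p n i :=
  QuotientGroup.mk (FreeProP.gen j)

instance (n i : ℕ) : DiscreteTopology (ZQuotient p n i) :=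
  QuotientGroup.discreteTopology ((SigmaEpi.refl p n).isOpen_zassenhaus i)

instance (n i : ℕ) : Finite (ZQuotient p n i) :=
  (zassenhaus p (FreeProP p n) i).quotient_finite_of_isOpen
    ((SigmaEpi.refl p n).isOpen_zassenhaus i)

theorem ZQuotient.isPGroup (n i : ℕ) : IsPGroup p (ZQuotient p n i) :=
  FreeProP.isPGroup_quotient ((SigmaEpi.refl p n).isOpen_zassenhaus i)

theorem ZQuotient.closure_gen (n i : ℕ) :
    Subgroup.closure (Set.range (ZQuotient.gen p i : Fin n → ZQuotient p n i)) = ⊤ :=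
  ((SigmaEpi.refl p n).quotient (zassenhaus p (FreeProP p n) i)).closure_eq_top

theorem ZQuotient.sigma_gen {n : ℕ} (j : Fin n) :
    sigma (ZQuotient.gen p i j) = (ZQuotient.gen p i j)⁻¹ :=
  ((SigmaEpi.refl p n).quotient (zassenhaus p (FreeProP p n) i)).sigma_toHom_gen j

theorem zassenhaus_quotient_self {G : Type*} [Group G] [TopologicalSpace G] [IsTopologicalGroup G]
    [CompactSpace G] (i : ℕ) [T2Space (G ⧸ zassenhaus p G i)] :
    zassenhaus p (G ⧸ zassenhaus p G i) i = ⊥ := by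
  rw [← map_zassenhaus_of_surjective p (QuotientGroup.mk' (zassenhaus p G i))
    QuotientGroup.continuous_mk (QuotientGroup.mk'_surjective _) i]
  exact QuotientGroup.map_mk'_self _

/-- The universal property of `F_n / D_i(F_n)`. -/
theorem ZQuotient.exists_lift {n : ℕ} {Q : Type*} [Group Q] [TopologicalSpace Q]
    [DiscreteTopology Q] [Finite Q] (hQ : IsPGroup p Q) (hQi : zassenhaus p Q i = ⊥)
    (g : Fin n → Q) : ∃ φ : ZQuotient p n i →* Q, ∀ j, φ (ZQuotient.gen p i j) = g j := by
  obtain ⟨φ, hφ, hφg⟩ := FreeProP.exists_lift_finite hQ g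
  refine ⟨QuotientGroup.lift _ φ fun x hx => ?_, hφg⟩
  have := map_mem_zassenhaus p φ hφ i x hx
  rwa [hQi, Subgroup.mem_bot] at this

theorem ZQuotient.hom_ext {n : ℕ} {Q : Type*} [Group Q] {φ ψ : ZQuotient p n i →* Q}
    (h : ∀ j, φ (ZQuotient.gen p i j) = ψ (ZQuotient.gen p i j)) : φ = ψ :=
  MonoidHom.eq_of_eqOn_dense (ZQuotient.closure_gen n i) (by rintro _ ⟨j, rfl⟩; exact h j)

/-- Comparison of a presentation `φ` of `B` with a presentation `φ'` that has `l` additional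
generators. The generators of `F_N` are numbered by `Fin k ⊕ Fin l`. -/
theorem finrank_invHoms_ker_extend (hp : p ≠ 2) (hi : 2 ≤ i) {k l N : ℕ} (e : Fin k ⊕ Fin l ≃ Fin N)
    {B : Type*} [Group B] [TopologicalSpace B] [DiscreteTopology B] [SigmaGroup B] [Finite B]
    (hB : IsPGroup p B) (φ : ZQuotient p k i →* B) (hφσ : ∀ x, φ (sigma x) = sigma (φ x))
    (hφ : Function.Surjective φ) (φ' : ZQuotient p N i →* B)
    (hφ'σ : ∀ x, φ' (sigma x) = sigma (φ' x))
    (h : ∀ j, φ' (ZQuotient.gen p i (e (Sum.inl j))) = φ (ZQuotient.gen p i j)) :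
    Module.finrank (ZMod p) (invHoms p φ'.ker) = Module.finrank (ZMod p) (invHoms p φ.ker) + l ∧
      (OddInvHoms p sigma φ'.ker ↔ OddInvHoms p sigma φ.ker) := by
  have hZ : ∀ n, zassenhaus p (ZQuotient p n i) i = ⊥ := fun n => zassenhaus_quotient_self i
  -- The retraction `ρ` of `F_N / D_i` to `F_k / D_i` maps the additional generators to odd lifts
  -- `w j` of their images in `B`, and `z j` is the relation eliminating an additional generator.
  have hw : ∀ j : Fin l, ∃ w : ZQuotient p k i, sigma w = w⁻¹ ∧
      φ w = φ' (ZQuotient.gen p i (e (Sum.inr j))) := fun j =>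
    _root_.exists_odd_lift SigmaGroup.sigma_sigma hφσ hφ (odd_card_of_isPGroup hp hB)
      (by rw [← hφ'σ, ZQuotient.sigma_gen, map_inv])
  choose w hwσ hwφ using hw
  obtain ⟨ι, hι⟩ := ZQuotient.exists_lift (n := k) (ZQuotient.isPGroup N i) (hZ N)
    fun j => ZQuotient.gen p i (e (Sum.inl j))
  obtain ⟨ρ, hρ⟩ := ZQuotient.exists_lift (n := N) (ZQuotient.isPGroup k i) (hZ k)
    fun t => Sum.elim (ZQuotient.gen p i) w (e.symm t)
  let Q := Multiplicative (Fin l → ZMod p)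
  let _ : TopologicalSpace Q := ⊥
  have _ : DiscreteTopology Q := ⟨rfl⟩
  have hQp : ∀ x : Q, x ^ p = 1 := fun x => by
    apply Multiplicative.toAdd.injective
    rw [toAdd_pow, toAdd_one]
    funext j
    simp
  have hQ : IsPGroup p Q := fun x => ⟨1, by rw [pow_one, hQp]⟩
  have hQfin : Finite Q := inferInstanceAs (Finite (Fin l → ZMod p))
  have hQi : zassenhaus p Q i = ⊥ := by
    rw [eq_bot_iff]
    refine (zassenhaus_antitone p hi).trans
      (zassenhaus_le p le_rfl (isClosed_discrete _) (fun x _ => hQp x) ?_)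
    intro _ _ _ _ _ a _ b _
    rw [mul_comm a, mul_inv_cancel_right, mul_inv_cancel]
    exact one_mem _
  obtain ⟨h', hh'⟩ := ZQuotient.exists_lift (n := N) hQ hQi
    fun t => Sum.elim (fun _ => 1) (fun j => Multiplicative.ofAdd (Pi.single j 1)) (e.symm t)
  let z : Fin l → ZQuotient p N i := fun j => ZQuotient.gen p i (e (Sum.inr j)) * (ι (w j))⁻¹
  have hρι : ∀ x, ρ (ι x) = x := fun x => DFunLike.congr_fun
    (ZQuotient.hom_ext (φ := ρ.comp ι) (ψ := MonoidHom.id _) fun j => by simp [hι, hρ]) x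
  have hρz : ∀ j, ρ (z j) = 1 := fun j => by simp [z, hρ, hρι]
  have hh'ι : ∀ x, h' (ι x) = 1 := fun x => DFunLike.congr_fun
    (ZQuotient.hom_ext (φ := h'.comp ι) (ψ := 1) fun j => by simp [hι, hh']) x
  have hh'z : ∀ j, h' (z j) = Multiplicative.ofAdd (Pi.single j 1) := fun j => by
    simp [z, hh', hh'ι]
  have hgen : Subgroup.closure (Set.range ι ∪ Set.range z) = ⊤ := by
    rw [← top_le_iff, ← ZQuotient.closure_gen, Subgroup.closure_le]
    rintro _ ⟨t, rfl⟩
    obtain ⟨s, rfl⟩ := e.surjective t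
    rcases s with j | j
    · exact Subgroup.subset_closure (Or.inl ⟨_, hι j⟩)
    · have h1 : ZQuotient.gen p i (e (Sum.inr j)) = z j * ι (w j) := by simp [z]
      rw [h1]
      exact mul_mem (Subgroup.subset_closure (Or.inr ⟨j, rfl⟩))
        (Subgroup.subset_closure (Or.inl ⟨_, rfl⟩))
  have hισ : ∀ x, ι (sigma x) = sigma (ι x) := equivariant_of_closure
    (ZQuotient.closure_gen k i) ZQuotient.sigma_gen fun j => by rw [hι, ZQuotient.sigma_gen]
  have hρσ : ∀ x, ρ (sigma x) = sigma (ρ x) := equivariant_of_closure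
    (ZQuotient.closure_gen N i) ZQuotient.sigma_gen fun t => by
      obtain ⟨s, rfl⟩ := e.surjective t
      rw [hρ, Equiv.symm_apply_apply]
      rcases s with j | j
      · exact ZQuotient.sigma_gen j
      · exact hwσ j
  have hh'σ : ∀ x, h' (sigma x) = (h' x)⁻¹ := equivariant_of_closure (φ := h')
    (τ := (invMonoidHom : Q →* Q)) (ZQuotient.closure_gen N i) ZQuotient.sigma_gen fun t => rfl
  have hker : φ'.ker = φ.ker.comap ρ := by
    rw [MonoidHom.comap_ker]
    congr 1
    refine ZQuotient.hom_ext fun t => ?_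
    obtain ⟨s, rfl⟩ := e.surjective t
    rw [MonoidHom.comp_apply, hρ, Equiv.symm_apply_apply]
    rcases s with j | j
    · exact h j
    · exact (hwφ j).symm
  rw [hker]
  exact ⟨finrank_invHoms_comap φ.ker hρι hρz hgen hh'ι hh'z,
    oddInvHoms_comap_iff φ.ker hρι hρz hgen hh'ι hh'z hισ hρσ hh'σ⟩

/-- The difference between the number of relations and the number of generators does not depend on
the presentation. -/
theorem finrank_invHoms_ker_add (hp : p ≠ 2) (hi : 2 ≤ i) {k l : ℕ}
    {B : Type*} [Group B] [TopologicalSpace B] [DiscreteTopology B] [SigmaGroup B] [Finite B]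
    (hB : IsPGroup p B) (hBi : zassenhaus p B i = ⊥)
    (φ : ZQuotient p k i →* B) (hφσ : ∀ x, φ (sigma x) = sigma (φ x))
    (hφ : Function.Surjective φ) (ψ : ZQuotient p l i →* B)
    (hψσ : ∀ x, ψ (sigma x) = sigma (ψ x)) (hψ : Function.Surjective ψ) :
    Module.finrank (ZMod p) (invHoms p φ.ker) + l =
        Module.finrank (ZMod p) (invHoms p ψ.ker) + k ∧
      (OddInvHoms p sigma φ.ker ↔ OddInvHoms p sigma ψ.ker) := by
  obtain ⟨φ', hφ'⟩ := ZQuotient.exists_lift (n := k + l) hB hBi fun t =>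
    Sum.elim (fun j => φ (ZQuotient.gen p i j)) (fun j => ψ (ZQuotient.gen p i j))
      (finSumFinEquiv.symm t)
  have hφ'σ : ∀ x, φ' (sigma x) = sigma (φ' x) := equivariant_of_closure
    (ZQuotient.closure_gen _ i) ZQuotient.sigma_gen fun t => by
      obtain ⟨s, rfl⟩ := finSumFinEquiv.surjective t
      rw [hφ', Equiv.symm_apply_apply]
      rcases s with j | j
      · simp only [Sum.elim_inl]
        rw [← hφσ, ZQuotient.sigma_gen, map_inv]
      · simp only [Sum.elim_inr]
        rw [← hψσ, ZQuotient.sigma_gen, map_inv]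
  have h1 := finrank_invHoms_ker_extend hp hi finSumFinEquiv hB φ hφσ hφ φ' hφ'σ fun j => by
    rw [hφ', Equiv.symm_apply_apply, Sum.elim_inl]
  have h2 := finrank_invHoms_ker_extend hp hi ((Equiv.sumComm _ _).trans finSumFinEquiv) hB ψ
    hψσ hψ φ' hφ'σ fun j => by
      rw [hφ', Equiv.trans_apply, Equiv.symm_apply_apply, Equiv.sumComm_apply, Sum.swap_inl,
        Sum.elim_inr]
  exact ⟨h1.1.symm.trans h2.1, h1.2.symm.trans h2.2⟩

end presentations

/-! ### The probability of a finite quotient -/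

section probability

variable {p : ℕ} [Fact p.Prime] {k : ℕ}

instance t2Space_relatorQuotient (r : Fin k → oddPart (FreeProP p k)) :
    T2Space (RelatorQuotient r) := by
  have : IsClosed (relators r : Set (FreeProP p k)) := Subgroup.isClosed_topologicalClosure _
  infer_instance

/-- The presentation of `G_r`. -/
def relatorEpi (r : Fin k → oddPart (FreeProP p k)) : SigmaEpi p k (RelatorQuotient r) :=
  (SigmaEpi.refl p k).quotient (relators r)

omit [Fact p.Prime] in
theorem ker_relatorEpi (r : Fin k → oddPart (FreeProP p k)) :
    (relatorEpi r).toHom.ker = relators r := QuotientGroup.ker_mk' _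

omit [Fact p.Prime] in
theorem map_relators (r : Fin k → oddPart (FreeProP p k)) {K : Subgroup (FreeProP p k)}
    [K.Normal] (hK : IsOpen (K : Set (FreeProP p k))) :
    (relators r).map (QuotientGroup.mk' K) = Subgroup.normalClosure
      (Set.range fun i => (QuotientGroup.mk (r i : FreeProP p k) : FreeProP p k ⧸ K)) := by
  have hd : DiscreteTopology (FreeProP p k ⧸ K) := QuotientGroup.discreteTopology hK
  have h1 : (Subgroup.normalClosure (Set.range fun i => (r i : FreeProP p k))).map
      (QuotientGroup.mk' K) = Subgroup.normalClosure
      (Set.range fun i => (QuotientGroup.mk (r i : FreeProP p k) : FreeProP p k ⧸ K)) := by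
    rw [Subgroup.map_normalClosure _ _ (QuotientGroup.mk'_surjective K), ← Set.range_comp]
    rfl
  rw [← h1]
  refine le_antisymm ?_ (Subgroup.map_mono (Subgroup.le_topologicalClosure _))
  rw [Subgroup.map_le_iff_le_comap]
  refine Subgroup.topologicalClosure_minimal _ (Subgroup.le_comap_map _ _) ?_
  rw [Subgroup.coe_comap]
  exact (isClosed_discrete (α := FreeProP p k ⧸ K) _).preimage
    (f := ⇑(QuotientGroup.mk' K)) QuotientGroup.continuous_mk

/-- An isomorphism between a finite factor group of `G_r` and `B` amounts to an epimorphism to `B`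
from a finite factor group of `F_k` whose kernel is generated by the relators. -/
theorem sigmaIso_quotient_iff (r : Fin k → oddPart (FreeProP p k)) {K : Subgroup (FreeProP p k)}
    [K.Normal] [IsSigmaInvariant K] (hK : IsOpen (K : Set (FreeProP p k)))
    (L : Subgroup (RelatorQuotient r)) [L.Normal] [IsSigmaInvariant L]
    (hL : L = (relatorEpi r).image K)
    {B : Type*} [Group B] [TopologicalSpace B] [SigmaGroup B] [DiscreteTopology B] :
    SigmaIso (RelatorQuotient r ⧸ L) B ↔ ∃ φ : FreeProP p k ⧸ K →* B,
      (∀ x, φ (sigma x) = sigma (φ x)) ∧ Function.Surjective φ ∧ φ.ker = Subgroup.normalClosure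
        (Set.range fun i => (QuotientGroup.mk (r i : FreeProP p k) : FreeProP p k ⧸ K)) := by
  have hLo : IsOpen (L : Set (RelatorQuotient r)) := by
    rw [hL]; exact (relatorEpi r).isOpenMap _ hK
  have hd : DiscreteTopology (RelatorQuotient r ⧸ L) := QuotientGroup.discreteTopology hLo
  let π := (relatorEpi r).quotient L
  have hker : π.toHom.ker = K ⊔ relators r := by
    have h1 : π.toHom.ker = L.comap (relatorEpi r).toHom := by
      change ((QuotientGroup.mk' L).comp (relatorEpi r).toHom).ker = _
      rw [← MonoidHom.comap_ker, QuotientGroup.ker_mk']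
    rw [h1, hL, SigmaEpi.image, Subgroup.comap_map_eq, ker_relatorEpi]
  have hmap : (K ⊔ relators r).map (QuotientGroup.mk' K) = Subgroup.normalClosure
        (Set.range fun i => (QuotientGroup.mk (r i : FreeProP p k) : FreeProP p k ⧸ K)) := by
    rw [Subgroup.map_sup, QuotientGroup.map_mk'_self, bot_sup_eq, map_relators r hK]
  constructor
  · rintro ⟨e, he⟩
    have hker' : (π.trans e he).toHom.ker = K ⊔ relators r := by
      rw [← hker]
      ext x
      change e (π.toHom x) = 1 ↔ π.toHom x = 1
      simp
    let φ : FreeProP p k ⧸ K →* B := QuotientGroup.lift K (π.trans e he).toHom fun x hx => by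
      rw [hker']; exact Subgroup.mem_sup_left hx
    refine ⟨φ, fun x => ?_, fun b => ?_, ?_⟩
    · induction x using QuotientGroup.induction_on with
      | H x => exact (π.trans e he).map_sigma x
    · obtain ⟨x, rfl⟩ := (π.trans e he).surjective b
      exact ⟨QuotientGroup.mk x, rfl⟩
    · rw [← hmap, ← hker', ← Subgroup.map_comap_eq_self_of_surjective
        (QuotientGroup.mk'_surjective K) φ.ker, MonoidHom.comap_ker]
      rfl
  · rintro ⟨φ, hφσ, hφ, hφk⟩
    obtain ⟨e, he⟩ := exists_mulEquiv_of_ker_eq π.surjective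
      (g := φ.comp (QuotientGroup.mk' K)) (hφ.comp (QuotientGroup.mk'_surjective K)) (by
        rw [hker, ← MonoidHom.comap_ker, hφk, ← hmap, Subgroup.comap_map_eq,
          QuotientGroup.ker_mk', eq_comm, sup_eq_left]
        exact le_sup_left)
    refine ⟨⟨e, continuous_of_discreteTopology, continuous_of_discreteTopology⟩, fun y => ?_⟩
    obtain ⟨x, rfl⟩ := π.surjective y
    change e (sigma (π.toHom x)) = sigma (e (π.toHom x))
    rw [← π.map_sigma, he, he]
    exact hφσ (QuotientGroup.mk x)

theorem schConst_pos {p : ℕ} [hp : Fact p.Prime] (k : ℕ) : 0 < schConst p k := by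
  refine Finset.prod_pos fun i hi => ?_
  have h1 : 1 ≤ i := (Finset.mem_Icc.1 hi).1
  have h2 : (1 : ℝ) < (p : ℝ) ^ i :=
    one_lt_pow₀ (by exact_mod_cast hp.out.one_lt) (by omega)
  exact sub_pos.2 (inv_lt_one_of_one_lt₀ h2)

/-- The probability that the relators of a random tuple generate the kernel of an epimorphism from
`F_k / K` to `B`. -/
theorem pi_oddHaar_exists_epi (hp : p ≠ 2) {K : Subgroup (FreeProP p k)}
    [K.Normal] [IsSigmaInvariant K] (hK : IsOpen (K : Set (FreeProP p k)))
    {B : Type*} [Group B] [TopologicalSpace B] [SigmaGroup B] [DiscreteTopology B] [Finite B]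
    (hB : IsPGroup p B) (hepi : ∀ ψ : SigmaEpi p k B, K ≤ ψ.toHom.ker)
    {n m : ℕ} (hX : OddInvHoms p sigma (⊤ : Subgroup B))
    (hn : Module.finrank (ZMod p) (invHoms p (⊤ : Subgroup B)) = n) (hnk : n ≤ k)
    (hker : ∀ φ : FreeProP p k ⧸ K →* B, (∀ x, φ (sigma x) = sigma (φ x)) →
      Function.Surjective φ →
      OddInvHoms p sigma φ.ker ∧ Module.finrank (ZMod p) (invHoms p φ.ker) = m) (hmk : m ≤ k) :
    (Measure.pi fun _ : Fin k => oddHaar p k)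
      {r | ∃ φ : FreeProP p k ⧸ K →* B, (∀ x, φ (sigma x) = sigma (φ x)) ∧
        Function.Surjective φ ∧ φ.ker = Subgroup.normalClosure
          (Set.range fun i => (QuotientGroup.mk (r i : FreeProP p k) : FreeProP p k ⧸ K))} =
      ENNReal.ofReal (schConst p k ^ 2 / (schConst p (k - n) * schConst p (k - m) *
        (Nat.card (SigmaAut B) : ℝ))) := by
  have hfin : Finite (FreeProP p k ⧸ K) := K.quotient_finite_of_isOpen hK
  have hd : DiscreteTopology (FreeProP p k ⧸ K) := QuotientGroup.discreteTopology hK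
  rw [pi_oddHaar_apply hp hK k fun A => ∃ φ : FreeProP p k ⧸ K →* B,
    (∀ x, φ (sigma x) = sigma (φ x)) ∧
        Function.Surjective φ ∧ φ.ker = Subgroup.normalClosure (Set.range A)]
  congr 1
  let π := (SigmaEpi.refl p k).quotient K
  have h := card_relators_mul_card_aut hp (FreeProP.isPGroup_quotient hK) hB
    (σ := sigma) SigmaGroup.sigma_sigma (τ := sigma) SigmaGroup.sigma_sigma
    (fun j => π.toHom (FreeProP.gen j)) π.sigma_toHom_gen π.closure_eq_top
    (fun y hy hgen => by
      obtain ⟨φ, hφ, hφg⟩ := FreeProP.exists_lift_finite hB y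
      let ψ : SigmaEpi p k B := ⟨φ, hφ, by
        rw [← MonoidHom.range_eq_top, ← top_le_iff, ← hgen, Subgroup.closure_le]
        rintro _ ⟨j, rfl⟩
        exact ⟨_, hφg j⟩, FreeProP.hom_sigma hφ fun j => by rw [hφg, hy]⟩
      exact ⟨QuotientGroup.lift K φ (hepi ψ), hφg⟩) hX hn hnk hker hmk
  have hA : Nat.card {α : B ≃* B // ∀ x, α (sigma x) = sigma (α x)} = Nat.card (SigmaAut B) :=
    Nat.card_congr
      { toFun := fun α => ⟨⟨α.1, continuous_of_discreteTopology, continuous_of_discreteTopology⟩,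
          α.2⟩
        invFun := fun α => ⟨α.1.toMulEquiv, α.2⟩
        left_inv := fun _ => rfl
        right_inv := fun _ => rfl }
  rw [hA] at h
  have hA0 : (Nat.card (SigmaAut B) : ℝ) ≠ 0 := by
    rw [← hA]
    have : Finite (B ≃* B) := Finite.of_injective _ DFunLike.coe_injective
    have : Nonempty {α : B ≃* B // ∀ x, α (sigma x) = sigma (α x)} :=
      ⟨⟨MulEquiv.refl B, fun _ => rfl⟩⟩
    exact Nat.cast_ne_zero.2 Nat.card_pos.ne'
  have hpos : (Nat.card {a : FreeProP p k ⧸ K // sigma a = a⁻¹} : ℝ) ≠ 0 := by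
    have : Nonempty {a : FreeProP p k ⧸ K // sigma a = a⁻¹} := ⟨⟨1, by simp⟩⟩
    exact Nat.cast_ne_zero.2 Nat.card_pos.ne'
  have h1 := (schConst_pos (p := p) (k - n)).ne'
  have h2 := (schConst_pos (p := p) (k - m)).ne'
  rw [div_eq_div_iff (pow_ne_zero _ hpos) (mul_ne_zero (mul_ne_zero h1 h2) hA0)]
  linear_combination h

end probability

/-! ### Isomorphisms and invariants of weak Schur `σ`-groups -/

section iso

variable {G H A : Type*} [Group G] [TopologicalSpace G] [SigmaGroup G]
  [Group H] [TopologicalSpace H] [SigmaGroup H] [Group A] [TopologicalSpace A] [SigmaGroup A]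

theorem SigmaIso.refl (G : Type*) [Group G] [TopologicalSpace G] [SigmaGroup G] : SigmaIso G G :=
  ⟨ContinuousMulEquiv.refl _, fun _ => rfl⟩

theorem SigmaIso.symm (h : SigmaIso G H) : SigmaIso H G := by
  obtain ⟨e, he⟩ := h
  exact ⟨e.symm, fun x => by
    rw [ContinuousMulEquiv.symm_apply_eq, he, ContinuousMulEquiv.apply_symm_apply]⟩

theorem SigmaIso.trans (h : SigmaIso G H) (h' : SigmaIso H A) : SigmaIso G A := by
  obtain ⟨e, he⟩ := h
  obtain ⟨f, hf⟩ := h'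
  exact ⟨e.trans f, fun x => by simp only [ContinuousMulEquiv.trans_apply, he, hf]⟩

theorem sigmaIso_of_ker_eq [DiscreteTopology H] [DiscreteTopology A] {f : G →* H} {g : G →* A}
    (hf : Function.Surjective f) (hg : Function.Surjective g)
    (hfσ : ∀ x, f (sigma x) = sigma (f x)) (hgσ : ∀ x, g (sigma x) = sigma (g x))
    (h : f.ker = g.ker) : SigmaIso H A := by
  obtain ⟨e, he⟩ := exists_mulEquiv_of_ker_eq hf hg h
  refine ⟨⟨e, continuous_of_discreteTopology, continuous_of_discreteTopology⟩, fun y => ?_⟩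
  obtain ⟨x, rfl⟩ := hf y
  change e (sigma (f x)) = sigma (e (f x))
  rw [← hfσ, he, he, hgσ]

omit [SigmaGroup G] [SigmaGroup H] in
theorem ContinuousMulEquiv.exists_dense_closure (e : G ≃ₜ* H) {d : ℕ}
    (h : ∃ x : Fin d → G, Dense (Subgroup.closure (Set.range x) : Set G)) :
    ∃ x : Fin d → H, Dense (Subgroup.closure (Set.range x) : Set H) := by
  obtain ⟨x, hx⟩ := h
  refine ⟨fun i => e (x i), ?_⟩
  have h := e.surjective.denseRange.dense_image e.continuous hx
  have h1 : (e : G → H) '' (Subgroup.closure (Set.range x) : Set G) =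
      ((Subgroup.closure (Set.range x)).map (e : G →* H) : Set H) := rfl
  rw [h1, MonoidHom.map_closure, ← Set.range_comp] at h
  exact h

theorem SigmaIso.minGenerators_eq (h : SigmaIso G H) : minGenerators G = minGenerators H := by
  obtain ⟨e, -⟩ := h
  exact congrArg sInf (Set.ext fun d => ⟨e.exists_dense_closure, e.symm.exists_dense_closure⟩)

end iso

namespace SigmaEpi

variable {p n : ℕ} [Fact p.Prime] {G : Type*} [Group G] [TopologicalSpace G] [SigmaGroup G]
  [IsTopologicalGroup G] [T2Space G]

omit [IsTopologicalGroup G] [T2Space G] in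
theorem minGenerators_eq_finrank_of_discrete [DiscreteTopology G] (π : SigmaEpi p n G) :
    minGenerators G = Module.finrank (ZMod p) (invHoms p (⊤ : Subgroup G)) := by
  have := π.finite
  have h : ∀ d, (∃ x : Fin d → G, Dense (Subgroup.closure (Set.range x) : Set G)) ↔
      Module.finrank (ZMod p) (invHoms p (⊤ : Subgroup G)) ≤ d := fun d => by
    rw [← exists_closure_eq_top_iff_finrank_le π.isPGroup]
    refine exists_congr fun x => ?_
    rw [dense_discrete]
    exact ⟨fun h => SetLike.coe_injective h, fun h => by rw [h]; rfl⟩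
  simp only [minGenerators, h]
  exact csInf_Ici

theorem minGenerators_quotient (π : SigmaEpi p n G) {L : Subgroup G} [L.Normal]
    [IsSigmaInvariant L] (hLo : IsOpen (L : Set G)) (hL : L ≤ openFrattini G) :
    minGenerators (G ⧸ L) = minGenerators G := by
  have hd : DiscreteTopology (G ⧸ L) := QuotientGroup.discreteTopology hLo
  rw [π.minGenerators_eq_finrank hLo hL, (π.quotient L).minGenerators_eq_finrank_of_discrete]

omit [Fact p.Prime] [IsTopologicalGroup G] [T2Space G] in
theorem image_le_openFrattini (π : SigmaEpi p n G) {D : Subgroup (FreeProP p n)}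
    (hD : D ≤ openFrattini (FreeProP p n)) : π.image D ≤ openFrattini G := by
  rw [SigmaEpi.image, Subgroup.map_le_iff_le_comap]
  refine hD.trans fun x hx => ?_
  rw [Subgroup.mem_comap, openFrattini, Subgroup.mem_sInf]
  rintro M ⟨hMo, hM⟩
  have h1 := Subgroup.isCoatom_comap_of_surjective π.surjective hM
  exact Subgroup.mem_sInf.1 hx _ ⟨hMo.preimage π.continuous_toHom, h1⟩

theorem zassenhaus_eq_image (π : SigmaEpi p n G) (i : ℕ) :
    zassenhaus p G i = π.image (zassenhaus p (FreeProP p n) i) :=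
  (map_zassenhaus_of_surjective p π.toHom π.continuous_toHom π.surjective i).symm

omit [IsTopologicalGroup G] [T2Space G] in
/-- The invariant homomorphisms of a finite `σ`-group generated by odd elements are odd. -/
theorem oddInvHoms_top [DiscreteTopology G] (π : SigmaEpi p n G) :
    OddInvHoms p sigma (⊤ : Subgroup G) := by
  have := π.finite
  exact oddInvHoms_of_normalClosure π.isPGroup ⊤ (fun _ _ => trivial)
    (fun i => ⟨π.toHom (FreeProP.gen i), trivial⟩) π.sigma_toHom_gen
    ((closure_eq_top_iff_normalClosure π.isPGroup _).1 π.closure_eq_top)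

/-- A `σ`-pro-`p`-group generated by odd elements is a factor group of `F_k` for all
`k ≥ d_G`. -/
theorem exists_of_minGenerators_le (hp : p ≠ 2) (π : SigmaEpi p n G) {k : ℕ}
    (hk : minGenerators G ≤ k) : Nonempty (SigmaEpi p k G) := by
  have := π.compactSpace
  have hGo := π.isOpen_zassenhaus 2
  have hFr := π.zassenhaus_le_openFrattini (i := 2) le_rfl
  let Γ := G ⧸ zassenhaus p G 2
  have hd : DiscreteTopology Γ := QuotientGroup.discreteTopology hGo
  let πΓ : SigmaEpi p n Γ := π.quotient (zassenhaus p G 2)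
  have hfin : Finite Γ := πΓ.finite
  rw [π.minGenerators_eq_finrank hGo hFr] at hk
  obtain ⟨y, hyσ, hy⟩ := exists_odd_separating (M := (⊤ : Subgroup Γ)) hp (σ := sigma)
    SigmaGroup.sigma_sigma (fun _ _ => trivial) πΓ.oddInvHoms_top
  let y' : Fin k → Γ := fun j =>
    if h : j.1 < Module.finrank (ZMod p) (invHoms p (⊤ : Subgroup Γ)) then y ⟨j, h⟩ else 1
  have hy'σ : ∀ j, sigma (y' j) = (y' j)⁻¹ := by
    intro j
    by_cases h : j.1 < Module.finrank (ZMod p) (invHoms p (⊤ : Subgroup Γ))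
    · simp only [y', dif_pos h, hyσ]
    · simp only [y', dif_neg h, map_one, inv_one]
  have hgen : Subgroup.closure (Set.range y') = ⊤ := by
    rw [closure_range_eq_top_iff_invHoms πΓ.isPGroup]
    refine fun f hf h' => hy f hf fun j => ?_
    have := h' ⟨j, j.2.trans_le hk⟩
    simpa [y'] using this
  choose b hbσ hb using fun j => πΓ.exists_odd_lift hp (hy'σ j)
  obtain ⟨φ, hφ, hφg⟩ := FreeProP.exists_lift b
  have hdense := π.dense_closure_of_quotient hFr (fun j => π.toHom (b j)) (by
    rw [← hgen]
    congr 1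
    exact congrArg Set.range (funext hb))
  refine ⟨⟨π.toHom.comp φ, π.continuous_toHom.comp hφ, fun x => ?_, fun x => ?_⟩⟩
  · have hr : Subgroup.closure (Set.range fun j => π.toHom (b j)) ≤ (π.toHom.comp φ).range := by
      rw [Subgroup.closure_le]
      rintro _ ⟨j, rfl⟩
      exact ⟨FreeProP.gen j, congrArg π.toHom (hφg j)⟩
    have hcl : IsClosed ((π.toHom.comp φ).range : Set G) := by
      rw [MonoidHom.coe_range]
      exact (isCompact_range (π.continuous_toHom.comp hφ)).isClosed
    exact closure_minimal hr hcl (hdense x)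
  · rw [MonoidHom.comp_apply, FreeProP.hom_sigma hφ (fun j => by rw [hφg, hbσ]), π.map_sigma]
    rfl

/-- The homomorphism of finite factor groups induced by `π`. -/
def reduce (π : SigmaEpi p n G) (K : Subgroup (FreeProP p n)) [K.Normal] {L : Subgroup G}
    [L.Normal] (hL : L = π.image K) : FreeProP p n ⧸ K →* G ⧸ L :=
  QuotientGroup.map K L π.toHom (by rw [hL]; exact Subgroup.le_comap_map _ _)

section reduce

variable (π : SigmaEpi p n G) (K : Subgroup (FreeProP p n)) [K.Normal] [IsSigmaInvariant K]
  {L : Subgroup G} [L.Normal] [IsSigmaInvariant L]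

omit [Fact p.Prime] [IsTopologicalGroup G] [T2Space G] [IsSigmaInvariant K]
  [IsSigmaInvariant L] in
theorem reduce_surjective (hL : L = π.image K) : Function.Surjective (π.reduce K hL) := by
  intro x
  obtain ⟨y, rfl⟩ := QuotientGroup.mk_surjective x
  obtain ⟨z, rfl⟩ := π.surjective y
  exact ⟨QuotientGroup.mk z, rfl⟩

omit [Fact p.Prime] [IsTopologicalGroup G] [T2Space G] in
theorem reduce_sigma (hL : L = π.image K) (x : FreeProP p n ⧸ K) :
    π.reduce K hL (sigma x) = sigma (π.reduce K hL x) := by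
  induction x using QuotientGroup.induction_on with
  | H x =>
    change (QuotientGroup.mk (π.toHom (sigma x)) : G ⧸ L) = _
    rw [π.map_sigma]; rfl

omit [Fact p.Prime] [IsTopologicalGroup G] [T2Space G] [K.Normal] [IsSigmaInvariant K]
  [IsSigmaInvariant L] in
theorem ker_comp_mk (hL : L = π.image K) :
    ((QuotientGroup.mk' L).comp π.toHom).ker = K ⊔ π.toHom.ker := by
  rw [← MonoidHom.comap_ker, QuotientGroup.ker_mk', hL, SigmaEpi.image, Subgroup.comap_map_eq]

omit [Fact p.Prime] [IsTopologicalGroup G] [T2Space G] [IsSigmaInvariant K]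
  [IsSigmaInvariant L] in
theorem ker_reduce (hL : L = π.image K) :
    (π.reduce K hL).ker = π.toHom.ker.map (QuotientGroup.mk' K) := by
  rw [← Subgroup.map_comap_eq_self_of_surjective (QuotientGroup.mk'_surjective K)
    (π.reduce K hL).ker, MonoidHom.comap_ker]
  have h : (π.reduce K hL).comp (QuotientGroup.mk' K) = (QuotientGroup.mk' L).comp π.toHom := rfl
  rw [h, π.ker_comp_mk K hL, Subgroup.map_sup, QuotientGroup.map_mk'_self, bot_sup_eq]

end reduce

/-- Precomposition with an automorphism of `F_n`. -/
def precomp (π : SigmaEpi p n G) (α : SigmaAut (FreeProP p n)) : SigmaEpi p n G where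
  toHom := π.toHom.comp (α.1 : FreeProP p n →* FreeProP p n)
  continuous_toHom := π.continuous_toHom.comp α.1.continuous
  surjective := π.surjective.comp α.1.surjective
  map_sigma x := by
    change π.toHom (α.1 (sigma x)) = _
    rw [α.2, π.map_sigma]; rfl

end SigmaEpi

/-- Invariant homomorphisms under a surjective homomorphism of finite groups. -/
theorem finrank_invHoms_le_of_map {p : ℕ} [Fact p.Prime] {E₁ E₂ : Type*} [Group E₁] [Finite E₁]
    [Group E₂] {σ₁ : E₁ →* E₁} {σ₂ : E₂ →* E₂} {f : E₁ →* E₂}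
    (hfσ : ∀ x, f (σ₁ x) = σ₂ (f x)) {M₁ : Subgroup E₁} {M₂ : Subgroup E₂}
    (hM : M₁.map f = M₂) (hM₁ : ∀ x ∈ M₁, σ₁ x ∈ M₁) :
    Module.finrank (ZMod p) (invHoms p M₂) ≤ Module.finrank (ZMod p) (invHoms p M₁) ∧
      (OddInvHoms p σ₁ M₁ → OddInvHoms p σ₂ M₂) := by
  subst hM
  have : Finite (M₁ → ZMod p) := Pi.finite
  refine ⟨LinearMap.finrank_le_finrank_of_injective
    (f := invHoms.pullback (M₁.map f) f (Subgroup.le_comap_map f M₁)) ?_, ?_⟩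
  · intro g h hgh
    apply Subtype.ext
    funext ⟨_, x, hx, rfl⟩
    exact congrFun (congrArg Subtype.val hgh) ⟨x, hx⟩
  · rintro h g hg ⟨_, x, hx, rfl⟩ ⟨b, hb⟩ hab
    have h1 := h _ (invHoms.pullback (M₁.map f) f (Subgroup.le_comap_map f M₁) ⟨g, hg⟩).2
      ⟨x, hx⟩ ⟨σ₁ x, hM₁ x hx⟩ rfl
    rw [← show g ⟨f (σ₁ x), ⟨_, hM₁ x hx, rfl⟩⟩ = g ⟨b, hb⟩ from
      congrArg g (Subtype.ext ((hfσ x).trans hab.symm))]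
    exact h1

section quotients

variable {p : ℕ} [Fact p.Prime] {G H : Type*} [Group G] [TopologicalSpace G] [SigmaGroup G]
  [IsTopologicalGroup G] [T2Space G] [Group H] [TopologicalSpace H] [SigmaGroup H]
  [IsTopologicalGroup H] [T2Space H] {k l : ℕ}

omit [SigmaGroup G] [T2Space G] in
theorem mem_zassenhaus_iff_mk_mem [CompactSpace G] {i j : ℕ} (hij : i ≤ j)
    [T2Space (G ⧸ zassenhaus p G j)] (x : G) :
    (QuotientGroup.mk x : G ⧸ zassenhaus p G j) ∈ zassenhaus p (G ⧸ zassenhaus p G j) i ↔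
      x ∈ zassenhaus p G i := by
  rw [← map_zassenhaus_of_surjective p (QuotientGroup.mk' (zassenhaus p G j))
    QuotientGroup.continuous_mk (QuotientGroup.mk'_surjective _) i]
  constructor
  · rintro ⟨y, hy, hyx⟩
    have h1 : y⁻¹ * x ∈ zassenhaus p G j := by rw [← QuotientGroup.eq]; exact hyx
    have h2 := mul_mem hy (zassenhaus_antitone p hij h1)
    rwa [mul_inv_cancel_left] at h2
  · exact fun h => ⟨x, h, rfl⟩

/-- Isomorphic factor groups by `D_j` have isomorphic factor groups by `D_i` for `i ≤ j`. -/
theorem SigmaIso.zassenhaus_quotient_of_le (π : SigmaEpi p k G) (ρ : SigmaEpi p l H) {i j : ℕ}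
    (hij : i ≤ j) (h : SigmaIso (G ⧸ zassenhaus p G j) (H ⧸ zassenhaus p H j)) :
    SigmaIso (G ⧸ zassenhaus p G i) (H ⧸ zassenhaus p H i) := by
  have := π.compactSpace
  have := ρ.compactSpace
  have hdG : ∀ i, DiscreteTopology (G ⧸ zassenhaus p G i) := fun i =>
    QuotientGroup.discreteTopology (π.isOpen_zassenhaus i)
  have hdH : ∀ i, DiscreteTopology (H ⧸ zassenhaus p H i) := fun i =>
    QuotientGroup.discreteTopology (ρ.isOpen_zassenhaus i)
  obtain ⟨e, he⟩ := h
  let q : H ⧸ zassenhaus p H j →* H ⧸ zassenhaus p H i :=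
    QuotientGroup.map _ _ (MonoidHom.id H) (zassenhaus_antitone p hij)
  let g : G →* H ⧸ zassenhaus p H i :=
    (q.comp (e : G ⧸ zassenhaus p G j →* H ⧸ zassenhaus p H j)).comp (QuotientGroup.mk' _)
  have hq : Function.Surjective q := fun x => by
    obtain ⟨y, rfl⟩ := QuotientGroup.mk_surjective x
    exact ⟨QuotientGroup.mk y, rfl⟩
  refine sigmaIso_of_ker_eq (f := QuotientGroup.mk' (zassenhaus p G i)) (g := g)
    (QuotientGroup.mk'_surjective _)
    ((hq.comp e.surjective).comp (QuotientGroup.mk'_surjective _)) (fun _ => rfl)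
    (fun x => ?_) ?_
  · change q (e (sigma (QuotientGroup.mk x))) = sigma (q (e (QuotientGroup.mk x)))
    rw [he]
    induction e (QuotientGroup.mk x) using QuotientGroup.induction_on with
    | H y => rfl
  · ext x
    rw [QuotientGroup.ker_mk', MonoidHom.mem_ker]
    change _ ↔ q (e (QuotientGroup.mk x)) = 1
    have h1 : q (e (QuotientGroup.mk x)) = 1 ↔
        e (QuotientGroup.mk x) ∈ zassenhaus p (H ⧸ zassenhaus p H j) i := by
      induction e (QuotientGroup.mk x) using QuotientGroup.induction_on with
      | H y =>
        rw [mem_zassenhaus_iff_mk_mem hij]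
        exact QuotientGroup.eq_one_iff y
    rw [h1, ← mem_zassenhaus_iff_mk_mem hij]
    constructor
    · exact map_mem_zassenhaus p
        (e : G ⧸ zassenhaus p G j →* H ⧸ zassenhaus p H j) e.continuous i _
    · intro h2
      have h3 := map_mem_zassenhaus p
        (e.symm : H ⧸ zassenhaus p H j →* G ⧸ zassenhaus p G j) e.symm.continuous i _ h2
      simpa using h3

/-- Isomorphic groups have isomorphic factor groups by `D_i`. -/
theorem SigmaIso.zassenhaus_quotient (π : SigmaEpi p k G) (ρ : SigmaEpi p l H) (i : ℕ)
    (h : SigmaIso G H) : SigmaIso (G ⧸ zassenhaus p G i) (H ⧸ zassenhaus p H i) := by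
  have hdG : DiscreteTopology (G ⧸ zassenhaus p G i) :=
    QuotientGroup.discreteTopology (π.isOpen_zassenhaus i)
  have hdH : DiscreteTopology (H ⧸ zassenhaus p H i) :=
    QuotientGroup.discreteTopology (ρ.isOpen_zassenhaus i)
  obtain ⟨e, he⟩ := h
  refine sigmaIso_of_ker_eq (f := QuotientGroup.mk' (zassenhaus p G i))
    (g := (QuotientGroup.mk' (zassenhaus p H i)).comp (e : G →* H))
    (QuotientGroup.mk'_surjective _)
    ((QuotientGroup.mk'_surjective _).comp e.surjective) (fun _ => rfl)
    (fun x => congrArg QuotientGroup.mk (he x)) ?_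
  ext x
  rw [← MonoidHom.comap_ker, QuotientGroup.ker_mk', QuotientGroup.ker_mk', Subgroup.mem_comap]
  constructor
  · exact map_mem_zassenhaus p (e : G →* H) e.continuous i _
  · intro h2
    have h3 := map_mem_zassenhaus p (e.symm : H →* G) e.symm.continuous i _ h2
    simpa using h3

end quotients

/-! ### The measures of the sets `U_{i,G}` and `U_{D,G}` -/

section formulas

variable {p : ℕ} [Fact p.Prime] {k l n : ℕ}

omit [Fact p.Prime] in
theorem Sch.mk_eq_mk_iff (s : Fin k → oddPart (FreeProP p k)) (r : Fin l → oddPart (FreeProP p l)) :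
    Sch.mk s = Sch.mk r ↔ SigmaIso (RelatorQuotient s) (RelatorQuotient r) :=
  Quotient.eq

/-- The class of `G_s / D_i` depends only on the class of `G_s`. -/
theorem Sch.mk_mem_basicOpen_iff (i : ℕ) (s : Fin k → oddPart (FreeProP p k))
    (r : Fin l → oddPart (FreeProP p l)) : Sch.mk s ∈ Sch.basicOpen i r ↔
      SigmaIso (RelatorQuotient s ⧸ zassenhaus p (RelatorQuotient s) i)
        (RelatorQuotient r ⧸ zassenhaus p (RelatorQuotient r) i) := by
  constructor
  · rintro ⟨k', s', h, h'⟩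
    exact (((Sch.mk_eq_mk_iff s s').1 h).zassenhaus_quotient (relatorEpi s) (relatorEpi s') i).trans
      h'
  · exact fun h => ⟨k, s, rfl, h⟩

/-- The invariant homomorphisms on a relation subgroup that is generated by `l` odd relators are
odd, and their space has dimension at most `l`. -/
theorem invHoms_normalClosure_mk (r : Fin l → oddPart (FreeProP p l))
    {K : Subgroup (FreeProP p l)} [K.Normal] [IsSigmaInvariant K]
    (hK : IsOpen (K : Set (FreeProP p l))) {M : Subgroup (FreeProP p l ⧸ K)}
    (hM : M = (relators r).map (QuotientGroup.mk' K)) :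
    OddInvHoms p sigma M ∧ Module.finrank (ZMod p) (invHoms p M) ≤ l := by
  have hfin : Finite (FreeProP p l ⧸ K) := K.quotient_finite_of_isOpen hK
  have hE := FreeProP.isPGroup_quotient hK
  have hMσ : ∀ x ∈ M, sigma x ∈ M := by
    subst hM
    rintro _ ⟨x, hx, rfl⟩
    exact ⟨sigma x, IsSigmaInvariant.sigma_mem x hx, rfl⟩
  have hMn : M.Normal := by
    subst hM
    exact Subgroup.Normal.map inferInstance _ (QuotientGroup.mk'_surjective K)
  rw [map_relators r hK] at hM
  let y : Fin l → M := fun i => ⟨QuotientGroup.mk (r i : FreeProP p l), by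
    rw [hM]; exact Subgroup.subset_normalClosure ⟨i, rfl⟩⟩
  have hy : Subgroup.normalClosure (Set.range fun i => (y i : FreeProP p l ⧸ K)) = M := hM.symm
  refine ⟨oddInvHoms_of_normalClosure hE M hMσ y (fun i => ?_) hy,
    finrank_invHoms_le y ((normalClosure_eq_iff_invHoms hE y).1 hy)⟩
  exact congrArg (QuotientGroup.mk : FreeProP p l → FreeProP p l ⧸ K) (r i).2

/-- The measure of `U_{i,G}` under the measures with a sufficiently large number of generators:
the numbers of generators and relations grow simultaneously. -/
theorem exists_pi_oddHaar_basicOpen (hp : p ≠ 2) {i : ℕ} (hi : 2 ≤ i)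
    (r : Fin l → oddPart (FreeProP p l)) : ∃ c : ℝ, 0 < c ∧ ∀ k,
    minGenerators (RelatorQuotient r) ≤ k →
      (Measure.pi fun _ : Fin k => oddHaar p k) {s | Sch.mk s ∈ Sch.basicOpen i r} =
        ENNReal.ofReal (schConst p k ^ 2 /
          (schConst p (k - minGenerators (RelatorQuotient r)) * c)) := by
  let G := RelatorQuotient r
  let B := G ⧸ zassenhaus p G i
  have hcomp : CompactSpace G := (relatorEpi r).compactSpace
  have hGo := (relatorEpi r).isOpen_zassenhaus i
  have hFr := (relatorEpi r).zassenhaus_le_openFrattini hi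
  have hd : DiscreteTopology B := QuotientGroup.discreteTopology hGo
  let πB : SigmaEpi p l B := (relatorEpi r).quotient (zassenhaus p G i)
  have hfin : Finite B := πB.finite
  have hBi : zassenhaus p B i = ⊥ := zassenhaus_quotient_self i
  have hz := fun k => (SigmaEpi.refl p k).isOpen_zassenhaus i
  have hφr := invHoms_normalClosure_mk r (hz l)
    (((relatorEpi r).ker_reduce _ ((relatorEpi r).zassenhaus_eq_image i)).trans
      (by rw [ker_relatorEpi]))
  set φr := (relatorEpi r).reduce _ ((relatorEpi r).zassenhaus_eq_image i)
  set ml := Module.finrank (ZMod p) (invHoms p φr.ker)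
  have hA : (0 : ℝ) < Nat.card (SigmaAut B) := by
    have h1 : Finite (B ≃ₜ* B) := Finite.of_injective _ DFunLike.coe_injective
    have h2 : Finite (SigmaAut B) := Subtype.finite
    have h3 : Nonempty (SigmaAut B) := ⟨⟨ContinuousMulEquiv.refl B, fun _ => rfl⟩⟩
    exact_mod_cast Nat.card_pos
  refine ⟨schConst p (l - ml) * Nat.card (SigmaAut B), mul_pos (schConst_pos _) hA,
    fun k hk => ?_⟩
  obtain ⟨ρ⟩ := (relatorEpi r).exists_of_minGenerators_le hp hk
  have hker : ∀ φ : ZQuotient p k i →* B, (∀ x, φ (sigma x) = sigma (φ x)) →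
      Function.Surjective φ → OddInvHoms p sigma φ.ker ∧
        Module.finrank (ZMod p) (invHoms p φ.ker) + l = ml + k := fun φ hφσ hφ => by
    have h := finrank_invHoms_ker_add hp hi πB.isPGroup hBi φ hφσ hφ φr
      ((relatorEpi r).reduce_sigma _ _) ((relatorEpi r).reduce_surjective _ _)
    exact ⟨h.2.2 hφr.1, h.1⟩
  have h0 := (hker (ρ.reduce _ (ρ.zassenhaus_eq_image i)) (ρ.reduce_sigma _ _)
    (ρ.reduce_surjective _ _)).2
  -- the excess of generators over relations is the same as for the presentation by `r`
  have hmk : k - (ml + k - l) = l - ml := by have := hφr.2; omega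
  have h := pi_oddHaar_exists_epi hp (hz k) (B := B) πB.isPGroup (m := ml + k - l)
    (fun ψ x hx => by
      have h1 := map_mem_zassenhaus p ψ.toHom ψ.continuous_toHom i x hx
      rwa [hBi, Subgroup.mem_bot] at h1)
    πB.oddInvHoms_top ((relatorEpi r).minGenerators_eq_finrank hGo hFr).symm hk
    (fun φ hφσ hφ => ⟨(hker φ hφσ hφ).1, Nat.eq_sub_of_add_eq (hker φ hφσ hφ).2⟩)
    (by have := hφr.2; omega)
  rw [hmk, mul_assoc] at h
  rw [← h]
  congr 1
  ext s
  exact (Sch.mk_mem_basicOpen_iff i s r).trans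
    (sigmaIso_quotient_iff s (hz k) _ ((relatorEpi s).zassenhaus_eq_image i))

/-- The Zassenhaus filtration of the finite `p`-group `F_n / D` reaches the trivial subgroup. -/
theorem exists_zassenhaus_le {D : Subgroup (FreeProP p n)} [D.Normal]
    (hD : IsOpen (D : Set (FreeProP p n))) : ∃ i, 2 ≤ i ∧ zassenhaus p (FreeProP p n) i ≤ D := by
  have hd : DiscreteTopology (FreeProP p n ⧸ D) := QuotientGroup.discreteTopology hD
  have hfin : Finite (FreeProP p n ⧸ D) := D.quotient_finite_of_isOpen hD
  obtain ⟨i, hi, h⟩ := exists_zassenhaus_eq_bot p (FreeProP.isPGroup_quotient hD)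
  refine ⟨i, hi, fun x hx => ?_⟩
  have h1 := map_mem_zassenhaus p (QuotientGroup.mk' D) QuotientGroup.continuous_mk i x hx
  rw [h, Subgroup.mem_bot] at h1
  exact (QuotientGroup.eq_one_iff x).1 h1

namespace SigmaEpi

variable {G : Type*} [Group G] [TopologicalSpace G] [SigmaGroup G]
  [IsTopologicalGroup G] [T2Space G] {D : Subgroup (FreeProP p n)} [D.Normal] [IsSigmaInvariant D]

/-- A `σ`-automorphism of `F_n` compares the kernels of two epimorphisms from `F_n / D` to a group
with `n` generators. The statement is applied in both directions. -/
theorem finrank_invHoms_ker_le (hp : p ≠ 2) (hDo : IsOpen (D : Set (FreeProP p n)))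
    (hDa : ∀ α : SigmaAut (FreeProP p n), ∀ x ∈ D, α.1 x ∈ D)
    {B : Type*} [Group B] [TopologicalSpace B] [DiscreteTopology B] [SigmaGroup B]
    (hB : minGenerators B = n) {φ ψ : FreeProP p n ⧸ D →* B}
    (hφσ : ∀ x, φ (sigma x) = sigma (φ x)) (hφ : Function.Surjective φ)
    (hψσ : ∀ x, ψ (sigma x) = sigma (ψ x)) (hψ : Function.Surjective ψ) :
    Module.finrank (ZMod p) (invHoms p ψ.ker) ≤ Module.finrank (ZMod p) (invHoms p φ.ker) ∧
      (OddInvHoms p sigma φ.ker → OddInvHoms p sigma ψ.ker) := by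
  have hd : DiscreteTopology (FreeProP p n ⧸ D) := QuotientGroup.discreteTopology hDo
  have hfin : Finite (FreeProP p n ⧸ D) := D.quotient_finite_of_isOpen hDo
  let lift : ∀ φ : FreeProP p n ⧸ D →* B, (∀ x, φ (sigma x) = sigma (φ x)) →
      Function.Surjective φ → SigmaEpi p n B := fun φ hφσ hφ =>
    ⟨φ.comp (QuotientGroup.mk' D),
      (continuous_of_discreteTopology (f := φ)).comp QuotientGroup.continuous_mk,
      hφ.comp (QuotientGroup.mk'_surjective D), fun x => hφσ (QuotientGroup.mk x)⟩
  obtain ⟨α, hα⟩ := exists_aut hp (lift ψ hψσ hψ) (lift φ hφσ hφ) hB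
  let f : FreeProP p n ⧸ D →* FreeProP p n ⧸ D :=
    QuotientGroup.map D D (α.1 : FreeProP p n →* FreeProP p n) (hDa α)
  have hfψ : ∀ x, ψ (f x) = φ x := fun x => by
    induction x using QuotientGroup.induction_on with
    | H x => exact hα x
  have hf : Function.Surjective f := fun x => by
    obtain ⟨y, rfl⟩ := QuotientGroup.mk_surjective x
    obtain ⟨z, rfl⟩ := α.1.surjective y
    exact ⟨QuotientGroup.mk z, rfl⟩
  refine finrank_invHoms_le_of_map (σ₁ := sigma) (σ₂ := sigma) (f := f) (fun x => ?_) ?_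
    (fun x hx => ?_)
  · induction x using QuotientGroup.induction_on with
    | H x => exact congrArg QuotientGroup.mk (α.2 x)
  · ext y
    constructor
    · rintro ⟨x, hx, rfl⟩
      rw [MonoidHom.mem_ker, hfψ]
      exact hx
    · intro hy
      obtain ⟨x, rfl⟩ := hf y
      exact ⟨x, by rwa [SetLike.mem_coe, MonoidHom.mem_ker, ← hfψ], rfl⟩
  · rw [MonoidHom.mem_ker] at hx ⊢
    rw [hφσ, hx, map_one]

/-- The relation subgroup of a weak Schur `σ`-group: the invariant homomorphisms are odd, and there
are at most as many relations as generators. -/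
theorem invHoms_ker_map (hp : p ≠ 2) (π : SigmaEpi p n G)
    (hG : ∃ (k : ℕ) (r : Fin k → oddPart (FreeProP p k)), SigmaIso G (RelatorQuotient r))
    (hDo : IsOpen (D : Set (FreeProP p n))) :
    OddInvHoms p sigma (π.toHom.ker.map (QuotientGroup.mk' D)) ∧
      Module.finrank (ZMod p) (invHoms p (π.toHom.ker.map (QuotientGroup.mk' D))) ≤ n := by
  obtain ⟨i, hi, hiD⟩ := exists_zassenhaus_le hDo
  obtain ⟨l, r, e, he⟩ := hG
  have he' : ∀ x, e.symm (sigma x) = sigma (e.symm x) := fun x => by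
    rw [ContinuousMulEquiv.symm_apply_eq, he, ContinuousMulEquiv.apply_symm_apply]
  have hcomp : CompactSpace G := π.compactSpace
  let θ : SigmaEpi p l G := (relatorEpi r).trans e.symm he'
  have hθ : θ.toHom.ker = relators r := by
    rw [← ker_relatorEpi]
    ext x
    change e.symm ((relatorEpi r).toHom x) = 1 ↔ (relatorEpi r).toHom x = 1
    simp
  let B := G ⧸ zassenhaus p G i
  have hd : DiscreteTopology B := QuotientGroup.discreteTopology (π.isOpen_zassenhaus i)
  have hfin : Finite B := (π.quotient (zassenhaus p G i)).finite
  have h1 := invHoms_normalClosure_mk r ((SigmaEpi.refl p l).isOpen_zassenhaus i)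
    ((θ.ker_reduce _ (θ.zassenhaus_eq_image i)).trans (by rw [hθ]))
  have h2 := finrank_invHoms_ker_add hp hi (π.quotient (zassenhaus p G i)).isPGroup
    (zassenhaus_quotient_self i) (π.reduce _ (π.zassenhaus_eq_image i)) (π.reduce_sigma _ _)
    (π.reduce_surjective _ _) (θ.reduce _ (θ.zassenhaus_eq_image i)) (θ.reduce_sigma _ _)
    (θ.reduce_surjective _ _)
  have h3 := finrank_invHoms_le_of_map (p := p) (σ₁ := sigma) (σ₂ := sigma)
    (f := QuotientGroup.map (zassenhaus p (FreeProP p n) i) D (MonoidHom.id _) hiD)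
    (M₁ := (π.reduce _ (π.zassenhaus_eq_image i)).ker)
    (M₂ := π.toHom.ker.map (QuotientGroup.mk' D))
    (fun x => by
      induction x using QuotientGroup.induction_on with
      | H x => rfl)
    (by rw [π.ker_reduce, Subgroup.map_map]; rfl)
    (fun x hx => by
      rw [MonoidHom.mem_ker] at hx ⊢
      rw [π.reduce_sigma, hx, map_one])
  refine ⟨h3.2 (h2.2.2 h1.1), h3.1.trans (Nat.le_of_add_le_add_right (b := l) ?_)⟩
  rw [add_comm n l]
  exact h2.1.le.trans (Nat.add_le_add_right h1.2 n)

/-- An isomorphism between `H` and `G` induces isomorphisms between `H_D` and `G_D`. -/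
theorem sigmaIso_quot (hp : p ≠ 2) {H : Type*} [Group H] [TopologicalSpace H] [SigmaGroup H]
    [IsTopologicalGroup H] [T2Space H] (hDo : IsOpen (D : Set (FreeProP p n)))
    (hDa : ∀ α : SigmaAut (FreeProP p n), ∀ x ∈ D, α.1 x ∈ D)
    (hH : minGenerators H = n) (ρ : SigmaEpi p n G) (π : SigmaEpi p n H) (h : SigmaIso G H) :
    SigmaIso (ρ.Quot D) (π.Quot D) := by
  have hdρ : DiscreteTopology (ρ.Quot D) := QuotientGroup.discreteTopology (ρ.isOpenMap _ hDo)
  have hdπ : DiscreteTopology (π.Quot D) := QuotientGroup.discreteTopology (π.isOpenMap _ hDo)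
  obtain ⟨e, he⟩ := h
  let ρ' := ρ.trans e he
  refine sigmaIso_of_ker_eq (f := (ρ.quotient (ρ.image D)).toHom)
    (g := (QuotientGroup.mk' (π.image D)).comp ρ'.toHom) (ρ.quotient _).surjective
    ((QuotientGroup.mk'_surjective _).comp ρ'.surjective) (ρ.quotient _).map_sigma
    (fun x => by
      change (QuotientGroup.mk (ρ'.toHom (sigma x)) : H ⧸ π.image D) = _
      rw [ρ'.map_sigma]; rfl) ?_
  rw [ρ'.ker_comp_mk D (image_eq hp π ρ' hH hDa)]
  refine (ρ.ker_comp_mk D rfl).trans (congrArg (D ⊔ ·) ?_)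
  ext x
  change ρ.toHom x = 1 ↔ e (ρ.toHom x) = 1
  simp

/-- The measure of `U_{D,G}` under the measure with `n = d_G` generators. -/
theorem pi_oddHaar_measureSet (hp : p ≠ 2) (π : SigmaEpi p n G)
    (hG : ∃ (k : ℕ) (r : Fin k → oddPart (FreeProP p k)), SigmaIso G (RelatorQuotient r))
    (hdG : minGenerators G = n) (hDo : IsOpen (D : Set (FreeProP p n)))
    (hDf : D ≤ openFrattini (FreeProP p n))
    (hDa : ∀ α : SigmaAut (FreeProP p n), ∀ x ∈ D, α.1 x ∈ D) :
    (Measure.pi fun _ : Fin n => oddHaar p n) {s | Sch.mk s ∈ π.measureSet D} =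
      ENNReal.ofReal (schConst p n ^ 2 / (schConst p (n - π.relationNumber D) *
        (Nat.card (SigmaAut (π.Quot D)) : ℝ))) := by
  let B := π.Quot D
  have hBo : IsOpen (π.image D : Set G) := π.isOpenMap _ hDo
  have hd : DiscreteTopology B := QuotientGroup.discreteTopology hBo
  let πB : SigmaEpi p n B := π.quotient (π.image D)
  have hfin : Finite B := πB.finite
  have hdF : DiscreteTopology (FreeProP p n ⧸ D) := QuotientGroup.discreteTopology hDo
  have hfinF : Finite (FreeProP p n ⧸ D) := D.quotient_finite_of_isOpen hDo
  have hB : minGenerators B = n :=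
    (π.minGenerators_quotient hBo (π.image_le_openFrattini hDf)).trans hdG
  have h1 := π.invHoms_ker_map hp hG hDo
  have hrel : π.relationNumber D =
      Module.finrank (ZMod p) (invHoms p (π.toHom.ker.map (QuotientGroup.mk' D))) := by
    have : (π.toHom.ker.map (QuotientGroup.mk' D)).Normal :=
      Subgroup.Normal.map inferInstance _ (QuotientGroup.mk'_surjective D)
    exact minNormalGenerators_eq_finrank (FreeProP.isPGroup_quotient hDo)
  rw [← hrel] at h1
  have hφ0 : (π.reduce D rfl).ker = π.toHom.ker.map (QuotientGroup.mk' D) := π.ker_reduce D rfl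
  rw [← hφ0] at hrel h1
  have h := pi_oddHaar_exists_epi hp hDo (B := B) πB.isPGroup (m := π.relationNumber D)
    (fun ψ x hx => by
      obtain ⟨α, hα⟩ := exists_aut hp πB ψ hB
      rw [MonoidHom.mem_ker, ← hα]
      exact (QuotientGroup.eq_one_iff _).2 ⟨_, hDa α x hx, rfl⟩)
    πB.oddInvHoms_top (πB.minGenerators_eq_finrank_of_discrete.symm.trans hB) le_rfl
    (fun φ hφσ hφ => by
      have h2 := finrank_invHoms_ker_le hp hDo hDa hB hφσ hφ (π.reduce_sigma D rfl)
        (π.reduce_surjective D rfl)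
      have h3 := finrank_invHoms_ker_le hp hDo hDa hB (π.reduce_sigma D rfl)
        (π.reduce_surjective D rfl) hφσ hφ
      exact ⟨h3.2 h1.1, by rw [hrel]; exact le_antisymm h3.1 h2.1⟩)
    h1.2
  rw [Nat.sub_self, show schConst p 0 = 1 from rfl, one_mul] at h
  rw [← h]
  congr 1
  ext s
  refine Iff.trans ?_ (sigmaIso_quotient_iff s hDo ((relatorEpi s).image D) rfl)
  constructor
  · rintro ⟨k, s', hs, hs', π', hπ'⟩
    exact (sigmaIso_quot hp hDo hDa hs' (relatorEpi s) π' ((Sch.mk_eq_mk_iff s s').1 hs)).trans hπ'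
  · intro hs
    refine ⟨n, s, rfl, ?_, relatorEpi s, hs⟩
    rw [← (relatorEpi s).minGenerators_quotient ((relatorEpi s).isOpenMap _ hDo)
      ((relatorEpi s).image_le_openFrattini hDf), hs.minGenerators_eq, hB]

end SigmaEpi

theorem minGenerators_eq_of_sigmaIso_quotient {i : ℕ} (hi : 2 ≤ i)
    {s : Fin k → oddPart (FreeProP p k)} {r : Fin l → oddPart (FreeProP p l)}
    (h : SigmaIso (RelatorQuotient s ⧸ zassenhaus p (RelatorQuotient s) i)
        (RelatorQuotient r ⧸ zassenhaus p (RelatorQuotient r) i)) :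
    minGenerators (RelatorQuotient s) = minGenerators (RelatorQuotient r) := by
  rw [← (relatorEpi s).minGenerators_quotient ((relatorEpi s).isOpen_zassenhaus i)
    ((relatorEpi s).zassenhaus_le_openFrattini hi), h.minGenerators_eq,
    (relatorEpi r).minGenerators_quotient ((relatorEpi r).isOpen_zassenhaus i)
    ((relatorEpi r).zassenhaus_le_openFrattini hi)]

theorem Sch.isOpen_basicOpen {i : ℕ} (hi : 2 ≤ i) (r : Fin l → oddPart (FreeProP p l)) :
    IsOpen (Sch.basicOpen i r) :=
  TopologicalSpace.isOpen_generateFrom_of_mem ⟨i, hi, l, r, rfl⟩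

omit [Fact p.Prime] in
theorem Sch.exists_rep (c : Sch p) : ∃ (k : ℕ) (s : Fin k → oddPart (FreeProP p k)),
    Sch.mk s = c := by
  induction c using Quotient.inductionOn with
  | h a => exact ⟨a.1, a.2, rfl⟩

/-- The set `U_{D,G}` is open because `D` contains a step of the Zassenhaus filtration. -/
theorem SigmaEpi.isOpen_measureSet {G : Type*} [Group G] [TopologicalSpace G] [SigmaGroup G]
    {D : Subgroup (FreeProP p n)} [D.Normal]
    [IsSigmaInvariant D] (hp : p ≠ 2) (π : SigmaEpi p n G)
    (hDo : IsOpen (D : Set (FreeProP p n)))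
    (hDa : ∀ α : SigmaAut (FreeProP p n), ∀ x ∈ D, α.1 x ∈ D) : IsOpen (π.measureSet D) := by
  obtain ⟨i, hi, hiD⟩ := exists_zassenhaus_le hDo
  rw [isOpen_iff_forall_mem_open]
  rintro _ ⟨k, s, rfl, hs, π', hπ'⟩
  refine ⟨Sch.basicOpen i s, ?_, Sch.isOpen_basicOpen hi s,
    (Sch.mk_mem_basicOpen_iff i s s).2 (SigmaIso.refl _)⟩
  rintro _ ⟨k', s', rfl, h⟩
  have hs' : minGenerators (RelatorQuotient s') = n :=
    (minGenerators_eq_of_sigmaIso_quotient hi h).trans hs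
  have hΓ := (π'.minGenerators_quotient (π'.isOpen_zassenhaus i)
    (π'.zassenhaus_le_openFrattini hi)).trans hs
  obtain ⟨ρ⟩ := (relatorEpi s').exists_of_minGenerators_le hp hs'.le
  refine ⟨k', s', rfl, hs', ρ, SigmaIso.trans ?_ hπ'⟩
  have hd1 : DiscreteTopology (ρ.Quot D) := QuotientGroup.discreteTopology (ρ.isOpenMap _ hDo)
  have hd2 : DiscreteTopology (π'.Quot D) := QuotientGroup.discreteTopology (π'.isOpenMap _ hDo)
  obtain ⟨e, he⟩ := h
  have hd3 : DiscreteTopology (RelatorQuotient s ⧸ zassenhaus p (RelatorQuotient s) i) :=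
    QuotientGroup.discreteTopology (π'.isOpen_zassenhaus i)
  obtain ⟨α, hα⟩ := exists_aut hp ((ρ.quotient (zassenhaus p (RelatorQuotient s') i)).trans e he)
    (π'.quotient (zassenhaus p (RelatorQuotient s) i)) hΓ
  let ρ' := ρ.precomp α
  refine sigmaIso_of_ker_eq (f := (QuotientGroup.mk' (ρ.image D)).comp ρ'.toHom)
    (g := (QuotientGroup.mk' (π'.image D)).comp π'.toHom)
    ((QuotientGroup.mk'_surjective _).comp ρ'.surjective)
    ((QuotientGroup.mk'_surjective _).comp π'.surjective)
    (fun x => by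
      change (QuotientGroup.mk (ρ'.toHom (sigma x)) : _ ⧸ ρ.image D) = _
      rw [ρ'.map_sigma]; rfl)
    (π'.quotient (π'.image D)).map_sigma ?_
  rw [ρ'.ker_comp_mk D (image_eq hp ρ ρ' hs' hDa), π'.ker_comp_mk D rfl]
  have h1 : zassenhaus p (FreeProP p n) i ⊔ ρ'.toHom.ker =
      zassenhaus p (FreeProP p n) i ⊔ π'.toHom.ker := by
    rw [← ρ'.ker_comp_mk _ (ρ'.zassenhaus_eq_image i),
      ← π'.ker_comp_mk _ (π'.zassenhaus_eq_image i)]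
    ext x
    have h2 : e (QuotientGroup.mk (ρ'.toHom x)) = QuotientGroup.mk (π'.toHom x) := hα x
    change (QuotientGroup.mk (ρ'.toHom x) : _ ⧸ zassenhaus p (RelatorQuotient s') i) = 1 ↔
      (QuotientGroup.mk (π'.toHom x) : _ ⧸ zassenhaus p (RelatorQuotient s) i) = 1
    rw [← h2]
    simp
  rw [← sup_eq_left.2 hiD, sup_assoc, h1, sup_assoc]

end formulas

/-! ### The topology of `Sch` -/

section topology

variable {p : ℕ} [Fact p.Prime] {k l : ℕ}

/-- The class of `G_s / D_i` depends only on the residue classes of `s` modulo `D_i`. -/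
theorem Sch.basicOpen_eq_of_mk_eq (i : ℕ) {r s : Fin l → oddPart (FreeProP p l)}
    (h : ∀ j, (QuotientGroup.mk (r j : FreeProP p l) : ZQuotient p l i) =
      QuotientGroup.mk (s j : FreeProP p l)) : Sch.basicOpen i r = Sch.basicOpen i s := by
  have hz := (SigmaEpi.refl p l).isOpen_zassenhaus i
  have hd : ∀ s : Fin l → oddPart (FreeProP p l),
      DiscreteTopology (RelatorQuotient s ⧸ zassenhaus p (RelatorQuotient s) i) := fun s =>
    QuotientGroup.discreteTopology ((relatorEpi s).isOpen_zassenhaus i)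
  have h1 : SigmaIso (RelatorQuotient r ⧸ zassenhaus p (RelatorQuotient r) i)
      (RelatorQuotient s ⧸ zassenhaus p (RelatorQuotient s) i) := by
    have h2 := (sigmaIso_quotient_iff s hz _ ((relatorEpi s).zassenhaus_eq_image i)).1
      (SigmaIso.refl _)
    rw [sigmaIso_quotient_iff r hz _ ((relatorEpi r).zassenhaus_eq_image i), funext h]
    exact h2
  ext c
  obtain ⟨k, t, rfl⟩ := c.exists_rep
  rw [Sch.mk_mem_basicOpen_iff, Sch.mk_mem_basicOpen_iff]
  exact ⟨fun h => h.trans h1, fun h => h.trans h1.symm⟩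

variable (p) in
/-- The sets `U_{i,G}` that generate the topology. -/
def Sch.basis : Set (Set (Sch p)) :=
  {U | ∃ (i : ℕ) (_ : 2 ≤ i) (n : ℕ) (r : Fin n → oddPart (FreeProP p n)), U = basicOpen i r}

theorem Sch.countable_basis : (Sch.basis p).Countable := by
  have h : Sch.basis p ⊆ ⋃ (i : ℕ) (l : ℕ),
      Set.range (Sch.basicOpen i : (Fin l → oddPart (FreeProP p l)) → Set (Sch p)) := by
    rintro _ ⟨i, -, l, r, rfl⟩
    exact Set.mem_iUnion₂.2 ⟨i, l, r, rfl⟩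
  refine (Set.countable_iUnion fun i => Set.countable_iUnion fun l => ?_).mono h
  let q : (Fin l → oddPart (FreeProP p l)) → Fin l → ZQuotient p l i := fun r j =>
    QuotientGroup.mk (r j : FreeProP p l)
  have hq : (Sch.basicOpen i : (Fin l → oddPart (FreeProP p l)) → Set (Sch p)).FactorsThrough q :=
    fun r s hrs => Sch.basicOpen_eq_of_mk_eq i (congrFun hrs)
  refine (Set.finite_range (Function.extend q (Sch.basicOpen i) fun _ => ∅)).countable.mono ?_
  rintro _ ⟨r, rfl⟩
  exact ⟨q r, hq.extend_apply _ r⟩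

instance : SecondCountableTopology (Sch p) := ⟨⟨Sch.basis p, Sch.countable_basis, rfl⟩⟩

theorem Sch.borel_eq_generateFrom_basis :
    (inferInstance : MeasurableSpace (Sch p)) = MeasurableSpace.generateFrom (Sch.basis p) :=
  borel_eq_generateFrom_of_subbasis rfl

/-- Two of the sets `U_{i,G}` are disjoint or contained in one another. -/
theorem Sch.isPiSystem_basis : IsPiSystem (Sch.basis p) := by
  have key : ∀ {i j : ℕ} (_ : i ≤ j) {k l : ℕ} (r : Fin k → oddPart (FreeProP p k))
      (s : Fin l → oddPart (FreeProP p l)), (Sch.basicOpen i r ∩ Sch.basicOpen j s).Nonempty →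
      Sch.basicOpen j s ⊆ Sch.basicOpen i r := by
    rintro i j hij k l r s ⟨c, hcr, hcs⟩ c' hc'
    obtain ⟨m, t, rfl⟩ := c.exists_rep
    obtain ⟨m', t', rfl⟩ := c'.exists_rep
    rw [Sch.mk_mem_basicOpen_iff] at hcr hcs hc' ⊢
    exact ((hc'.trans hcs.symm).zassenhaus_quotient_of_le (relatorEpi t') (relatorEpi t) hij).trans
      hcr
  rintro _ ⟨i, hi, k, r, rfl⟩ _ ⟨j, hj, l, s, rfl⟩ h
  rcases le_total i j with hij | hij
  · rw [Set.inter_eq_right.2 (key hij r s h)]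
    exact ⟨j, hj, l, s, rfl⟩
  · rw [Set.inter_comm] at h
    rw [Set.inter_eq_left.2 (key hij s r h)]
    exact ⟨i, hi, k, r, rfl⟩

theorem Sch.sUnion_basis : ⋃₀ Sch.basis p = Set.univ := by
  refine Set.eq_univ_of_forall fun c => ?_
  obtain ⟨k, r, rfl⟩ := c.exists_rep
  exact ⟨_, ⟨2, le_rfl, k, r, rfl⟩, (Sch.mk_mem_basicOpen_iff 2 r r).2 (SigmaIso.refl _)⟩

theorem Sch.continuous_mk :
    Continuous (Sch.mk : (Fin k → oddPart (FreeProP p k)) → Sch p) := by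
  rw [continuous_generateFrom_iff]
  rintro _ ⟨i, -, l, r, rfl⟩
  have hz := (SigmaEpi.refl p k).isOpen_zassenhaus i
  have hd : DiscreteTopology (RelatorQuotient r ⧸ zassenhaus p (RelatorQuotient r) i) :=
    QuotientGroup.discreteTopology ((relatorEpi r).isOpen_zassenhaus i)
  let q : (Fin k → oddPart (FreeProP p k)) → Fin k → ZQuotient p k i := fun s j =>
    QuotientGroup.mk (s j : FreeProP p k)
  have hq : Continuous q := continuous_pi fun j =>
    QuotientGroup.continuous_mk.comp (continuous_subtype_val.comp (continuous_apply j))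
  have h : Sch.mk ⁻¹' Sch.basicOpen i r = q ⁻¹' {A | ∃ φ : ZQuotient p k i →*
      RelatorQuotient r ⧸ zassenhaus p (RelatorQuotient r) i, (∀ x, φ (sigma x) = sigma (φ x)) ∧
        Function.Surjective φ ∧ φ.ker = Subgroup.normalClosure (Set.range A)} := by
    ext s
    exact (Sch.mk_mem_basicOpen_iff i s r).trans
      (sigmaIso_quotient_iff s hz _ ((relatorEpi s).zassenhaus_eq_image i))
  rw [h]
  exact (isOpen_discrete _).preimage hq

theorem schMeasure_apply {A : Set (Sch p)} (hA : MeasurableSet A) :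
    schMeasure p k A = (Measure.pi fun _ : Fin k => oddHaar p k) {s | Sch.mk s ∈ A} :=
  Measure.map_apply Sch.continuous_mk.measurable hA

theorem isProbabilityMeasure_schMeasure (hp : p ≠ 2) : IsProbabilityMeasure (schMeasure p k) := by
  have := isProbabilityMeasure_oddHaar (p := p) (n := k) hp
  exact Measure.isProbabilityMeasure_map Sch.continuous_mk.measurable.aemeasurable

variable (p) in
/-- The set of all classes `[G]` with `d_G = n`. -/
def Sch.rankSet (n : ℕ) : Set (Sch p) :=
  {c | ∃ (k : ℕ) (s : Fin k → oddPart (FreeProP p k)), c = mk s ∧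
    minGenerators (RelatorQuotient s) = n}

omit [Fact p.Prime] in
theorem Sch.mk_mem_rankSet_iff (s : Fin k → oddPart (FreeProP p k)) (n : ℕ) :
    Sch.mk s ∈ Sch.rankSet p n ↔ minGenerators (RelatorQuotient s) = n := by
  constructor
  · rintro ⟨l, r, h, hr⟩
    rw [((Sch.mk_eq_mk_iff s r).1 h).minGenerators_eq, hr]
  · exact fun h => ⟨k, s, rfl, h⟩

theorem Sch.basicOpen_subset_rankSet {i : ℕ} (hi : 2 ≤ i) (r : Fin l → oddPart (FreeProP p l)) :
    Sch.basicOpen i r ⊆ Sch.rankSet p (minGenerators (RelatorQuotient r)) := by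
  rintro _ ⟨k, s, rfl, h⟩
  exact ⟨k, s, rfl, minGenerators_eq_of_sigmaIso_quotient hi h⟩

theorem Sch.isOpen_rankSet (n : ℕ) : IsOpen (Sch.rankSet p n) := by
  rw [isOpen_iff_forall_mem_open]
  rintro _ ⟨k, s, rfl, rfl⟩
  exact ⟨_, Sch.basicOpen_subset_rankSet le_rfl s, Sch.isOpen_basicOpen le_rfl s,
    (Sch.mk_mem_basicOpen_iff 2 s s).2 (SigmaIso.refl _)⟩

omit [Fact p.Prime] in
theorem Sch.disjoint_rankSet : Pairwise (Function.onFun Disjoint (Sch.rankSet p)) := by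
  intro m n hmn
  refine Set.disjoint_left.2 fun c hm hn => hmn ?_
  obtain ⟨k, s, rfl⟩ := c.exists_rep
  rw [Sch.mk_mem_rankSet_iff] at hm hn
  exact hm.symm.trans hn

omit [Fact p.Prime] in
theorem Sch.iUnion_rankSet : ⋃ n, Sch.rankSet p n = Set.univ := by
  refine Set.eq_univ_of_forall fun c => ?_
  obtain ⟨k, s, rfl⟩ := c.exists_rep
  exact Set.mem_iUnion.2 ⟨_, (Sch.mk_mem_rankSet_iff s _).2 rfl⟩

end topology

/-! ### The constants `C_k` -/

section constants

variable {p : ℕ}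

theorem schConst_le_one (k : ℕ) [Fact p.Prime] : schConst p k ≤ 1 := by
  induction k with
  | zero => exact le_rfl
  | succ k ih =>
    rw [schConst_succ]
    have h : (0 : ℝ) ≤ ((p : ℝ) ^ (k + 1))⁻¹ := by positivity
    exact (mul_le_of_le_one_right (schConst_pos k).le (sub_le_self 1 h)).trans ih

/-- The constants `C_k` are bounded below, uniformly in `k`. -/
theorem half_le_schConst (hp : 3 ≤ p) (k : ℕ) : 1 / 2 ≤ schConst p k := by
  have hp' : (3 : ℝ) ≤ p := by exact_mod_cast hp
  have hx0 : (0 : ℝ) < (p : ℝ)⁻¹ := by positivity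
  have hx : (p : ℝ)⁻¹ ≤ 1 / 3 := by
    rw [inv_le_comm₀ (by linarith) (by norm_num)]
    norm_num
    exact hp
  -- the summand `p⁻ᵏ / 2` makes the induction work
  suffices h : 1 / 2 + ((p : ℝ)⁻¹) ^ k / 2 ≤ schConst p k by
    have : 0 ≤ ((p : ℝ)⁻¹) ^ k := by positivity
    linarith
  induction k with
  | zero => norm_num [schConst]
  | succ k ih =>
    rw [schConst_succ, ← inv_pow]
    have hy0 : 0 ≤ ((p : ℝ)⁻¹) ^ k := by positivity
    have hy1 : ((p : ℝ)⁻¹) ^ k ≤ 1 := pow_le_one₀ hx0.le (by linarith)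
    have h1 : ((p : ℝ)⁻¹) ^ (k + 1) ≤ 1 / 3 * ((p : ℝ)⁻¹) ^ k := by
      rw [pow_succ, mul_comm]
      exact mul_le_mul_of_nonneg_right hx hy0
    have h2 : 0 ≤ ((p : ℝ)⁻¹) ^ (k + 1) := by positivity
    have h3 := mul_le_mul_of_nonneg_right ih (show 0 ≤ 1 - ((p : ℝ)⁻¹) ^ (k + 1) by linarith)
    nlinarith

theorem tendsto_schConst [hp : Fact p.Prime] :
    Tendsto (schConst p) atTop (𝓝 (schConstInf p)) := by
  have h1 : ∀ k, schConst p k = ∏ i ∈ Finset.range k, (1 - ((p : ℝ) ^ (i + 1))⁻¹) := by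
    intro k
    induction k with
    | zero => rfl
    | succ k ih => rw [schConst_succ, ih, Finset.prod_range_succ]
  have hx : (p : ℝ)⁻¹ < 1 := inv_lt_one_of_one_lt₀ (by exact_mod_cast hp.out.one_lt)
  have h2 : Summable fun i : ℕ => ‖-((p : ℝ) ^ (i + 1))⁻¹‖ := by
    have h3 := (summable_geometric_of_lt_one (by positivity) hx).mul_right (p : ℝ)⁻¹
    refine h3.congr fun i => ?_
    rw [norm_neg, norm_inv, norm_pow, Real.norm_natCast, pow_succ, mul_inv, inv_pow]
  have h4 := (multipliable_one_add_of_summable h2).hasProd.tendsto_prod_nat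
  simp only [← sub_eq_add_neg] at h4
  exact h4.congr fun k => (h1 k).symm

theorem half_le_schConstInf [Fact p.Prime] (hp : 3 ≤ p) : 1 / 2 ≤ schConstInf p :=
  ge_of_tendsto' tendsto_schConst (half_le_schConst hp)

end constants

/-! ### The limit measure -/

section limit

variable {p : ℕ} [Fact p.Prime]

/-- On the set of all classes with `d_G = n` the measures `μ_k` for `k ≥ n` are proportional. -/
theorem schMeasure_restrict_rankSet (hp : p ≠ 2) {n k : ℕ} (hnk : n ≤ k) :
    (schMeasure p k).restrict (Sch.rankSet p n) =
      ENNReal.ofReal (schConst p k ^ 2 / (schConst p (k - n) * schConst p n ^ 2)) •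
        (schMeasure p n).restrict (Sch.rankSet p n) := by
  have := isProbabilityMeasure_schMeasure (p := p) (k := k) hp
  refine Measure.ext_of_generateFrom_of_cover_subset Sch.borel_eq_generateFrom_basis
    Sch.isPiSystem_basis subset_rfl Sch.countable_basis Sch.sUnion_basis
    (fun s _ => measure_ne_top _ s) ?_
  rintro _ ⟨i, hi, l, r, rfl⟩
  have hA := (Sch.isOpen_basicOpen hi r).measurableSet
  have hsub := Sch.basicOpen_subset_rankSet hi r
  rw [Measure.smul_apply, Measure.restrict_apply hA, Measure.restrict_apply hA, smul_eq_mul]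
  by_cases hr : minGenerators (RelatorQuotient r) = n
  · obtain ⟨c, hc, h⟩ := exists_pi_oddHaar_basicOpen hp hi r
    rw [hr] at h hsub
    rw [Set.inter_eq_left.2 hsub, schMeasure_apply hA, schMeasure_apply hA, h k hnk, h n le_rfl]
    have h1 := schConst_pos (p := p) k
    have h2 := schConst_pos (p := p) (k - n)
    have h3 := schConst_pos (p := p) n
    rw [← ENNReal.ofReal_mul (by positivity), Nat.sub_self, show schConst p 0 = 1 from rfl]
    congr 1
    field_simp
  · have h0 : Sch.basicOpen i r ∩ Sch.rankSet p n = ∅ := by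
      rw [← Set.disjoint_iff_inter_eq_empty]
      exact (Sch.disjoint_rankSet hr).mono_left hsub
    rw [h0, measure_empty, measure_empty, mul_zero]

theorem schMeasure_inter_rankSet (hp : p ≠ 2) {n k : ℕ} (hnk : n ≤ k) {A : Set (Sch p)}
    (hA : MeasurableSet A) : schMeasure p k (A ∩ Sch.rankSet p n) =
      ENNReal.ofReal (schConst p k ^ 2 / (schConst p (k - n) * schConst p n ^ 2)) *
        schMeasure p n (A ∩ Sch.rankSet p n) := by
  rw [← Measure.restrict_apply hA, ← Measure.restrict_apply hA,
    schMeasure_restrict_rankSet hp hnk, Measure.smul_apply, smul_eq_mul]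

theorem schMeasure_rankSet_of_lt {n k : ℕ} (hkn : k < n) :
    schMeasure p k (Sch.rankSet p n) = 0 := by
  rw [schMeasure_apply (Sch.isOpen_rankSet n).measurableSet]
  refine (congrArg _ (Set.eq_empty_of_forall_notMem fun s hs => ?_)).trans measure_empty
  have h1 := (Sch.mk_mem_rankSet_iff s n).1 hs
  have h2 := (relatorEpi s).minGenerators_le
  omega

/-- The limit of `μ_k(A)` for sets `A` on which `d_G = n`. -/
theorem tendsto_schMeasure_inter_rankSet (hp : p ≠ 2) (n : ℕ) {A : Set (Sch p)}
    (hA : MeasurableSet A) :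
    Tendsto (fun k => schMeasure p k (A ∩ Sch.rankSet p n)) atTop
      (𝓝 (ENNReal.ofReal (schConstInf p / schConst p n ^ 2) *
        schMeasure p n (A ∩ Sch.rankSet p n))) := by
  have := isProbabilityMeasure_schMeasure (p := p) (k := n) hp
  have hp3 : 3 ≤ p := by have := (Fact.out : p.Prime).two_le; omega
  have hC := half_le_schConstInf hp3
  have h1 : Tendsto (fun k => schConst p k ^ 2 / (schConst p (k - n) * schConst p n ^ 2)) atTop
      (𝓝 (schConstInf p ^ 2 / (schConstInf p * schConst p n ^ 2))) :=
    (tendsto_schConst.pow 2).div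
      ((tendsto_schConst.comp (tendsto_sub_atTop_nat n)).mul_const _)
      (mul_ne_zero (by linarith) (pow_ne_zero _ (schConst_pos n).ne'))
  have h2 : schConstInf p ^ 2 / (schConstInf p * schConst p n ^ 2) =
      schConstInf p / schConst p n ^ 2 := by
    rw [sq (schConstInf p), mul_div_mul_left _ _ (by linarith)]
  rw [h2] at h1
  refine (ENNReal.Tendsto.mul_const (ENNReal.tendsto_ofReal h1)
    (Or.inr (measure_ne_top _ _))).congr' ?_
  filter_upwards [eventually_ge_atTop n] with k hk
  rw [schMeasure_inter_rankSet hp hk hA]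

/-- The uniform bound that allows passing to the limit: the total mass of the measures `μ_n` on the
sets of classes with `d_G = n` is finite. -/
theorem tsum_schMeasure_rankSet_le (hp : p ≠ 2) :
    ∑' n, schMeasure p n (Sch.rankSet p n) ≤ 4 := by
  have hp3 : 3 ≤ p := by have := (Fact.out : p.Prime).two_le; omega
  refine ENNReal.tsum_le_of_sum_range_le fun N => ?_
  have := isProbabilityMeasure_schMeasure (p := p) (k := N) hp
  have h1 : ∀ n ∈ Finset.range N, schMeasure p n (Sch.rankSet p n) ≤
      4 * schMeasure p N (Sch.rankSet p n) := by
    intro n hn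
    have h2 := schMeasure_inter_rankSet hp (Finset.mem_range.1 hn).le
      (MeasurableSet.univ (α := Sch p))
    rw [Set.univ_inter] at h2
    rw [h2, ← mul_assoc]
    refine le_mul_of_one_le_left' ?_
    rw [← ENNReal.ofReal_ofNat, ← ENNReal.ofReal_mul (by norm_num), ENNReal.one_le_ofReal]
    have hN := half_le_schConst hp3 N
    have h3 := schConst_pos (p := p) (N - n)
    have h4 := schConst_pos (p := p) n
    rw [← mul_div_assoc, one_le_div (by positivity)]
    have h5 : schConst p (N - n) * schConst p n ^ 2 ≤ 1 :=
      mul_le_one₀ (schConst_le_one _) (by positivity) (pow_le_one₀ h4.le (schConst_le_one _))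
    nlinarith
  refine (Finset.sum_le_sum h1).trans ?_
  rw [← Finset.mul_sum, ← measure_biUnion_finset
    (fun i _ j _ hij => Sch.disjoint_rankSet hij)
    (fun n _ => (Sch.isOpen_rankSet n).measurableSet)]
  exact mul_le_of_le_one_right' prob_le_one

/-- The limit measure exists: by dominated convergence, the limit can be taken separately on each of
the sets of classes with `d_G = n`. -/
theorem exists_tendsto_schMeasure (hp : p ≠ 2) : ∃ μ : Measure (Sch p), ∀ A : Set (Sch p),
    MeasurableSet A → Tendsto (fun n => schMeasure p n A) atTop (𝓝 (μ A)) := by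
  have hp3 : 3 ≤ p := by have := (Fact.out : p.Prime).two_le; omega
  have hT := fun n => (Sch.isOpen_rankSet (p := p) n).measurableSet
  refine ⟨Measure.sum fun n => ENNReal.ofReal (schConstInf p / schConst p n ^ 2) •
    (schMeasure p n).restrict (Sch.rankSet p n), fun A hA => ?_⟩
  rw [Measure.sum_apply _ hA]
  have h1 : ∀ k, schMeasure p k A = ∑' n, schMeasure p k (A ∩ Sch.rankSet p n) := fun k => by
    rw [← measure_iUnion
      (fun i j hij => (Sch.disjoint_rankSet hij).mono Set.inter_subset_right Set.inter_subset_right)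
      (fun n => hA.inter (hT n)), ← Set.inter_iUnion, Sch.iUnion_rankSet, Set.inter_univ]
  simp only [h1, Measure.smul_apply, Measure.restrict_apply hA, smul_eq_mul, ← lintegral_count]
  refine tendsto_lintegral_of_dominated_convergence
    (fun n => 8 * schMeasure p n (Sch.rankSet p n)) (fun _ => measurable_of_countable _)
    (fun k => ae_of_all _ fun n => ?_) ?_
    (ae_of_all _ fun n => tendsto_schMeasure_inter_rankSet hp n hA)
  · refine (measure_mono Set.inter_subset_right).trans ?_
    rcases lt_or_ge k n with h | h
    · rw [schMeasure_rankSet_of_lt h]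
      exact zero_le
    · have h2 := schMeasure_inter_rankSet hp h (MeasurableSet.univ (α := Sch p))
      rw [Set.univ_inter] at h2
      rw [h2]
      refine mul_le_mul' ?_ le_rfl
      rw [← ENNReal.ofReal_ofNat]
      refine ENNReal.ofReal_le_ofReal ?_
      have hn := half_le_schConst hp3 n
      have hkn := half_le_schConst hp3 (k - n)
      have hk := schConst_le_one (p := p) k
      have hk0 := schConst_pos (p := p) k
      have h3 : 1 / 4 ≤ schConst p n ^ 2 := by nlinarith
      have h4 : 1 / 8 ≤ schConst p (k - n) * schConst p n ^ 2 := by nlinarith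
      rw [div_le_iff₀ (by linarith)]
      nlinarith
  · rw [lintegral_count, ENNReal.tsum_mul_left]
    exact (ENNReal.mul_lt_top (by simp)
      ((tsum_schMeasure_rankSet_le hp).trans_lt (by simp))).ne

theorem tendsto_schMeasureLim (hp : p ≠ 2) {A : Set (Sch p)} (hA : MeasurableSet A) :
    Tendsto (fun n => schMeasure p n A) atTop (𝓝 (schMeasureLim p A)) := by
  rw [schMeasureLim, dif_pos (exists_tendsto_schMeasure hp)]
  exact (exists_tendsto_schMeasure hp).choose_spec A hA

end limit

theorem mainTheorem2 (p : ℕ) [Fact p.Prime] (hp : p ≠ 2) (n : ℕ)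
    (D : Subgroup (FreeProP p n)) [D.Normal] [IsSigmaInvariant D]
    (hD_open : IsOpen (D : Set (FreeProP p n)))
    (hD_frattini : D ≤ openFrattini (FreeProP p n))
    (hD_aut : ∀ α : SigmaAut (FreeProP p n), ∀ x ∈ D, α.1 x ∈ D)
    (G : Type*) [Group G] [TopologicalSpace G] [SigmaGroup G]
    (hG : IsWeakSchur p G) (hdG : minGenerators G = n) :
    Nonempty (SigmaEpi p n G) ∧
      ∀ π : SigmaEpi p n G,
        MeasurableSet (π.measureSet D) ∧
        schMeasureLim p (π.measureSet D) =
          ENNReal.ofReal (schConstInf p / schConst p (n - π.relationNumber D) *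
            (1 / (Nat.card (SigmaAut (π.Quot D)) : ℝ))) := by
  have hprop := hG.isProP
  have hiso := hG.exists_iso
  have htop : IsTopologicalGroup G := hprop.toIsTopologicalGroup
  have hT2 : T2Space G := hprop.toT2Space
  refine ⟨?_, fun π => ?_⟩
  · obtain ⟨l, r, e, he⟩ := hiso.imp fun _ h => h.imp fun _ h => h.symm
    exact ((relatorEpi r).trans e he).exists_of_minGenerators_le hp hdG.le
  · have hU := (π.isOpen_measureSet hp hD_open hD_aut).measurableSet
    refine ⟨hU, ?_⟩
    -- all classes in `U_{D,G}` have `d_H = n`, so that `μ_∞` is `(C_∞ / C_n²) μ_n` there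
    have hsub : π.measureSet D ⊆ Sch.rankSet p n := fun c ⟨k, s, hc, hs, _⟩ => ⟨k, s, hc, hs⟩
    have h1 := tendsto_schMeasure_inter_rankSet hp n hU
    rw [Set.inter_eq_left.2 hsub] at h1
    rw [tendsto_nhds_unique (tendsto_schMeasureLim hp hU) h1, schMeasure_apply hU,
      π.pi_oddHaar_measureSet hp hiso hdG hD_open hD_frattini hD_aut]
    have hp3 : 3 ≤ p := by have := (Fact.out : p.Prime).two_le; omega
    have hC := half_le_schConstInf hp3
    have hn := schConst_pos (p := p) n
    rw [← ENNReal.ofReal_mul (div_nonneg (by linarith) (by positivity))]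
    congr 1
    have := (schConst_pos (p := p) (n - π.relationNumber D)).ne'
    field_simp
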